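/- **Setting.** Let $D\subset\mathbb R^d$ be open and connected (nonempty), $U=\mathbb R^N$, $1\le p<\infty$, $T\in(0,\infty]$. All measurability, "a.e." and integrals in $t$ and $x$ refer to Lebesgue measure. $C_0(U^k)$ is the space of continuous functions vanishing at infinity, $\mathcal M(U^k)$ the space of finite signed Radon measures, $\langle\nu,f\rangle=\int f\,d\nu$, $B_r(x)=\{y\in D:|x-y|<r\}$ is the ball in $D$. For a family of measures $\nu^2_{x,y}$ on $U^2$, $(x,y)\in D^2$, put $$\omega^p_r(\nu^2)=\int_D \frac1{|B_r(x)|}\int_{B_r(x)}\langle\nu^2_{x,y},|\xi_1-\xi_2|^p\rangle\,dy\,dx .$$ *Correlation measures.* $\mathcal L^p(D;U)$ is the set of sequences $\boldsymbol\nu=(\nu^1,\nu^2,\dots)$ of essentially bounded weak* measurable maps $\nu^k:D^k\to\mathcal M(U^k)$ (i.e. $\nu^k\in L^\infty_w(D^k;\mathcal M(U^k))$) such that for all $k\ge1$: (a) $\nu^k_x$ is a probability measure for a.e. $x\in D^k$ and $x\mapsto\langle\nu^k_x,f\rangle$ is measurable for every bounded continuous $f$ on $U^k$; (b) for every permutation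 $\sigma$ of $\{1,\dots,k\}$ and every $f\in C_0(U^k)$, $\int f(\xi)\,d\nu^k_{(x_{\sigma(1)},\dots,x_{\sigma(k)})}(\xi)=\int f(\xi_{\sigma(1)},\dots,\xi_{\sigma(k)})\,d\nu^k_x(\xi)$ for a.e. $x\in D^k$; (c) for every $f\in C_0(U^k)$, $\int f(\xi_1,\dots,\xi_k)\,d\nu^{k+1}_{x_1,\dots,x_{k+1}}(\xi)=\langle\nu^k_{x_1,\dots,x_k},f\rangle$ for a.e. $x\in D^{k+1}$; (d) $\int_D\langle\nu^1_x,|\xi|^p\rangle\,dx<\infty$; (e) $\lim_{r\to0}\omega^p_r(\nu^2)=0$. *Time-dependent correlation measures.* $\mathcal L^p([0,T),D;U)$ is the set of sequences $\boldsymbol\nu=(\nu^1,\nu^2,\dots)$ with $\nu^k\in L^\infty_w([0,T)\times D^k;\mathcal M(U^k))$ such that $\boldsymbol\nu_t=(\nu^1_t,\nu^2_t,\dots)\in\mathcal L^p(D;U)$ for a.e. $t\in[0,T)$, $\operatorname{ess\,sup}_{t\in[0,T)}\int_D\langle\nu^1_{t,x},|\xi|^p\rangle\,dx<\infty$, and $\lim_{r\to0}\int_0^{T'}\omega^p_r(\nu^2_t)\,dt=0$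 for all $T'\in(0,T)$. *Pairing and duality.* For $g\in L^1([0,T)\times D^k;C_0(U^k))$, or $g\ge0$ measurable (with value in $[0,\infty]$), $\langle\nu^k,g\rangle=\int_0^T\int_{D^k}\langle\nu^k_{t,x},g(t,x,\cdot)\rangle\,dx\,dt$. A map $\mu:t\mapsto\mu_t$ from $[0,T)$ to the Borel probability measures on $L^p(D;U)$ is dual to $\boldsymbol\nu$ if, for a.e. $t$, for all $k\ge1$ and all $g\in L^1(D^k;C_0(U^k))$, $\int_{D^k}\langle\nu^k_{t,x},g(x)\rangle\,dx=\int_{L^p}\int_{D^k}g(x,u(x_1),\dots,u(x_k))\,dx\,d\mu_t(u)$. *Observables.* $\mathcal H^{k,p}$ ($k\ge0$) is the set of functions $g:[0,T)\times D^k\times U^k\to\mathbb R$ that are continuous in $\xi$ for a.e. $(t,x)$ and measurable in $(t,x)$ for every $\xi$, such that, for some nonnegative $\phi_i\in L^\infty([0,T);L^1(D^i))$, $0\le i\le k$ (with $L^1(D^0)=\mathbb R$), for a.e. $t$ and all $x\in D^k$, $\xi\in U^k$, $$|g(t,x,\xi)|\le\sum_{A\subset\{1,\dots,k\}}\phi_{k-|A|}\big(t,(x_i)_{i\notin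 A}\big)\prod_{i\in A}|\xi_i|^p .$$ For $k\ge1$, $\mathcal H^{k,p}_1$ is the set of $g\in\mathcal H^{k,p}$ for which there are $r>0$, a nonnegative $\psi\in L^\infty([0,T))$ and a nonnegative $h\in\mathcal H^{k-1,p}$ such that for a.e. $t$, all $x,y\in D^k$ with $|x-y|<r$ and all $\xi,\zeta\in U^k$, $$|g(t,x,\zeta)-g(t,y,\xi)|\le\psi(t)\sum_{i=1}^k|\zeta_i-\xi_i|\max(|\xi_i|,|\zeta_i|)^{p-1}h(t,\hat x^i,\hat\xi^i),$$ where $\hat x^i$, $\hat\xi^i$ are $x$, $\xi$ with the $i$-th entry deleted. **Theorem 2.9.** Let $\boldsymbol\nu_n\in\mathcal L^p([0,T),D;U)$, $n=1,2,\dots$, satisfy, for some $c>0$, $$\sup_{n}\operatorname*{ess\,sup}_{t\in[0,T)}\int_D\langle\nu^1_{n;t,x},|\xi|^p\rangle\,dx\le c^p,\qquad \lim_{r\to0}\limsup_{n\to\infty}\int_0^{T'}\omega^p_r(\nu^2_{n,t})\,dt=0\quad\text{for all }T'\in[0,T).$$ Then there are a subsequence $(n_j)_{j\ge1}$ and $\boldsymbol\nu\in\mathcal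 L^p([0,T),D;U)$ such that: (i) $\langle\nu^k_{n_j},g\rangle\to\langle\nu^k,g\rangle$ as $j\to\infty$ for every $k\ge1$ and every $g\in L^1([0,T)\times D^k;C_0(U^k))$; (ii) $\int_D\langle\nu^1_{t,x},|\xi|^p\rangle\,dx\le c^p$ for a.e. $t\in[0,T)$; (iii) $\int_0^{T'}\omega^p_r(\nu^2_t)\,dt\le\liminf_{j\to\infty}\int_0^{T'}\omega^p_r(\nu^2_{n_j,t})\,dt$ for every $r>0$ and $T'\in[0,T)$; (iv) for every $k\ge1$ and all nonnegative $\phi\in L^1_{\rm loc}([0,T)\times D^k)$, $\kappa\in C(U^k)$, the function $g(t,x,\xi)=\phi(t,x)\kappa(\xi)$ satisfies $\langle\nu^k,g\rangle\le\liminf_{j\to\infty}\langle\nu^k_{n_j},g\rangle$; (v) if moreover $D$ is bounded, $T<\infty$, and there are $M$ and maps $\mu^n$ dual to $\boldsymbol\nu_n$ such that, for every $n$ and a.e. $t$, $\|u\|_{L^p}\le M$ for $\mu^n_t$-a.e. $u\in L^p(D;U)$, then for every $k\ge1$ and every $g\in\mathcal H^{k,p}_1$ the functions $(t,x)\mapsto\langle\nu^k_{n;t,x},g(t,x)\rangle$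 (all $n$) and $(t,x)\mapsto\langle\nu^k_{t,x},g(t,x)\rangle$ are well defined a.e. and integrable on $[0,T)\times D^k$, and $$\lim_{j\to\infty}\int_{D^k}\left|\int_0^T\Big(\langle\nu^k_{n_j;t,x},g(t,x)\rangle-\langle\nu^k_{t,x},g(t,x)\rangle\Big)\,dt\right|dx=0 .$$ -/

import Mathlib

open MeasureTheory Filter Topology Set
open scoped ENNReal NNReal ZeroAtInfty BoundedContinuousFunction

/-- The `k`-fold product `D^k`, as a subset of `(ℝ^d)^k`. -/
def cmPower {d : ℕ} (D : Set (EuclideanSpace ℝ (Fin d))) (k : ℕ) :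
    Set (Fin k → EuclideanSpace ℝ (Fin d)) :=
  Set.univ.pi fun _ => D

/-- The time interval `[0,T)`, where `T ∈ (0,∞]` is an extended real. -/
def cmTime (T : EReal) : Set ℝ := {t : ℝ | 0 ≤ t ∧ (t : EReal) < T}

/-- Lebesgue measure on `D^k`. -/
noncomputable def cmSpaceMeasure {d : ℕ} (D : Set (EuclideanSpace ℝ (Fin d))) (k : ℕ) :
    Measure (Fin k → EuclideanSpace ℝ (Fin d)) :=
  volume.restrict (cmPower D k)

/-- Lebesgue measure on `[0,T)`. -/
noncomputable def cmTimeMeasure (T : EReal) : Measure ℝ := volume.restrict (cmTime T)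

/-- Lebesgue measure on `[0,T) × D^k`. -/
noncomputable def cmSpaceTimeMeasure {d : ℕ} (D : Set (EuclideanSpace ℝ (Fin d))) (T : EReal)
    (k : ℕ) : Measure (ℝ × (Fin k → EuclideanSpace ℝ (Fin d))) :=
  (cmTimeMeasure T).prod (cmSpaceMeasure D k)

/-- Representatives of the nonnegative elements of `L^∞_w(A; M(V))`: essentially bounded maps from
`(A, m)` into the finite measures on `V`, measurable when tested against `C₀(V)`. -/
structure IsBoundedWeakStarMeasurable {A V : Type*} [MeasurableSpace A] [TopologicalSpace V]
    [MeasurableSpace V] (m : Measure A) (ν : A → Measure V) : Prop where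
  measurable : ∀ f : C₀(V, ℝ), AEStronglyMeasurable (fun a => ∫ ξ, f ξ ∂(ν a)) m
  bounded : ∃ C : ℝ≥0, ∀ᵐ a ∂m, ν a Set.univ ≤ C

/-- `∫_D ⟨ν¹_x, |ξ|^p⟩ dx`. -/
noncomputable def cmMoment {d N : ℕ} (p : ℝ≥0∞) (D : Set (EuclideanSpace ℝ (Fin d)))
    (ν₁ : (Fin 1 → EuclideanSpace ℝ (Fin d)) → Measure (Fin 1 → EuclideanSpace ℝ (Fin N))) :
    ℝ≥0∞ :=
  ∫⁻ x in D, ∫⁻ ξ, ‖ξ 0‖ₑ ^ p.toReal ∂(ν₁ ![x])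

/-- The modulus of continuity `ω_r^p(ν²) = ∫_D ⨍_{B_r(x)} ⟨ν²_{x,y}, |ξ₁ - ξ₂|^p⟩ dy dx`.
Since `ν²_{x,y}` lives on `D × D`, the ball `B_r(x)` is the ball of the metric space `D`. -/
noncomputable def cmModulus {d N : ℕ} (p : ℝ≥0∞) (D : Set (EuclideanSpace ℝ (Fin d)))
    (r : ℝ)
    (ν₂ : (Fin 2 → EuclideanSpace ℝ (Fin d)) → Measure (Fin 2 → EuclideanSpace ℝ (Fin N))) :
    ℝ≥0∞ :=
  ∫⁻ x in D, ⨍⁻ y, (∫⁻ ξ, ‖ξ 0 - ξ 1‖ₑ ^ p.toReal ∂(ν₂ ![x, y]))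
    ∂(volume.restrict (D ∩ Metric.ball x r))

/-- Correlation measures, the set `𝓛^p(D;U)` with `U = ℝ^N`. The family is `(ν^k)_{k ≥ 1}`; the
value at `k = 0` is a dummy on which nothing is imposed. -/
structure IsCorrelationMeasure {d N : ℕ} (p : ℝ≥0∞) (D : Set (EuclideanSpace ℝ (Fin d)))
    (ν : ∀ k : ℕ, (Fin k → EuclideanSpace ℝ (Fin d)) →
      Measure (Fin k → EuclideanSpace ℝ (Fin N))) : Prop where
  weakStar : ∀ k : ℕ, 1 ≤ k → IsBoundedWeakStarMeasurable (cmSpaceMeasure D k) (ν k)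
  prob : ∀ k : ℕ, 1 ≤ k → ∀ᵐ x ∂(cmSpaceMeasure D k), IsProbabilityMeasure (ν k x)
  measurable : ∀ k : ℕ, 1 ≤ k → ∀ f : (Fin k → EuclideanSpace ℝ (Fin N)) →ᵇ ℝ,
    AEStronglyMeasurable (fun x => ∫ ξ, f ξ ∂(ν k x)) (cmSpaceMeasure D k)
  symmetry : ∀ k : ℕ, 1 ≤ k → ∀ (σ : Equiv.Perm (Fin k))
    (f : C₀(Fin k → EuclideanSpace ℝ (Fin N), ℝ)), ∀ᵐ x ∂(cmSpaceMeasure D k),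
    ∫ ξ, f ξ ∂(ν k (fun i => x (σ i))) = ∫ ξ, f (fun i => ξ (σ i)) ∂(ν k x)
  consistency : ∀ k : ℕ, 1 ≤ k → ∀ f : C₀(Fin k → EuclideanSpace ℝ (Fin N), ℝ),
    ∀ᵐ x ∂(cmSpaceMeasure D (k + 1)),
    ∫ ξ, f (fun i : Fin k => ξ i.castSucc) ∂(ν (k + 1) x) =
      ∫ ξ, f ξ ∂(ν k (fun i : Fin k => x i.castSucc))
  integrability : cmMoment p D (ν 1) < ∞
  diagonal : Tendsto (fun r : ℝ => cmModulus p D r (ν 2)) (𝓝[>] 0) (𝓝 0)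

/-- Time-dependent correlation measures, the set `𝓛^p([0,T),D;U)` with `U = ℝ^N`. -/
structure IsTimeDepCorrelationMeasure {d N : ℕ} (p : ℝ≥0∞)
    (D : Set (EuclideanSpace ℝ (Fin d))) (T : EReal)
    (ν : ∀ k : ℕ, ℝ → (Fin k → EuclideanSpace ℝ (Fin d)) →
      Measure (Fin k → EuclideanSpace ℝ (Fin N))) : Prop where
  weakStar : ∀ k : ℕ, 1 ≤ k →
    IsBoundedWeakStarMeasurable (cmSpaceTimeMeasure D T k) (fun z => ν k z.1 z.2)
  slice : ∀ᵐ t ∂(cmTimeMeasure T), IsCorrelationMeasure p D (fun k => ν k t)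
  integrability : essSup (fun t => cmMoment p D (ν 1 t)) (cmTimeMeasure T) < ∞
  diagonal : ∀ T' : ℝ, 0 < T' → (T' : EReal) < T →
    Tendsto (fun r : ℝ => ∫⁻ t in Set.Ico 0 T', cmModulus p D r (ν 2 t)) (𝓝[>] 0) (𝓝 0)

/-- The duality pairing `⟨ν^k, g⟩ = ∫_0^T ∫_{D^k} ⟨ν^k_{t,x}, g(t,x)⟩ dx dt` with
`g ∈ L¹([0,T) × D^k; C₀(U^k))`. -/
noncomputable def cmPairing {d N : ℕ} (D : Set (EuclideanSpace ℝ (Fin d))) (T : EReal) (k : ℕ)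
    (ν : ℝ → (Fin k → EuclideanSpace ℝ (Fin d)) → Measure (Fin k → EuclideanSpace ℝ (Fin N)))
    (g : ℝ × (Fin k → EuclideanSpace ℝ (Fin d)) → C₀(Fin k → EuclideanSpace ℝ (Fin N), ℝ)) : ℝ :=
  ∫ z, ∫ ξ, g z ξ ∂(ν z.1 z.2) ∂(cmSpaceTimeMeasure D T k)

/-- The pairing `⟨ν^k, g⟩ ∈ [0,∞]` with a nonnegative function `g(t,x,ξ)`. -/
noncomputable def cmPairingNonneg {d N : ℕ} (D : Set (EuclideanSpace ℝ (Fin d))) (T : EReal)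
    (k : ℕ)
    (ν : ℝ → (Fin k → EuclideanSpace ℝ (Fin d)) → Measure (Fin k → EuclideanSpace ℝ (Fin N)))
    (g : ℝ → (Fin k → EuclideanSpace ℝ (Fin d)) → (Fin k → EuclideanSpace ℝ (Fin N)) → ℝ) :
    ℝ≥0∞ :=
  ∫⁻ z, ∫⁻ ξ, ENNReal.ofReal (g z.1 z.2 ξ) ∂(ν z.1 z.2) ∂(cmSpaceTimeMeasure D T k)

/-- Nonnegative functions in `L^∞([0,T); L¹(D^i))`. For `i = 0` this is `L^∞([0,T))`. -/
structure MemNonnegLinftyL1 {d : ℕ} (D : Set (EuclideanSpace ℝ (Fin d))) (T : EReal) (i : ℕ)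
    (φ : ℝ → (Fin i → EuclideanSpace ℝ (Fin d)) → ℝ) : Prop where
  nonneg : ∀ t ∈ cmTime T, ∀ x ∈ cmPower D i, 0 ≤ φ t x
  measurable : AEStronglyMeasurable (fun z : ℝ × (Fin i → EuclideanSpace ℝ (Fin d)) => φ z.1 z.2)
    (cmSpaceTimeMeasure D T i)
  bounded : ∃ C : ℝ≥0, ∀ᵐ t ∂(cmTimeMeasure T),
    ∫⁻ x, ENNReal.ofReal (φ t x) ∂(cmSpaceMeasure D i) ≤ C

/-- Carathéodory functions on `([0,T) × D^k) × U^k`: continuous in `ξ` for a.e. `(t,x)`, and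
Lebesgue measurable in `(t,x)` for every `ξ`. -/
structure IsCaratheodory {d N : ℕ} (D : Set (EuclideanSpace ℝ (Fin d))) (T : EReal) (k : ℕ)
    (g : ℝ → (Fin k → EuclideanSpace ℝ (Fin d)) → (Fin k → EuclideanSpace ℝ (Fin N)) → ℝ) :
    Prop where
  continuous : ∀ᵐ z ∂(cmSpaceTimeMeasure D T k), Continuous (g z.1 z.2)
  measurable : ∀ ξ, AEStronglyMeasurable
    (fun z : ℝ × (Fin k → EuclideanSpace ℝ (Fin d)) => g z.1 z.2 ξ) (cmSpaceTimeMeasure D T k)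

/-- The space `𝓗^{k,p}([0,T),D;U)`. A multiindex `α ∈ {0,1}^k` is the set `α` of the indices where
it equals one, so `αᶜ` is its complement and `x_{αᶜ}` lists the `x_i`, `i ∉ α`, in increasing
order of `i`. -/
def MemH {d N : ℕ} (p : ℝ≥0∞) (D : Set (EuclideanSpace ℝ (Fin d))) (T : EReal) (k : ℕ)
    (g : ℝ → (Fin k → EuclideanSpace ℝ (Fin d)) → (Fin k → EuclideanSpace ℝ (Fin N)) → ℝ) :
    Prop :=
  IsCaratheodory D T k g ∧
  ∃ φ : ∀ i : ℕ, ℝ → (Fin i → EuclideanSpace ℝ (Fin d)) → ℝ,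
    (∀ i ≤ k, MemNonnegLinftyL1 D T i (φ i)) ∧
    ∀ᵐ t ∂(cmTimeMeasure T), ∀ x ∈ cmPower D k, ∀ ξ : Fin k → EuclideanSpace ℝ (Fin N),
      |g t x ξ| ≤ ∑ α : Finset (Fin k),
        φ αᶜ.card t (fun j => x (αᶜ.orderEmbOfFin rfl j)) * ∏ i ∈ α, ‖ξ i‖ ^ p.toReal

/-- The space `𝓗^{k+1,p}_1([0,T),D;U)`: functions in `𝓗^{k+1,p}` satisfying the local Lipschitz
condition. Here `i.removeNth x` is `x` with its `i`-th entry deleted. -/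
def MemHOne {d N : ℕ} (p : ℝ≥0∞) (D : Set (EuclideanSpace ℝ (Fin d))) (T : EReal) (k : ℕ)
    (g : ℝ → (Fin (k + 1) → EuclideanSpace ℝ (Fin d)) →
      (Fin (k + 1) → EuclideanSpace ℝ (Fin N)) → ℝ) : Prop :=
  MemH p D T (k + 1) g ∧
  ∃ (r : ℝ) (ψ : ℝ → ℝ)
    (h : ℝ → (Fin k → EuclideanSpace ℝ (Fin d)) → (Fin k → EuclideanSpace ℝ (Fin N)) → ℝ),
    0 < r ∧
    AEStronglyMeasurable ψ (cmTimeMeasure T) ∧ (∀ t ∈ cmTime T, 0 ≤ ψ t) ∧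
    (∃ C : ℝ, ∀ᵐ t ∂(cmTimeMeasure T), ψ t ≤ C) ∧
    MemH p D T k h ∧ (∀ t ∈ cmTime T, ∀ x ∈ cmPower D k, ∀ ξ, 0 ≤ h t x ξ) ∧
    ∀ᵐ t ∂(cmTimeMeasure T), ∀ x ∈ cmPower D (k + 1), ∀ y ∈ cmPower D (k + 1), dist y x < r →
      ∀ ξ ζ : Fin (k + 1) → EuclideanSpace ℝ (Fin N),
        |g t x ζ - g t y ξ| ≤ ψ t * ∑ i : Fin (k + 1),
          ‖ζ i - ξ i‖ * max ‖ξ i‖ ‖ζ i‖ ^ (p.toReal - 1) *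
            h t (i.removeNth x) (i.removeNth ξ)

/-- Borel measures on `L^p(D;U)`, `U = ℝ^N`. -/
abbrev CmLpMeasure (p : ℝ≥0∞) [Fact (1 ≤ p)] {d : ℕ} (D : Set (EuclideanSpace ℝ (Fin d)))
    (N : ℕ) : Type :=
  @Measure (Lp (EuclideanSpace ℝ (Fin N)) p (volume.restrict D)) (borel _)

/-- The map `t ↦ μ_t` from `[0,T)` to the Borel probability measures on `L^p(D;U)` is dual to `ν`:
`∫_{D^k} ⟨ν^k_t, g(x)⟩ dx = ∫_{L^p} ∫_{D^k} g(x, u(x₁), …, u(x_k)) dx dμ_t(u)` for a.e. `t`, every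
`g ∈ L¹(D^k; C₀(U^k))` and all `k ≥ 1`. -/
structure IsDualTo (p : ℝ≥0∞) [Fact (1 ≤ p)] {d N : ℕ} (D : Set (EuclideanSpace ℝ (Fin d)))
    (T : EReal)
    (ν : ∀ k : ℕ, ℝ → (Fin k → EuclideanSpace ℝ (Fin d)) →
      Measure (Fin k → EuclideanSpace ℝ (Fin N)))
    (μ : ℝ → CmLpMeasure p D N) : Prop where
  prob : ∀ t ∈ cmTime T, IsProbabilityMeasure (μ t)
  duality : ∀ᵐ t ∂(cmTimeMeasure T), ∀ k : ℕ, 1 ≤ k →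
    ∀ g : (Fin k → EuclideanSpace ℝ (Fin d)) → C₀(Fin k → EuclideanSpace ℝ (Fin N), ℝ),
      Integrable g (cmSpaceMeasure D k) →
      ∫ x, ∫ ξ, g x ξ ∂(ν k t x) ∂(cmSpaceMeasure D k) =
        ∫ u, ∫ x, g x (fun i => u (x i)) ∂(cmSpaceMeasure D k) ∂(μ t)

/-- The observable `(t,x) ↦ ⟨ν^k_{t,x}, g(t,x)⟩` is well defined a.e. and integrable on
`[0,T) × D^k`. -/
def ObservableIntegrable {d N : ℕ} (D : Set (EuclideanSpace ℝ (Fin d))) (T : EReal) (k : ℕ)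
    (ν : ℝ → (Fin k → EuclideanSpace ℝ (Fin d)) → Measure (Fin k → EuclideanSpace ℝ (Fin N)))
    (g : ℝ → (Fin k → EuclideanSpace ℝ (Fin d)) → (Fin k → EuclideanSpace ℝ (Fin N)) → ℝ) :
    Prop :=
  (∀ᵐ z ∂(cmSpaceTimeMeasure D T k), Integrable (g z.1 z.2) (ν z.1 z.2)) ∧
  Integrable (fun z => ∫ ξ, g z.1 z.2 ξ ∂(ν z.1 z.2)) (cmSpaceTimeMeasure D T k)

/-! Each `ν n` is, up to null sets, a symmetric and consistent family of Markov kernels: countably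
many C₀ functions determine a finite measure, so weak* measurability upgrades to a kernel off a null
set (`exists_kernel_ae_eq`, `IsTimeDepCorrelationMeasure.exists_kernel`). The uniform moment bound
makes the joint laws of base point and state tight. Prokhorov's theorem for each k, compactness of
the product over the countably many k, and disintegration of the limits give one subsequence that
converges stably for every k: against L¹ functions of (t,x) and bounded continuous functions of ξ
(`exists_subseq_stableTendsto`). No mass escapes, so the limits are again probability kernels.
Stable limits are unique, hence symmetry and consistency survive, and integrals of nonnegative
continuous functions are lower semicontinuous (`StableTendsto.lintegral_le_liminf`). This yields
(i)-(iv).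

The delicate point in the membership of the limit is diagonal continuity for almost every single t,
along the full limit r → 0, when only time integrals are controlled. Fatou's lemma gives, for a.e.
t, arbitrarily small scales S with small modulus. The triangle inequality under the three-point
measure transfers smallness from S to every r ≤ S/2 away from the boundary of D, and near the
boundary the modulus is dominated by moments, which are small there
(`tendsto_modulus_of_frequently`).

For (v), the Lipschitz condition with equal states says that g is locally constant in x. As D is
connected, g is a function G(t,ξ), with growth ∏(1+|ξ_i|^p) (`MemHOne.exists_profile`). A dual
measure on the ball of radius M in L^p decouples points: integrating out a factor 1+|u(x)|^p costs
at most |D|+M^p (`IsDualAt.lintegral_decoupled_le`). So product moments are bounded, and an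
increment of one state weighted by the growth of the others is bounded by the ordinary two-point
modulus. Decoupling and diagonal continuity also give equi-integrability: if |ξ₁| is large, then
either |ξ₁-ξ₂| is comparable with it, which the modulus controls, or |ξ₂| is large too, and
|ξ₁|^p|ξ₂|^p has a bounded integral (`tailWeight_mul_le`, `HasBoundedDual.tailMass_le`).

Equi-integrability extends the weak convergence to G. A Kolmogorov-Riesz argument then makes it
strong in x: averages over small balls converge pointwise and boundedly, and they differ from the
averaged functions by an amount that the modulus controls uniformly in j
(`tendsto_lintegral_enorm_integral_sub`). -/

section

open ProbabilityTheory

/-! ### Weakly measurable families of measures are kernels -/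

/-- Tent functions, which increase to `1` and have bounded support. -/
noncomputable def tent {V : Type*} [NormedAddCommGroup V] (n : ℕ) (ξ : V) : ℝ≥0 :=
  1 - Real.toNNReal (‖ξ‖ / (n + 1))

section Tent

variable {V : Type*} [NormedAddCommGroup V]

lemma continuous_tent (n : ℕ) : Continuous (tent n : V → ℝ≥0) := by
  unfold tent; fun_prop

lemma tent_le_one (n : ℕ) (ξ : V) : tent n ξ ≤ 1 := tsub_le_self

lemma tent_mono : Monotone fun (n : ℕ) (ξ : V) => tent n ξ := by
  intro m n hmn ξ
  have h : (m : ℝ) ≤ n := by exact_mod_cast hmn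
  exact tsub_le_tsub_left (Real.toNNReal_le_toNNReal (by gcongr)) 1

lemma tendsto_tent (ξ : V) : Tendsto (fun n : ℕ => tent n ξ) atTop (𝓝 1) := by
  have h1 : Tendsto (fun n : ℕ => ‖ξ‖ / ((n : ℝ) + 1)) atTop (𝓝 0) :=
    tendsto_const_nhds.div_atTop (tendsto_natCast_atTop_atTop.atTop_add tendsto_const_nhds)
  have h2 := (continuous_real_toNNReal.tendsto 0).comp h1
  have h3 : Continuous fun y : ℝ≥0 => (1 : ℝ≥0) - y := by fun_prop
  have := (h3.tendsto _).comp h2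
  simpa [tent, Function.comp_def] using this

lemma hasCompactSupport_tent [ProperSpace V] (n : ℕ) :
    HasCompactSupport (tent n : V → ℝ≥0) := by
  refine HasCompactSupport.intro (isCompact_closedBall 0 ((n : ℝ) + 1)) fun ξ hξ => ?_
  simp only [Metric.mem_closedBall, dist_zero_right, not_le] at hξ
  unfold tent
  refine tsub_eq_zero_of_le ?_
  rw [← Real.toNNReal_one]
  exact Real.toNNReal_le_toNNReal ((one_le_div (by positivity)).2 hξ.le)

/-- The product of a continuous function with a tent function vanishes at infinity. -/
noncomputable def tentMul [ProperSpace V] (n : ℕ) (f : V → ℝ) (hf : Continuous f) : C₀(V, ℝ) where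
  toFun ξ := tent n ξ * f ξ
  continuous_toFun := (NNReal.continuous_coe.comp (continuous_tent n)).mul hf
  zero_at_infty' := HasCompactSupport.is_zero_at_infty (by
    refine HasCompactSupport.mul_right (f := fun ξ => (tent n ξ : ℝ)) ?_
    exact (hasCompactSupport_tent n).comp_left (g := fun y : ℝ≥0 => (y : ℝ)) rfl)

@[simp] lemma tentMul_apply [ProperSpace V] (n : ℕ) (f : V → ℝ) (hf : Continuous f) (ξ : V) :
    tentMul n f hf ξ = tent n ξ * f ξ := rfl

end Tent

/-- An open set is approximated by functions vanishing at infinity. -/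
lemma exists_seq_tendsto_measure_isOpen {V : Type*} [NormedAddCommGroup V] [ProperSpace V]
    [MeasurableSpace V] [BorelSpace V] {O : Set V} (hO : IsOpen O) :
    ∃ f : ℕ → C₀(V, ℝ), ∀ μ : Measure V, IsFiniteMeasure μ →
      Tendsto (fun n => ∫ ξ, f n ξ ∂μ) atTop (𝓝 (μ.real O)) := by
  have : SecondCountableTopology V := secondCountable_of_proper
  have hC : IsClosed Oᶜ := hO.isClosed_compl
  have hcont (n : ℕ) : Continuous fun ξ => 1 - (hC.apprSeq n ξ : ℝ) := by fun_prop
  -- One minus the outer approximation of the closed complement tends to the indicator of `O`. The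
  -- tent factor only serves to make it vanish at infinity.
  refine ⟨fun n => tentMul n (fun ξ => 1 - (hC.apprSeq n ξ : ℝ)) (hcont n), fun μ _ => ?_⟩
  have h1 : μ.real O = ∫ ξ, O.indicator (fun _ => (1 : ℝ)) ξ ∂μ := by
    rw [integral_indicator hO.measurableSet]; simp [Measure.real]
  have hb (n : ℕ) (ξ : V) : (hC.apprSeq n ξ : ℝ) ≤ 1 := by
    exact_mod_cast HasOuterApproxClosed.apprSeq_apply_le_one hC n ξ
  rw [h1]
  refine tendsto_integral_of_dominated_convergence (fun ξ => (1 : ℝ)) ?_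
    (integrable_const _) ?_ ?_
  · intro n
    exact (ContinuousMapClass.map_continuous _).aestronglyMeasurable
  · intro n
    refine ae_of_all _ fun ξ => ?_
    rw [tentMul_apply, norm_mul]
    have h2 : (tent n ξ : ℝ) ≤ 1 := by exact_mod_cast tent_le_one n ξ
    have h3 : ‖1 - (hC.apprSeq n ξ : ℝ)‖ ≤ 1 := by
      rw [Real.norm_of_nonneg (by linarith [hb n ξ])]
      linarith [(hC.apprSeq n ξ).2, (NNReal.coe_nonneg (hC.apprSeq n ξ))]
    exact mul_le_one₀ (by simpa using h2) (norm_nonneg _) h3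
  · refine ae_of_all _ fun ξ => ?_
    have h2 := (NNReal.continuous_coe.tendsto _).comp (tendsto_tent ξ)
    have h3 := (NNReal.continuous_coe.tendsto _).comp
      (tendsto_pi_nhds.1 (HasOuterApproxClosed.tendsto_apprSeq hC) ξ)
    have h4 := h2.mul (h3.const_sub 1)
    refine (h4.congr fun n => ?_).trans_eq ?_
    · rfl
    · by_cases hξ : ξ ∈ O <;> simp [hξ]

/-- A countable `π`-system of open sets generating the Borel `σ`-algebra. -/
lemma exists_countable_isPiSystem_isOpen (V : Type*) [TopologicalSpace V]
    [SecondCountableTopology V] [MeasurableSpace V] [BorelSpace V] :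
    ∃ S : Set (Set V), S.Countable ∧ (∀ s ∈ S, IsOpen s) ∧ IsPiSystem S ∧
      ‹MeasurableSpace V› = .generateFrom S ∧ univ ∈ S := by
  let B := TopologicalSpace.countableBasis V
  let I := {F : Set (Set V) | F.Finite ∧ F ⊆ B}
  have hI : I.Countable :=
    Set.countable_ofPred_finite_subset (TopologicalSpace.countable_countableBasis V)
  let S : Set (Set V) := (fun F : Set (Set V) => ⋂₀ F) '' I
  have hSo : ∀ s ∈ S, IsOpen s := by
    rintro _ ⟨F, ⟨hF, hFB⟩, rfl⟩
    exact hF.isOpen_sInter fun s hs => TopologicalSpace.isOpen_of_mem_countableBasis (hFB hs)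
  refine ⟨S, hI.image _, hSo, ?_, ?_, ⟨∅, ⟨finite_empty, empty_subset _⟩, by simp⟩⟩
  · rintro _ ⟨F, ⟨hF, hFB⟩, rfl⟩ _ ⟨G, ⟨hG, hGB⟩, rfl⟩ _
    exact ⟨F ∪ G, ⟨hF.union hG, union_subset hFB hGB⟩, sInter_union F G⟩
  · apply le_antisymm
    · rw [BorelSpace.measurable_eq (α := V),
        (TopologicalSpace.isBasis_countableBasis V).borel_eq_generateFrom]
      refine MeasurableSpace.generateFrom_mono fun s hs => ⟨{s}, ⟨finite_singleton s, ?_⟩, by simp⟩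
      simpa using hs
    · exact MeasurableSpace.generateFrom_le fun s hs => (hSo s hs).measurableSet

/-- Countably many functions vanishing at infinity determine finite measures. -/
lemma exists_seq_zeroAtInfty_separating (V : Type*) [NormedAddCommGroup V] [ProperSpace V]
    [MeasurableSpace V] [BorelSpace V] :
    ∃ (I : Type) (_ : Countable I) (F : I → C₀(V, ℝ)), ∀ μ ν : Measure V, IsFiniteMeasure μ →
      IsFiniteMeasure ν → (∀ i, ∫ ξ, F i ξ ∂μ = ∫ ξ, F i ξ ∂ν) → μ = ν := by
  have : SecondCountableTopology V := secondCountable_of_proper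
  obtain ⟨S, hSc, hSo, hSpi, hSgen, hSuniv⟩ := exists_countable_isPiSystem_isOpen V
  obtain ⟨g, hg⟩ := hSc.exists_eq_range ⟨univ, hSuniv⟩
  choose f hf using fun n : ℕ => exists_seq_tendsto_measure_isOpen (hSo (g n) (hg ▸ ⟨n, rfl⟩))
  refine ⟨ℕ × ℕ, inferInstance, fun i => f i.1 i.2, fun μ ν hμ hν h => ?_⟩
  have key : ∀ s ∈ S, μ s = ν s := by
    intro s hs
    rw [hg] at hs
    obtain ⟨n, rfl⟩ := hs
    have h1 := hf n μ hμ
    have h2 := hf n ν hν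
    have h3 : μ.real (g n) = ν.real (g n) :=
      tendsto_nhds_unique (h1.congr fun j => h (n, j)) h2
    exact (measureReal_eq_measureReal_iff).1 h3
  exact ext_of_generate_finite S hSgen hSpi key (key _ hSuniv)

/-- A family of finite measures which is a.e. measurable when tested against `C₀` agrees a.e.
with a kernel. -/
lemma exists_kernel_ae_eq {A V : Type*} [MeasurableSpace A] [NormedAddCommGroup V] [ProperSpace V]
    [MeasurableSpace V] [BorelSpace V] {m : Measure A} {ν : A → Measure V}
    (hmeas : ∀ f : C₀(V, ℝ), AEStronglyMeasurable (fun a => ∫ ξ, f ξ ∂(ν a)) m)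
    (hfin : ∀ᵐ a ∂m, IsFiniteMeasure (ν a)) :
    ∃ κ : Kernel A V, ν =ᵐ[m] κ := by
  classical
  have : SecondCountableTopology V := secondCountable_of_proper
  obtain ⟨S, hSc, hSo, hSpi, hSgen, hSuniv⟩ := exists_countable_isPiSystem_isOpen V
  have : Countable S := hSc
  choose f hf using fun s : S => exists_seq_tendsto_measure_isOpen (hSo s.1 s.2)
  have hae : ∀ᵐ a ∂m, IsFiniteMeasure (ν a) ∧
      ∀ s n, ∫ ξ, f s n ξ ∂(ν a) = (hmeas (f s n)).mk _ a := by
    filter_upwards [hfin, ae_all_iff.2 fun s => ae_all_iff.2 fun n => (hmeas (f s n)).ae_eq_mk]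
      with a h1 h2 using ⟨h1, h2⟩
  -- `G` is a measurable null set outside which all the countably many approximating integrals agree
  -- with their measurable versions. The kernel is set to zero on it.
  obtain ⟨G, hGsub, hGm, hG⟩ := exists_measurable_superset_of_null hae
  let κ : A → Measure V := fun a => if a ∈ G then 0 else ν a
  have hgood : ∀ a, a ∉ G → IsFiniteMeasure (ν a) ∧
      ∀ s n, ∫ ξ, f s n ξ ∂(ν a) = (hmeas (f s n)).mk _ a := by
    intro a ha
    by_contra hcon
    exact ha (hGsub hcon)
  have hκfin : ∀ a, IsFiniteMeasure (κ a) := by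
    intro a
    by_cases ha : a ∈ G
    · simp only [κ, ha, if_true]; infer_instance
    · simp only [κ, ha, if_false]; exact (hgood a ha).1
  have hκS : ∀ s ∈ S, Measurable fun a => κ a s := by
    intro s hs
    have h1 : Measurable fun a => (κ a).real s := by
      refine measurable_of_tendsto_metrizable
        (f := fun n a => if a ∈ G then 0 else (hmeas (f ⟨s, hs⟩ n)).mk _ a) ?_ ?_
      · intro n
        exact Measurable.ite hGm measurable_const
          (hmeas (f ⟨s, hs⟩ n)).stronglyMeasurable_mk.measurable
      · rw [tendsto_pi_nhds]
        intro a
        by_cases ha : a ∈ G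
        · simp [κ, ha]
        · simp only [ha, if_false, κ]
          have := (hgood a ha).1
          refine (hf ⟨s, hs⟩ (ν a) this).congr fun n => ?_
          rw [(hgood a ha).2]
    have h2 : (fun a => κ a s) = fun a => ENNReal.ofReal ((κ a).real s) := by
      funext a
      have := hκfin a
      simp [Measure.real]
    rw [h2]
    exact h1.ennreal_ofReal
  have hκm : Measurable κ := Measurable.measure_of_isPiSystem hSgen hSpi hκS (hκS _ hSuniv)
  refine ⟨⟨κ, hκm⟩, ?_⟩
  filter_upwards [measure_eq_zero_iff_ae_notMem.1 hG] with a ha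
  simp [κ, ha]

/-! ### Stable convergence of Markov kernels -/

/-- Stable convergence of kernels: convergence of all integrals of bounded continuous functions,
averaged over the base with respect to finite measures absolutely continuous with respect to `m`. -/
def StableTendsto {A V : Type*} [MeasurableSpace A] [TopologicalSpace V] [MeasurableSpace V]
    (m : Measure A) (κ : ℕ → Kernel A V) (κ' : Kernel A V) : Prop :=
  ∀ μ : Measure A, IsFiniteMeasure μ → μ ≪ m → ∀ f : V →ᵇ ℝ,
    Tendsto (fun n => ∫ a, ∫ ξ, f ξ ∂(κ n a) ∂μ) atTop (𝓝 (∫ a, ∫ ξ, f ξ ∂(κ' a) ∂μ))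

section KernelIntegral

variable {A V : Type*} [MeasurableSpace A] [TopologicalSpace V] [MeasurableSpace V]
  [OpensMeasurableSpace V]

lemma stronglyMeasurable_integral_bcf (κ : Kernel A V) [IsMarkovKernel κ] (f : V →ᵇ ℝ) :
    StronglyMeasurable fun a => ∫ ξ, f ξ ∂(κ a) :=
  StronglyMeasurable.integral_kernel f.continuous.measurable.stronglyMeasurable

lemma norm_integral_bcf_le {μ : Measure V} [IsProbabilityMeasure μ] (f : V →ᵇ ℝ) :
    ‖∫ ξ, f ξ ∂μ‖ ≤ ‖f‖ := by
  simpa using f.norm_integral_le_norm μ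

lemma integrable_integral_bcf (μ : Measure A) [IsFiniteMeasure μ] (κ : Kernel A V)
    [IsMarkovKernel κ] (f : V →ᵇ ℝ) : Integrable (fun a => ∫ ξ, f ξ ∂(κ a)) μ :=
  Integrable.of_bound (stronglyMeasurable_integral_bcf κ f).aestronglyMeasurable ‖f‖
    (ae_of_all _ fun _ => norm_integral_bcf_le f)

end KernelIntegral

namespace StableTendsto

variable {A V : Type*} [MeasurableSpace A] [TopologicalSpace V] [MeasurableSpace V]
  {m : Measure A} {κ η : ℕ → Kernel A V} {κ' η' : Kernel A V}

lemma congr_left (h : StableTendsto m κ κ') (hη : ∀ n, κ n =ᵐ[m] η n) :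
    StableTendsto m η κ' := by
  intro μ hμ hac f
  refine (h μ hμ hac f).congr fun n => ?_
  refine integral_congr_ae ?_
  filter_upwards [hac.ae_le (hη n)] with a ha using by rw [ha]

lemma comap {A' : Type*} [MeasurableSpace A'] {m' : Measure A'} [OpensMeasurableSpace V]
    [∀ n, IsMarkovKernel (κ n)] [IsMarkovKernel κ'] (h : StableTendsto m κ κ') {π : A' → A}
    (hπ : Measure.QuasiMeasurePreserving π m' m) :
    StableTendsto m' (fun n => (κ n).comap π hπ.measurable) (κ'.comap π hπ.measurable) := by
  intro μ hμ hac f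
  have key (η : Kernel A V) [IsMarkovKernel η] :
      ∫ a, ∫ ξ, f ξ ∂(η.comap π hπ.measurable a) ∂μ = ∫ a, ∫ ξ, f ξ ∂(η a) ∂(μ.map π) := by
    rw [integral_map hπ.measurable.aemeasurable
      (stronglyMeasurable_integral_bcf η f).aestronglyMeasurable]
    rfl
  simp_rw [key]
  exact h _ (Measure.isFiniteMeasure_map μ π)
    ((hac.map hπ.measurable).trans hπ.absolutelyContinuous) f


lemma map [BorelSpace V] {V' : Type*} [TopologicalSpace V'] [MeasurableSpace V'] [BorelSpace V']
    [TopologicalSpace.PseudoMetrizableSpace V'] [SecondCountableTopology V']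
    (h : StableTendsto m κ κ') {φ : V → V'} (hφ : Continuous φ) :
    StableTendsto m (fun n => (κ n).map φ) (κ'.map φ) := by
  intro μ hμ hac f
  have key (η : Kernel A V) :
      ∫ a, ∫ ξ, f ξ ∂(η.map φ a) ∂μ = ∫ a, ∫ ξ, f.compContinuous ⟨φ, hφ⟩ ξ ∂(η a) ∂μ := by
    refine integral_congr_ae (ae_of_all _ fun a => ?_)
    change ∫ ξ, f ξ ∂(η.map φ a) = ∫ ξ, f (φ ξ) ∂(η a)
    rw [Kernel.map_apply _ hφ.measurable]
    exact integral_map hφ.measurable.aemeasurable f.continuous.aestronglyMeasurable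
  simp_rw [key]
  exact h μ hμ hac _

/-- The density is split into positive and negative parts, each of which is the density of a finite
measure absolutely continuous with respect to `m`. -/
lemma tendsto_integral_mul [OpensMeasurableSpace V] [∀ n, IsMarkovKernel (κ n)]
    [IsMarkovKernel κ'] (h : StableTendsto m κ κ') {φ : A → ℝ} (hφ : Integrable φ m)
    (f : V →ᵇ ℝ) :
    Tendsto (fun n => ∫ a, φ a * ∫ ξ, f ξ ∂(κ n a) ∂m) atTop
      (𝓝 (∫ a, φ a * ∫ ξ, f ξ ∂(κ' a) ∂m)) := by
  have hfin (ψ : A → ℝ) (hψ : Integrable ψ m) :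
      IsFiniteMeasure (m.withDensity fun a => ENNReal.ofReal (ψ a)) :=
    isFiniteMeasure_withDensity_ofReal hψ.2
  have h1 := hfin φ hφ
  have h2 := hfin (fun a => -φ a) hφ.neg
  have key (η : Kernel A V) [IsMarkovKernel η] :
      ∫ a, φ a * ∫ ξ, f ξ ∂(η a) ∂m =
        ∫ a, ∫ ξ, f ξ ∂(η a) ∂(m.withDensity fun a => ENNReal.ofReal (φ a)) -
        ∫ a, ∫ ξ, f ξ ∂(η a) ∂(m.withDensity fun a => ENNReal.ofReal (-φ a)) := by
    have hm := stronglyMeasurable_integral_bcf η f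
    have e1 := integral_withDensity_eq_integral_toReal_smul₀ (μ := m)
      (f := fun a => ENNReal.ofReal (φ a)) hφ.1.aemeasurable.ennreal_ofReal (by simp)
      (fun a => ∫ ξ, f ξ ∂(η a))
    have e2 := integral_withDensity_eq_integral_toReal_smul₀ (μ := m)
      (f := fun a => ENNReal.ofReal (-φ a)) hφ.1.aemeasurable.neg.ennreal_ofReal (by simp)
      (fun a => ∫ ξ, f ξ ∂(η a))
    have hint (ψ : A → ℝ) (hψ : Integrable ψ m) :
        Integrable (fun a => (ENNReal.ofReal (ψ a)).toReal • ∫ ξ, f ξ ∂(η a)) m := by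
      have := hψ.pos_part.bdd_mul (c := ‖f‖) hm.aestronglyMeasurable
        (ae_of_all _ fun a => norm_integral_bcf_le f)
      refine this.congr (ae_of_all _ fun a => ?_)
      simp [ENNReal.toReal_ofReal', mul_comm]
    rw [e1, e2, ← integral_sub (hint _ hφ) (hint (fun a => -φ a) hφ.neg)]
    refine integral_congr_ae (ae_of_all _ fun a => ?_)
    simp only [ENNReal.toReal_ofReal', smul_eq_mul, ← sub_mul]
    congr 1
    rcases le_total 0 (φ a) with h0 | h0
    · rw [max_eq_left h0, max_eq_right (by linarith)]; ring
    · rw [max_eq_right h0, max_eq_left (by linarith)]; ring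
  simp_rw [key]
  exact (h _ h1 (withDensity_absolutelyContinuous _ _) f).sub
    (h _ h2 (withDensity_absolutelyContinuous _ _) f)

/-- The limits are tested with products of a bounded continuous function of `a` and one of ξ. These
determine the measure on the product, and a kernel is recovered a.e. from the product measure. The
finite measure `m.toFinite` has the same null sets as `m`. -/
lemma unique [TopologicalSpace A] [HasOuterApproxClosed A] [BorelSpace A]
    [HasOuterApproxClosed V] [BorelSpace V]
    [MeasurableSpace.CountableOrCountablyGenerated A V] [SFinite m]
    [∀ n, IsMarkovKernel (κ n)] [IsMarkovKernel κ'] [IsMarkovKernel η']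
    (h : StableTendsto m κ κ') (h' : StableTendsto m κ η') : κ' =ᵐ[m] η' := by
  have hac : m.toFinite ≪ m := toFinite_absolutelyContinuous m
  have H : m.toFinite ⊗ₘ κ' = m.toFinite ⊗ₘ η' := by
    refine Measure.ext_of_integral_mul_boundedContinuousFunction fun φ f => ?_
    have hst (ρ : Kernel A V) [IsMarkovKernel ρ] (hρ : StableTendsto m κ ρ) :
        Tendsto (fun n => ∫ a, φ a * ∫ ξ, f ξ ∂(κ n a) ∂m.toFinite) atTop
          (𝓝 (∫ p, φ p.1 * f p.2 ∂(m.toFinite ⊗ₘ ρ))) := by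
      have h1 : StableTendsto m.toFinite κ ρ := fun μ hμ hμm f => hρ μ hμ (hμm.trans hac) f
      rw [Measure.integral_compProd]
      · simp_rw [integral_const_mul]
        exact h1.tendsto_integral_mul (φ.integrable _) f
      · refine Integrable.of_bound (C := ‖φ‖ * ‖f‖) ?_ (ae_of_all _ fun p => ?_)
        · exact ((φ.continuous.measurable.comp measurable_fst).mul
            (f.continuous.measurable.comp measurable_snd)).aestronglyMeasurable
        · rw [norm_mul]
          gcongr
          · exact φ.norm_coe_le_norm _
          · exact f.norm_coe_le_norm _
    exact tendsto_nhds_unique (hst _ h) (hst _ h')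
  have := Kernel.ae_eq_of_compProd_eq H
  rw [Filter.EventuallyEq, ae_toFinite] at this
  exact this

/-- Convergence of the pairing with integrable maps into the bounded continuous functions. -/
lemma integrable_integral_of_integrable [SecondCountableTopology V] [OpensMeasurableSpace V]
    (η : Kernel A V) [IsMarkovKernel η] {G : A → V →ᵇ ℝ} (hG : Integrable G m) :
    Integrable (fun a => ∫ ξ, G a ξ ∂(η a)) m := by
  refine hG.norm.mono' ?_ (ae_of_all _ fun a => norm_integral_bcf_le _)
  have h1 : StronglyMeasurable fun a => ∫ ξ, hG.1.mk G a ξ ∂(η a) := by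
    refine StronglyMeasurable.integral_kernel_prod_right (f := fun a ξ => hG.1.mk G a ξ) ?_
    obtain ⟨f, hf⟩ := hG.1.stronglyMeasurable_mk
    have hm : Measurable fun p : A × V => hG.1.mk G p.1 p.2 := by
      refine measurable_of_tendsto_metrizable (f := fun n (p : A × V) => f n p.1 p.2) ?_ ?_
      · intro n
        have : (fun p : A × V => f n p.1 p.2) = fun p : A × V =>
            ∑ F ∈ (f n).range, (f n ⁻¹' {F}).indicator (fun _ => (1 : ℝ)) p.1 * F p.2 := by
          funext p
          rw [Finset.sum_eq_single (f n p.1)]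
          · simp
          · intro F _ hF
            simp [Ne.symm hF]
          · intro h0
            exact absurd (SimpleFunc.mem_range_self _ _) h0
        rw [this]
        refine Finset.measurable_sum _ fun F _ => Measurable.mul ?_ ?_
        · exact (measurable_const.indicator ((f n).measurableSet_fiber F)).comp measurable_fst
        · exact F.continuous.measurable.comp measurable_snd
      · rw [tendsto_pi_nhds]
        intro p
        exact ((show Continuous fun F : V →ᵇ ℝ => F p.2 by fun_prop).tendsto _).comp
          (hf p.1)
    exact hm.stronglyMeasurable
  refine h1.aestronglyMeasurable.congr ?_
  filter_upwards [hG.1.ae_eq_mk] with a ha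
  rw [ha]

/-- Indicators times a fixed function are covered by the previous convergence with scalar densities.
The pairing is 1-Lipschitz in `G` for the L¹ norm, uniformly over Markov kernels, so the set of
admissible `G` is closed. -/
lemma tendsto_integral_of_integrable [SecondCountableTopology V] [OpensMeasurableSpace V]
    [∀ n, IsMarkovKernel (κ n)] [IsMarkovKernel κ'] (h : StableTendsto m κ κ')
    {G : A → V →ᵇ ℝ} (hG : Integrable G m) :
    Tendsto (fun n => ∫ a, ∫ ξ, G a ξ ∂(κ n a) ∂m) atTop (𝓝 (∫ a, ∫ ξ, G a ξ ∂(κ' a) ∂m)) := by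
  have hi (η : Kernel A V) [IsMarkovKernel η] {G : A → V →ᵇ ℝ} (hG : Integrable G m) :=
    integrable_integral_of_integrable η hG
  refine hG.induction (P := fun (G : A → V →ᵇ ℝ) => Tendsto (fun n => ∫ a, ∫ ξ, G a ξ ∂(κ n a) ∂m) atTop
    (𝓝 (∫ a, ∫ ξ, G a ξ ∂(κ' a) ∂m))) ?_ ?_ ?_ ?_
  · intro F s hs hfin
    have e (η : Kernel A V) : ∫ a, ∫ ξ, s.indicator (fun _ => F) a ξ ∂(η a) ∂m =
        ∫ a, s.indicator (fun _ => (1 : ℝ)) a * ∫ ξ, F ξ ∂(η a) ∂m := by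
      refine integral_congr_ae (ae_of_all _ fun a => ?_)
      by_cases ha : a ∈ s <;> simp [ha]
    simp_rw [e]
    exact h.tendsto_integral_mul ((integrable_indicator_iff hs).2 (by
      simpa [IntegrableOn, integrable_const_iff, isFiniteMeasure_restrict] using hfin.ne)) F
  · intro G₁ G₂ _ h1 h2 t1 t2
    have e (η : Kernel A V) [IsMarkovKernel η] : ∫ a, ∫ ξ, (G₁ + G₂) a ξ ∂(η a) ∂m =
        ∫ a, ∫ ξ, G₁ a ξ ∂(η a) ∂m + ∫ a, ∫ ξ, G₂ a ξ ∂(η a) ∂m := by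
      rw [← integral_add (hi η h1) (hi η h2)]
      refine integral_congr_ae (ae_of_all _ fun a => ?_)
      exact integral_add ((G₁ a).integrable _) ((G₂ a).integrable _)
    simp_rw [e]
    exact t1.add t2
  · have hdist (η : Kernel A V) [IsMarkovKernel η] (F₁ F₂ : Lp (V →ᵇ ℝ) 1 m) :
        |∫ a, ∫ ξ, F₁ a ξ ∂(η a) ∂m - ∫ a, ∫ ξ, F₂ a ξ ∂(η a) ∂m| ≤ dist F₁ F₂ := by
      have i1 := L1.integrable_coeFn F₁
      have i2 := L1.integrable_coeFn F₂
      rw [← integral_sub (hi η i1) (hi η i2), ← Real.norm_eq_abs, L1.dist_eq_integral_dist]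
      refine norm_integral_le_of_norm_le ((i1.sub i2).norm.congr ?_) (ae_of_all _ fun a => ?_)
      · refine ae_of_all _ fun a => ?_
        simp [dist_eq_norm]
      · rw [← integral_sub ((F₁ a).integrable _) ((F₂ a).integrable _), dist_eq_norm]
        exact norm_integral_bcf_le (F₁ a - F₂ a)
    refine isClosed_of_closure_subset fun F hF => ?_
    simp only [Set.mem_ofPred_eq]
    rw [Metric.tendsto_atTop]
    intro ε hε
    obtain ⟨F', hF', hd⟩ := Metric.mem_closure_iff.1 hF (ε / 3) (by positivity)
    obtain ⟨N, hN⟩ := Metric.tendsto_atTop.1 hF' (ε / 3) (by positivity)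
    refine ⟨N, fun n hn => ?_⟩
    have e1 := hdist (κ n) F F'
    have e2 := hdist κ' F F'
    have e3 := hN n hn
    rw [Real.dist_eq] at e3 ⊢
    rw [abs_le] at e1 e2
    rw [abs_lt] at e3 ⊢
    constructor <;> linarith
  · intro G₁ G₂ hae _ t
    have e (η : Kernel A V) : ∫ a, ∫ ξ, G₂ a ξ ∂(η a) ∂m = ∫ a, ∫ ξ, G₁ a ξ ∂(η a) ∂m := by
      refine integral_congr_ae ?_
      filter_upwards [hae] with a ha
      rw [ha]
    simp_rw [e]
    exact t

/-- Lower semicontinuity of integrals of nonnegative continuous functions. -/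
lemma lintegral_le_liminf [OpensMeasurableSpace V] [∀ n, IsMarkovKernel (κ n)]
    [IsMarkovKernel κ'] (h : StableTendsto m κ κ') {μ : Measure A} [SFinite μ] (hμ : μ ≪ m)
    {f : V → ℝ≥0} (hf : Continuous f) :
    ∫⁻ a, ∫⁻ ξ, f ξ ∂(κ' a) ∂μ ≤ liminf (fun n => ∫⁻ a, ∫⁻ ξ, f ξ ∂(κ n a) ∂μ) atTop := by
  -- finite measures and bounded functions
  have h1 (μ : Measure A) [IsFiniteMeasure μ] (hμ : μ ≪ m) (b : ℕ) :
      Tendsto (fun n => ∫⁻ a, ∫⁻ ξ, (min (f ξ) b : ℝ≥0) ∂(κ n a) ∂μ) atTop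
        (𝓝 (∫⁻ a, ∫⁻ ξ, (min (f ξ) b : ℝ≥0) ∂(κ' a) ∂μ)) := by
    let F : V →ᵇ ℝ := BoundedContinuousFunction.mkOfBound
      ⟨fun ξ => (min (f ξ) b : ℝ≥0), by fun_prop⟩ b (by
        intro x y
        have hx : ((min (f x) b : ℝ≥0) : ℝ) ≤ b := by exact_mod_cast min_le_right _ _
        have hy : ((min (f y) b : ℝ≥0) : ℝ) ≤ b := by exact_mod_cast min_le_right _ _
        have hx0 := NNReal.coe_nonneg (min (f x) (b : ℝ≥0))
        have hy0 := NNReal.coe_nonneg (min (f y) (b : ℝ≥0))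
        rw [ContinuousMap.coe_mk, Real.dist_eq, abs_le]
        constructor <;> linarith)
    have hF (ξ : V) : F ξ = (min (f ξ) b : ℝ≥0) := rfl
    have e (η : Kernel A V) [IsMarkovKernel η] :
        ∫⁻ a, ∫⁻ ξ, (min (f ξ) b : ℝ≥0) ∂(η a) ∂μ =
          ENNReal.ofReal (∫ a, ∫ ξ, F ξ ∂(η a) ∂μ) := by
      rw [ofReal_integral_eq_lintegral_ofReal (integrable_integral_bcf μ η F)
        (ae_of_all _ fun a => integral_nonneg fun ξ => NNReal.coe_nonneg _)]
      refine lintegral_congr fun a => ?_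
      rw [ofReal_integral_eq_lintegral_ofReal (F.integrable _)
        (ae_of_all _ fun ξ => NNReal.coe_nonneg _)]
      simp [hF]
    simp_rw [e]
    exact (ENNReal.continuous_ofReal.tendsto _).comp (h μ inferInstance hμ F)
  have hsup (ξ : V) : (f ξ : ℝ≥0∞) = ⨆ b : ℕ, ((min (f ξ) b : ℝ≥0) : ℝ≥0∞) := by
    refine le_antisymm ?_ (iSup_le fun b => by exact_mod_cast min_le_left _ _)
    obtain ⟨b, hb⟩ := exists_nat_ge (f ξ)
    exact le_iSup_of_le b (by rw [min_eq_left hb])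
  have hmeas (b : ℕ) : Measurable fun ξ => ((min (f ξ) b : ℝ≥0) : ℝ≥0∞) := by
    have : Continuous fun ξ => min (f ξ) (b : ℝ≥0) := by fun_prop
    exact this.measurable.coe_nnreal_ennreal
  have hmono : Monotone fun (b : ℕ) (ξ : V) => ((min (f ξ) b : ℝ≥0) : ℝ≥0∞) := by
    intro b c hbc ξ
    have : (b : ℝ≥0) ≤ c := by exact_mod_cast hbc
    exact ENNReal.coe_le_coe.2 (min_le_min_left _ this)
  -- finite measures
  have h2 (μ : Measure A) [IsFiniteMeasure μ] (hμ : μ ≪ m) :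
      ∫⁻ a, ∫⁻ ξ, f ξ ∂(κ' a) ∂μ ≤ liminf (fun n => ∫⁻ a, ∫⁻ ξ, f ξ ∂(κ n a) ∂μ) atTop := by
    have e : ∫⁻ a, ∫⁻ ξ, f ξ ∂(κ' a) ∂μ =
        ⨆ b : ℕ, ∫⁻ a, ∫⁻ ξ, (min (f ξ) b : ℝ≥0) ∂(κ' a) ∂μ := by
      rw [← lintegral_iSup (fun b => (hmeas b).lintegral_kernel)
        (fun b c hbc a => lintegral_mono (hmono hbc))]
      refine lintegral_congr fun a => ?_
      rw [← lintegral_iSup hmeas hmono]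
      simp_rw [hsup]
    rw [e]
    refine iSup_le fun b => ?_
    rw [← (h1 μ hμ b).liminf_eq]
    refine liminf_le_liminf (Eventually.of_forall fun n => ?_)
    gcongr
    exact min_le_left _ _
  -- s-finite measures
  have e : ∫⁻ a, ∫⁻ ξ, f ξ ∂(κ' a) ∂μ =
      ⨆ N : ℕ, ∫⁻ a, ∫⁻ ξ, f ξ ∂(κ' a) ∂(∑ i ∈ Finset.range N, sfiniteSeq μ i) := by
    conv_lhs => rw [← sum_sfiniteSeq μ]
    rw [lintegral_sum_measure, ENNReal.tsum_eq_iSup_nat]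
    simp_rw [lintegral_finsetSum_measure]
  rw [e]
  refine iSup_le fun N => ?_
  have hle : ∑ i ∈ Finset.range N, sfiniteSeq μ i ≤ μ := by
    conv_rhs => rw [← sum_sfiniteSeq μ]
    exact Measure.le_intro fun s hs _ => by
      rw [Measure.sum_apply _ hs, Measure.coe_finsetSum, Finset.sum_apply]
      exact ENNReal.sum_le_tsum _
  refine (h2 _ ((Measure.absolutelyContinuous_of_le hle).trans hμ)).trans ?_
  exact liminf_le_liminf (Eventually.of_forall fun n => lintegral_mono' hle le_rfl)

end StableTendsto

/-- Sequential compactness for stable convergence, simultaneously for countably many sequences of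
Markov kernels. -/
theorem exists_subseq_stableTendsto {ι : Type*} [Countable ι] {A V : ι → Type*}
    [∀ k, TopologicalSpace (A k)] [∀ k, PolishSpace (A k)] [∀ k, MeasurableSpace (A k)]
    [∀ k, BorelSpace (A k)]
    [∀ k, TopologicalSpace (V k)] [∀ k, PolishSpace (V k)] [∀ k, MeasurableSpace (V k)]
    [∀ k, BorelSpace (V k)] [∀ k, Nonempty (V k)]
    (m : ∀ k, Measure (A k)) [∀ k, SFinite (m k)] [∀ k, NeZero (m k)]
    (κ : ℕ → ∀ k, Kernel (A k) (V k)) [∀ n k, IsMarkovKernel (κ n k)]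
    (htight : ∀ k, ∀ μ : Measure (A k), IsFiniteMeasure μ → μ ≪ m k →
      IsTightMeasureSet (range fun n => (μ ⊗ₘ κ n k).snd)) :
    ∃ s : ℕ → ℕ, StrictMono s ∧ ∃ κ' : ∀ k, Kernel (A k) (V k), (∀ k, IsMarkovKernel (κ' k)) ∧
      ∀ k, StableTendsto (m k) (fun j => κ (s j) k) (κ' k) := by
  let mf (k : ι) : Measure (A k) := (m k).toFinite
  have hprob (k : ι) : IsProbabilityMeasure (mf k) := by
    simp only [mf]; infer_instance
  -- The base measure is replaced by the probability measure `mf k` with the same null sets, so that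
  -- kernels become probability measures on the product, to which Prokhorov's theorem applies.
  let P (n : ℕ) (k : ι) : ProbabilityMeasure (A k × V k) := ⟨mf k ⊗ₘ κ n k, inferInstance⟩
  let S (k : ι) : Set (ProbabilityMeasure (A k × V k)) := closure (range fun n => P n k)
  have hS (k : ι) : IsCompact (S k) := by
    refine isCompact_closure_of_isTightMeasureSet ?_
    refine IsTightMeasureSet.prodMk ?_ ?_
    · refine (isTightMeasureSet_singleton (μ := mf k)).subset ?_
      rintro _ ⟨_, ⟨_, ⟨n, rfl⟩, rfl⟩, rfl⟩
      exact Measure.fst_compProd _ _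
    · refine (htight k (mf k) inferInstance (toFinite_absolutelyContinuous _)).subset ?_
      rintro _ ⟨_, ⟨_, ⟨n, rfl⟩, rfl⟩, rfl⟩
      exact ⟨n, rfl⟩
  -- Countability of the index set makes the compact product first countable, hence sequentially
  -- compact: one subsequence works for every k.
  obtain ⟨Q, hQ, s, hs, hlim⟩ := (isCompact_univ_pi hS).tendsto_subseq
    (x := fun n k => P n k) (fun n k _ => subset_closure ⟨n, rfl⟩)
  refine ⟨s, hs, fun k => (Q k : Measure (A k × V k)).condKernel, fun k => inferInstance,
    fun k => ?_⟩
  have hlimk : Tendsto (fun j => P (s j) k) atTop (𝓝 (Q k)) := tendsto_pi_nhds.1 hlim k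
  rw [ProbabilityMeasure.tendsto_iff_forall_integral_tendsto] at hlimk
  have hfst : (Q k : Measure (A k × V k)).fst = mf k := by
    refine ext_of_forall_integral_eq_of_IsFiniteMeasure fun φ => ?_
    have h1 := hlimk (φ.compContinuous ⟨Prod.fst, continuous_fst⟩)
    have h2 (ρ : Measure (A k × V k)) :
        ∫ p, (φ.compContinuous ⟨Prod.fst, continuous_fst⟩ : A k × V k →ᵇ ℝ) p ∂ρ =
          ∫ a, φ a ∂(ρ.fst) := by
      rw [Measure.fst, integral_map measurable_fst.aemeasurable
        φ.continuous.aestronglyMeasurable]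
      rfl
    simp_rw [h2] at h1
    have h3 (j : ℕ) : (P (s j) k : Measure (A k × V k)).fst = mf k := Measure.fst_compProd _ _
    simp_rw [h3] at h1
    exact (tendsto_nhds_unique h1 tendsto_const_nhds)
  have hdis : mf k ⊗ₘ (Q k : Measure (A k × V k)).condKernel = Q k := by
    rw [← hfst]; exact Measure.disintegrate _ _
  -- convergence for continuous densities
  have hcont (φ : A k →ᵇ ℝ) (f : V k →ᵇ ℝ) :
      Tendsto (fun j => ∫ a, φ a * ∫ ξ, f ξ ∂(κ (s j) k a) ∂(mf k)) atTop
        (𝓝 (∫ a, φ a * ∫ ξ, f ξ ∂((Q k : Measure (A k × V k)).condKernel a) ∂(mf k))) := by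
    have h1 := hlimk (φ.compContinuous ⟨Prod.fst, continuous_fst⟩ *
      f.compContinuous ⟨Prod.snd, continuous_snd⟩)
    have h2 (η : Kernel (A k) (V k)) [IsMarkovKernel η] :
        ∫ p, (φ.compContinuous ⟨Prod.fst, continuous_fst⟩ *
          f.compContinuous ⟨Prod.snd, continuous_snd⟩ : A k × V k →ᵇ ℝ) p ∂(mf k ⊗ₘ η) =
        ∫ a, φ a * ∫ ξ, f ξ ∂(η a) ∂(mf k) := by
      rw [Measure.integral_compProd (BoundedContinuousFunction.integrable _ _)]
      simp [integral_const_mul]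
    rw [← hdis, h2] at h1
    refine h1.congr fun j => ?_
    exact h2 _
  intro μ hμ hac f
  have hac' : μ ≪ mf k := hac.trans (absolutelyContinuous_toFinite _)
  have hrn : Integrable (fun a => (μ.rnDeriv (mf k) a).toReal) (mf k) :=
    Measure.integrable_toReal_rnDeriv
  have key (η : Kernel (A k) (V k)) : ∫ a, ∫ ξ, f ξ ∂(η a) ∂μ =
      ∫ a, (μ.rnDeriv (mf k) a).toReal * ∫ ξ, f ξ ∂(η a) ∂(mf k) := by
    rw [← integral_rnDeriv_smul hac']; rfl
  simp_rw [key]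
  rw [Metric.tendsto_atTop]
  intro ε hε
  -- Weak convergence of the joint laws handles only continuous densities. The Radon-Nikodym density
  -- is approximated in L¹, with an error that is uniform over all Markov kernels because integrals
  -- of `f` are bounded by ‖f‖.
  obtain ⟨φ, hφ, hφi⟩ := hrn.exists_boundedContinuous_integral_sub_le
    (ε := ε / (3 * (‖f‖ + 1))) (by positivity)
  have herr (η : Kernel (A k) (V k)) [IsMarkovKernel η] :
      |(∫ a, (μ.rnDeriv (mf k) a).toReal * ∫ ξ, f ξ ∂(η a) ∂(mf k)) -
        ∫ a, φ a * ∫ ξ, f ξ ∂(η a) ∂(mf k)| ≤ ε / 3 := by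
    have hb := (stronglyMeasurable_integral_bcf η f).aestronglyMeasurable (μ := mf k)
    have hbd : ∀ᵐ a ∂(mf k), ‖∫ ξ, f ξ ∂(η a)‖ ≤ ‖f‖ := ae_of_all _ fun a => norm_integral_bcf_le f
    rw [← integral_sub (hrn.mul_bdd (c := ‖f‖) hb hbd) (hφi.mul_bdd (c := ‖f‖) hb hbd),
      ← Real.norm_eq_abs]
    calc _ ≤ ∫ a, ‖(μ.rnDeriv (mf k) a).toReal - φ a‖ * ‖f‖ ∂(mf k) := by
          refine norm_integral_le_of_norm_le ((hrn.sub hφi).norm.mul_const _) ?_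
          filter_upwards [hbd] with a ha
          rw [← sub_mul, norm_mul]
          gcongr
      _ = (∫ a, ‖(μ.rnDeriv (mf k) a).toReal - φ a‖ ∂(mf k)) * ‖f‖ := integral_mul_const _ _
      _ ≤ ε / (3 * (‖f‖ + 1)) * (‖f‖ + 1) := by gcongr; linarith
      _ = ε / 3 := by field_simp
  obtain ⟨N, hN⟩ := Metric.tendsto_atTop.1 (hcont φ f) (ε / 3) (by positivity)
  refine ⟨N, fun j hj => ?_⟩
  have e1 := herr (κ (s j) k)
  have e2 := herr (Q k : Measure (A k × V k)).condKernel
  have e3 := hN j hj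
  rw [Real.dist_eq] at e3 ⊢
  rw [abs_le] at e1 e2
  rw [abs_lt] at e3 ⊢
  constructor <;> linarith

/-! ### Consistent families of kernels -/

section Base

variable {X : Type*} [MeasurableSpace X]

/-- The product of a measure on time and `k` copies of a measure on space. -/
noncomputable def baseMeasure (τ : Measure ℝ) (lam : Measure X) (k : ℕ) :
    Measure (ℝ × (Fin k → X)) :=
  τ.prod (Measure.pi fun _ => lam)

variable {τ : Measure ℝ} {lam : Measure X} [SigmaFinite lam]

lemma ae_ae_of_ae_base {k : ℕ} {P : ℝ × (Fin k → X) → Prop}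
    (h : ∀ᵐ z ∂(baseMeasure τ lam k), P z) :
    ∀ᵐ t ∂τ, ∀ᵐ x ∂(Measure.pi fun _ : Fin k => lam), P (t, x) :=
  Measure.ae_ae_of_ae_prod h

variable [SigmaFinite τ]

instance (k : ℕ) : SigmaFinite (baseMeasure τ lam k) := by
  unfold baseMeasure; infer_instance

/-- Forgetting coordinates multiplies the measure by the mass of the forgotten factors, which may be
infinite. Only null sets are tracked, and that suffices for identities holding a.e. -/
lemma quasiMeasurePreserving_comp_injective {j k : ℕ} {ι : Fin j → Fin k}
    (hι : Function.Injective ι) :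
    Measure.QuasiMeasurePreserving (fun x : Fin k → X => x ∘ ι)
      (Measure.pi fun _ => lam) (Measure.pi fun _ => lam) := by
  classical
  let p : Fin k → Prop := fun i => i ∈ range ι
  let : Fintype {i // p i} := Subtype.fintype p
  let e : Fin j ≃ {i // p i} := Equiv.ofInjective ι hι
  have h1 := (measurePreserving_piEquivPiSubtypeProd (fun _ : Fin k => lam) p).quasiMeasurePreserving
  have h2 := (Measure.quasiMeasurePreserving_fst
    (μ := Measure.pi fun _ : {i // p i} => lam) (ν := Measure.pi fun _ : {i // ¬ p i} => lam)).comp h1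
  have h3 := (measurePreserving_piCongrLeft (fun _ : {i // p i} => lam) e).symm
  exact h3.quasiMeasurePreserving.comp h2

lemma quasiMeasurePreserving_prodMap_id {Y Z : Type*} [MeasurableSpace Y] [MeasurableSpace Z]
    {μ : Measure Y} {ν : Measure Z} [SFinite μ] [SFinite ν] {f : Y → Z}
    (hf : Measure.QuasiMeasurePreserving f μ ν) :
    Measure.QuasiMeasurePreserving (fun z : ℝ × Y => (z.1, f z.2)) (τ.prod μ) (τ.prod ν) := by
  refine ⟨by have := hf.measurable; fun_prop, ?_⟩
  have : (fun z : ℝ × Y => (z.1, f z.2)) = Prod.map id f := rfl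
  rw [this, ← Measure.map_prod_map _ _ measurable_id hf.measurable, Measure.map_id]
  exact Measure.AbsolutelyContinuous.rfl.prod hf.absolutelyContinuous

lemma quasiMeasurePreserving_base {j k : ℕ} {ι : Fin j → Fin k} (hι : Function.Injective ι) :
    Measure.QuasiMeasurePreserving (fun z : ℝ × (Fin k → X) => (z.1, z.2 ∘ ι))
      (baseMeasure τ lam k) (baseMeasure τ lam j) :=
  quasiMeasurePreserving_prodMap_id (quasiMeasurePreserving_comp_injective hι)

end Base

section Family

variable {X : Type*} [MeasurableSpace X] {U : Type*} [MeasurableSpace U]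

/-- Families of kernels which are symmetric and consistent almost everywhere. -/
structure IsConsistentFamily (τ : Measure ℝ) (lam : Measure X)
    (κ : ∀ k : ℕ, Kernel (ℝ × (Fin k → X)) (Fin k → U)) : Prop where
  symmetry : ∀ (k : ℕ) (σ : Equiv.Perm (Fin k)), ∀ᵐ z ∂(baseMeasure τ lam k),
    κ k (z.1, z.2 ∘ σ) = (κ k z).map (fun ξ => ξ ∘ σ)
  consistency : ∀ k : ℕ, ∀ᵐ z ∂(baseMeasure τ lam (k + 1)),
    κ k (z.1, z.2 ∘ Fin.castSucc) = (κ (k + 1) z).map (fun ξ => ξ ∘ Fin.castSucc)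

lemma measurable_comp_index {j k : ℕ} (ι : Fin j → Fin k) :
    Measurable fun ξ : Fin k → U => ξ ∘ ι := by
  unfold Function.comp; fun_prop

/-- The marginals of a consistent family. -/
lemma IsConsistentFamily.marginal {τ : Measure ℝ} [SigmaFinite τ] {lam : Measure X}
    [SigmaFinite lam] {κ : ∀ k : ℕ, Kernel (ℝ × (Fin k → X)) (Fin k → U)}
    (h : IsConsistentFamily τ lam κ) {j k : ℕ} {ι : Fin j → Fin k}
    (hι : Function.Injective ι) :
    ∀ᵐ z ∂(baseMeasure τ lam k), κ j (z.1, z.2 ∘ ι) = (κ k z).map (fun ξ => ξ ∘ ι) := by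
  classical
  have hjk : j ≤ k := by simpa using Fintype.card_le_of_injective ι hι
  have hcomp {a b c : ℕ} {ι₁ : Fin a → Fin b} {ι₂ : Fin b → Fin c}
      (h2 : Function.Injective ι₂)
      (H1 : ∀ᵐ z ∂(baseMeasure τ lam b), κ a (z.1, z.2 ∘ ι₁) = (κ b z).map (fun ξ => ξ ∘ ι₁))
      (H2 : ∀ᵐ z ∂(baseMeasure τ lam c), κ b (z.1, z.2 ∘ ι₂) = (κ c z).map (fun ξ => ξ ∘ ι₂)) :
      ∀ᵐ z ∂(baseMeasure τ lam c),
        κ a (z.1, z.2 ∘ (ι₂ ∘ ι₁)) = (κ c z).map (fun ξ => ξ ∘ (ι₂ ∘ ι₁)) := by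
    filter_upwards [(quasiMeasurePreserving_base h2).ae H1, H2] with z hz1 hz2
    rw [hz2, Measure.map_map (measurable_comp_index _) (measurable_comp_index _)] at hz1
    exact hz1
  have hcast : ∀ n : ℕ, ∀ᵐ z ∂(baseMeasure τ lam (j + n)),
      κ j (z.1, z.2 ∘ Fin.castAdd n) = (κ (j + n) z).map (fun ξ => ξ ∘ Fin.castAdd n) := by
    intro n
    induction n with
    | zero =>
      refine ae_of_all _ fun z => ?_
      exact (Measure.map_id).symm
    | succ n ih =>
      exact hcomp (ι₁ := Fin.castAdd n) (ι₂ := Fin.castSucc) (Fin.castSucc_injective _) ih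
        (h.consistency _)
  obtain ⟨n, rfl⟩ := Nat.exists_eq_add_of_le hjk
  let p : Fin (j + n) → Prop := fun i => i ∈ range (Fin.castAdd n : Fin j → Fin (j + n))
  let q : Fin (j + n) → Prop := fun i => i ∈ range ι
  -- An arbitrary injection is the initial inclusion followed by a permutation. The permutation
  -- extends the bijection between the two ranges.
  let e : {i // p i} ≃ {i // q i} :=
    (Equiv.ofInjective _ (Fin.castAdd_injective j n)).symm.trans (Equiv.ofInjective ι hι)
  have hσ : ι = e.extendSubtype ∘ Fin.castAdd n := by
    funext i
    have hp : p (Fin.castAdd n i) := ⟨i, rfl⟩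
    rw [Function.comp_apply, Equiv.extendSubtype_apply_of_mem e _ hp]
    have : (⟨Fin.castAdd n i, hp⟩ : {i // p i}) =
      Equiv.ofInjective _ (Fin.castAdd_injective j n) i := rfl
    simp only [e, this, Equiv.trans_apply, Equiv.symm_apply_apply]
    rfl
  rw [hσ]
  exact hcomp e.extendSubtype.injective (hcast n) (h.symmetry _ _)

end Family

/-! ### Kernels representing correlation measures -/

section Bridge

variable {d N : ℕ} {p : ℝ≥0∞} {D : Set (EuclideanSpace ℝ (Fin d))} {T : EReal}

lemma cmSpaceMeasure_eq_pi (D : Set (EuclideanSpace ℝ (Fin d))) (k : ℕ) :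
    cmSpaceMeasure D k = Measure.pi fun _ => volume.restrict D := by
  rw [cmSpaceMeasure, cmPower, volume_pi]
  exact Measure.restrict_pi_pi _ _

lemma cmSpaceTimeMeasure_eq (D : Set (EuclideanSpace ℝ (Fin d))) (T : EReal) (k : ℕ) :
    cmSpaceTimeMeasure D T k = baseMeasure (cmTimeMeasure T) (volume.restrict D) k := by
  rw [cmSpaceTimeMeasure, cmSpaceMeasure_eq_pi, baseMeasure]

instance : SigmaFinite (cmTimeMeasure T) := by unfold cmTimeMeasure; infer_instance

lemma measure_ext_of_subsingleton {V : Type*} [Subsingleton V] [MeasurableSpace V]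
    (μ ν : Measure V) [IsProbabilityMeasure μ] [IsProbabilityMeasure ν] : μ = ν := by
  ext s hs
  rcases Subsingleton.set_cases (p := fun s => μ s = ν s) (by simp) (by simp) s with h
  exact h

/-- For each f the exceptional points depend on t and on f. Joint measurability of the two integrals
turns them into one null set of the product, and a countable separating family removes the
dependence on f. -/
lemma ae_eq_of_forall_integral_eq_slice {X V : Type*} [MeasurableSpace X]
    [NormedAddCommGroup V] [ProperSpace V] [MeasurableSpace V] [BorelSpace V]
    {τ : Measure ℝ} {lam : Measure X} [SFinite lam]
    {κ η : Kernel (ℝ × X) V} [IsMarkovKernel κ] [IsMarkovKernel η]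
    (h : ∀ f : C₀(V, ℝ), ∀ᵐ t ∂τ, ∀ᵐ x ∂lam, ∫ ξ, f ξ ∂(κ (t, x)) = ∫ ξ, f ξ ∂(η (t, x))) :
    κ =ᵐ[τ.prod lam] η := by
  have : SecondCountableTopology V := secondCountable_of_proper
  obtain ⟨I, _, F, hF⟩ := exists_seq_zeroAtInfty_separating V
  have key : ∀ i, ∀ᵐ z ∂(τ.prod lam), ∫ ξ, F i ξ ∂(κ z) = ∫ ξ, F i ξ ∂(η z) := by
    intro i
    have hm (ρ : Kernel (ℝ × X) V) [IsMarkovKernel ρ] : Measurable fun z => ∫ ξ, F i ξ ∂(ρ z) :=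
      (StronglyMeasurable.integral_kernel
        (ContinuousMapClass.map_continuous (F i)).measurable.stronglyMeasurable).measurable
    exact (Measure.ae_prod_mem_iff_ae_ae_mem (measurableSet_eq_fun (hm κ) (hm η))).2 (h (F i))
  filter_upwards [ae_all_iff.2 key] with z hz
  exact hF _ _ inferInstance inferInstance hz

/-- Time-dependent correlation measures are represented by a consistent family of kernels. -/
lemma IsTimeDepCorrelationMeasure.exists_kernel
    {ν : ∀ k : ℕ, ℝ → (Fin k → EuclideanSpace ℝ (Fin d)) →
      Measure (Fin k → EuclideanSpace ℝ (Fin N))}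
    (hν : IsTimeDepCorrelationMeasure p D T ν) :
    ∃ κ : ∀ k : ℕ, Kernel (ℝ × (Fin k → EuclideanSpace ℝ (Fin d)))
        (Fin k → EuclideanSpace ℝ (Fin N)),
      (∀ k, IsMarkovKernel (κ k)) ∧
      IsConsistentFamily (cmTimeMeasure T) (volume.restrict D) κ ∧
      ∀ k, 1 ≤ k → ∀ᵐ z ∂(baseMeasure (cmTimeMeasure T) (volume.restrict D) k),
        ν k z.1 z.2 = κ k z := by
  classical
  set lam : Measure (EuclideanSpace ℝ (Fin d)) := volume.restrict D
  have step (k : ℕ) : ∃ κ : Kernel (ℝ × (Fin k → EuclideanSpace ℝ (Fin d)))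
      (Fin k → EuclideanSpace ℝ (Fin N)), IsMarkovKernel κ ∧
      (1 ≤ k → ∀ᵐ z ∂(baseMeasure (cmTimeMeasure T) lam k), ν k z.1 z.2 = κ z) := by
    by_cases hk : 1 ≤ k
    · have hw := hν.weakStar k hk
      rw [cmSpaceTimeMeasure_eq] at hw
      obtain ⟨C, hC⟩ := hw.bounded
      obtain ⟨κ₀, hκ₀⟩ := exists_kernel_ae_eq hw.measurable
        (hC.mono fun z hz => ⟨hz.trans_lt ENNReal.coe_lt_top⟩)
      have hset : MeasurableSet {z | κ₀ z univ = 1} :=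
        measurableSet_eq_fun (Kernel.measurable_coe κ₀ MeasurableSet.univ) measurable_const
      have hprob : ∀ᵐ z ∂(baseMeasure (cmTimeMeasure T) lam k), κ₀ z univ = 1 := by
        refine (Measure.ae_prod_mem_iff_ae_ae_mem hset).2 ?_
        filter_upwards [hν.slice, ae_ae_of_ae_base hκ₀] with t ht1 ht2
        have := ht1.prob k hk
        rw [cmSpaceMeasure_eq_pi] at this
        filter_upwards [this, ht2] with x hx1 hx2
        have h3 := hx1.measure_univ
        rw [hx2] at h3
        exact h3
      -- Where the mass differs from one, a null set, the kernel is replaced by a point mass, so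
      -- that it is Markov everywhere.
      refine ⟨Kernel.piecewise hset κ₀ (Kernel.const _ (Measure.dirac 0)), ⟨fun z => ?_⟩,
        fun _ => ?_⟩
      · rw [Kernel.piecewise_apply]
        split_ifs with hz
        · exact ⟨hz⟩
        · rw [Kernel.const_apply]; infer_instance
      · filter_upwards [hκ₀, hprob] with z hz1 hz2
        rw [Kernel.piecewise_apply]
        exact hz1.trans (if_pos hz2).symm
    -- The index 0 carries no data. Its state space is a single point, so any Markov kernel fits
    -- symmetry and consistency.
    · exact ⟨Kernel.const _ (Measure.dirac 0), inferInstance, fun h => absurd h hk⟩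
  choose κ hκM hκ using step
  refine ⟨κ, hκM, ⟨fun k σ => ?_, fun k => ?_⟩, hκ⟩
  · rcases Nat.eq_zero_or_pos k with rfl | hk
    · refine ae_of_all _ fun z => ?_
      have := Measure.isProbabilityMeasure_map (μ := κ 0 z)
        (measurable_comp_index σ).aemeasurable
      exact measure_ext_of_subsingleton _ _
    have hπ := quasiMeasurePreserving_base (τ := cmTimeMeasure T) (lam := lam) σ.injective
    have := Kernel.IsMarkovKernel.map (κ k) (measurable_comp_index (U := EuclideanSpace ℝ (Fin N)) σ)
    have hae := ae_eq_of_forall_integral_eq_slice (τ := cmTimeMeasure T)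
      (lam := Measure.pi fun _ : Fin k => lam)
      (κ := (κ k).comap _ hπ.measurable) (η := (κ k).map (fun ξ => ξ ∘ σ)) (by
        intro f
        filter_upwards [hν.slice, ae_ae_of_ae_base (hκ k hk),
          ae_ae_of_ae_base (hπ.ae (hκ k hk))] with t ht1 ht2 ht3
        have h4 := ht1.symmetry k hk σ f
        rw [cmSpaceMeasure_eq_pi] at h4
        filter_upwards [h4, ht2, ht3] with x hx1 hx2 hx3
        rw [Kernel.comap_apply, Kernel.map_apply _ (measurable_comp_index σ),
          integral_map (measurable_comp_index σ).aemeasurable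
            (ContinuousMapClass.map_continuous f).aestronglyMeasurable, ← hx2, ← hx3]
        exact hx1)
    filter_upwards [hae] with z hz
    rw [Kernel.comap_apply, Kernel.map_apply _ (measurable_comp_index σ)] at hz
    exact hz
  · rcases Nat.eq_zero_or_pos k with rfl | hk
    · refine ae_of_all _ fun z => ?_
      have := Measure.isProbabilityMeasure_map (μ := κ (0 + 1) z)
        (measurable_comp_index (Fin.castSucc : Fin 0 → Fin (0 + 1))).aemeasurable
      exact measure_ext_of_subsingleton _ _
    have hπ := quasiMeasurePreserving_base (τ := cmTimeMeasure T) (lam := lam)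
      (Fin.castSucc_injective k)
    have hm := measurable_comp_index (U := EuclideanSpace ℝ (Fin N))
      (Fin.castSucc : Fin k → Fin (k + 1))
    have := Kernel.IsMarkovKernel.map (κ (k + 1)) hm
    have hae := ae_eq_of_forall_integral_eq_slice (τ := cmTimeMeasure T)
      (lam := Measure.pi fun _ : Fin (k + 1) => lam)
      (κ := (κ k).comap _ hπ.measurable) (η := (κ (k + 1)).map (fun ξ => ξ ∘ Fin.castSucc)) (by
        intro f
        filter_upwards [hν.slice, ae_ae_of_ae_base (hκ (k + 1) (by omega)),
          ae_ae_of_ae_base (hπ.ae (hκ k hk))] with t ht1 ht2 ht3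
        have h4 := ht1.consistency k hk f
        rw [cmSpaceMeasure_eq_pi] at h4
        filter_upwards [h4, ht2, ht3] with x hx1 hx2 hx3
        rw [Kernel.comap_apply, Kernel.map_apply _ hm,
          integral_map hm.aemeasurable
            (ContinuousMapClass.map_continuous f).aestronglyMeasurable, ← hx2, ← hx3]
        exact hx1.symm)
    filter_upwards [hae] with z hz
    rw [Kernel.comap_apply, Kernel.map_apply _ hm] at hz
    exact hz

end Bridge

/-! ### Tightness from moment bounds -/

/-- Bounds on moments over an exhausting sequence of sets control tails with respect to all
finite absolutely continuous measures. -/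
lemma exists_forall_lintegral_tail_le {A V : Type*} [MeasurableSpace A] [MeasurableSpace V]
    {m : Measure A} [SigmaFinite m] {ι : Type*} {κ : ι → Kernel A V} [∀ n, IsMarkovKernel (κ n)]
    {φ : V → ℝ≥0∞} (hφ : Measurable φ) {B : ℕ → Set A} (hB : ∀ K, MeasurableSet (B K))
    (hmono : Monotone B) (hunion : ∀ a, ∃ K, a ∈ B K)
    (hC : ∀ K, ∃ C : ℝ≥0, ∀ n, ∫⁻ a in B K, ∫⁻ ξ, φ ξ ∂(κ n a) ∂m ≤ C)
    (μ : Measure A) [IsFiniteMeasure μ] (hμ : μ ≪ m) {ε : ℝ≥0∞} (hε : 0 < ε) :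
    ∃ c : ℝ≥0, ∀ n, ∀ S : Set V, MeasurableSet S → (∀ ξ ∈ S, (c : ℝ≥0∞) ≤ φ ξ) →
      ∫⁻ a, κ n a S ∂μ ≤ ε := by
  let w := μ.rnDeriv m
  have hw : Measurable w := Measure.measurable_rnDeriv μ m
  have hwfin : ∫⁻ a, w a ∂m ≠ ∞ := (Measure.lintegral_rnDeriv_lt_top μ m).ne
  -- The density of `μ` is cut to height K on `B K`. The removed part has small integral and
  -- probabilities are at most one, while the part that is kept is controlled by Markov's inequality
  -- and the moment bound on `B K`.
  let v : ℕ → A → ℝ≥0∞ := fun K a => (B K).indicator (fun a => min (w a) K) a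
  have hv (K : ℕ) : Measurable (v K) := (hw.min measurable_const).indicator (hB K)
  have hvw (K : ℕ) (a : A) : v K a ≤ w a := by
    by_cases ha : a ∈ B K <;> simp [v, ha]
  have hlim : Tendsto (fun K => ∫⁻ a, (w a - v K a) ∂m) atTop (𝓝 (∫⁻ a, 0 ∂m)) := by
    refine tendsto_lintegral_of_dominated_convergence' w
      (fun K => (hw.sub (hv K)).aemeasurable) (fun K => ae_of_all _ fun a => tsub_le_self)
      hwfin ?_
    filter_upwards [Measure.rnDeriv_lt_top μ m] with a ha
    obtain ⟨K₁, hK₁⟩ := hunion a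
    obtain ⟨K₂, hK₂⟩ := ENNReal.exists_nat_gt ha.ne
    refine tendsto_const_nhds.congr' ?_
    filter_upwards [eventually_ge_atTop (max K₁ K₂)] with K hK
    have h1 : a ∈ B K := hmono ((le_max_left _ _).trans hK) hK₁
    have h2 : w a ≤ K := hK₂.le.trans (by exact_mod_cast (le_max_right _ _).trans hK)
    simp [v, h1, min_eq_left h2]
  rw [lintegral_zero] at hlim
  obtain ⟨K, hK⟩ := (hlim.eventually (ge_mem_nhds (ENNReal.half_pos hε.ne'))).exists
  obtain ⟨C, hC⟩ := hC K
  obtain ⟨c, hc0, hc⟩ : ∃ c : ℝ≥0, 0 < c ∧ (K : ℝ≥0∞) * C / c ≤ ε / 2 := by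
    rcases eq_or_ne ε ∞ with rfl | hε'
    · exact ⟨1, one_pos, by simp [ENNReal.top_div]⟩
    · have h2 : ε / 2 ≠ 0 := (ENNReal.half_pos hε.ne').ne'
      have h3 : ε / 2 ≠ ∞ := ENNReal.div_ne_top hε' (by simp)
      -- The added 1 keeps the threshold positive even when `K * C` vanishes.
      refine ⟨((K : ℝ≥0∞) * C / (ε / 2)).toNNReal + 1, by positivity, ?_⟩
      have h4 : (K : ℝ≥0∞) * C / (ε / 2) ≠ ∞ :=
        ENNReal.div_ne_top (ENNReal.mul_ne_top (by simp) (by simp)) h2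
      rw [ENNReal.coe_add, ENNReal.coe_toNNReal h4, ENNReal.div_le_iff (by simp) (by simp [h4])]
      calc (K : ℝ≥0∞) * C = (ε / 2) * ((K : ℝ≥0∞) * C / (ε / 2)) :=
            (ENNReal.mul_div_cancel h2 h3).symm
        _ ≤ _ := by gcongr; simp
  refine ⟨c, fun n S hS hSφ => ?_⟩
  have hκS : Measurable fun a => κ n a S := Kernel.measurable_coe _ hS
  have hle1 (a : A) : κ n a S ≤ 1 := prob_le_one
  have hmarkov (a : A) : κ n a S ≤ (∫⁻ ξ, φ ξ ∂(κ n a)) / c := by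
    rw [ENNReal.le_div_iff_mul_le (by simp [hc0.ne']) (by simp), mul_comm]
    exact (mul_le_mul_right (measure_mono hSφ) _).trans
      (mul_meas_ge_le_lintegral hφ _)
  calc ∫⁻ a, κ n a S ∂μ = ∫⁻ a, w a * κ n a S ∂m := (lintegral_rnDeriv_mul hμ hκS.aemeasurable).symm
    _ ≤ ∫⁻ a, ((w a - v K a) + (B K).indicator (fun a => K * ((∫⁻ ξ, φ ξ ∂(κ n a)) / c)) a) ∂m := by
        refine lintegral_mono fun a => ?_
        calc w a * κ n a S = (w a - v K a) * κ n a S + v K a * κ n a S := by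
              rw [← add_mul, tsub_add_cancel_of_le (hvw K a)]
          _ ≤ (w a - v K a) * 1 +
              (B K).indicator (fun a => K * ((∫⁻ ξ, φ ξ ∂(κ n a)) / c)) a := by
              refine add_le_add (mul_le_mul_right (hle1 a) _) ?_
              · by_cases ha : a ∈ B K
                · simp only [v, ha, indicator_of_mem]
                  gcongr
                  · exact min_le_right _ _
                  · exact hmarkov a
                · simp [v, ha]
          _ = _ := by rw [mul_one]
    _ = ∫⁻ a, (w a - v K a) ∂m + ∫⁻ a in B K, K * ((∫⁻ ξ, φ ξ ∂(κ n a)) / c) ∂m := by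
        rw [lintegral_add_left (show Measurable fun a => w a - v K a from hw.sub (hv K)),
          lintegral_indicator (hB K)]
    _ ≤ ε / 2 + ε / 2 := by
        gcongr
        simp_rw [ENNReal.div_eq_inv_mul]
        have hm : Measurable fun a => ∫⁻ ξ, φ ξ ∂(κ n a) := hφ.lintegral_kernel
        rw [lintegral_const_mul _ (hm.const_mul _), lintegral_const_mul _ hm]
        calc (K : ℝ≥0∞) * ((c : ℝ≥0∞)⁻¹ * ∫⁻ a in B K, ∫⁻ ξ, φ ξ ∂(κ n a) ∂m)
            ≤ (K : ℝ≥0∞) * ((c : ℝ≥0∞)⁻¹ * C) := by gcongr; exact hC n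
          _ = (K : ℝ≥0∞) * C / c := by rw [ENNReal.div_eq_inv_mul]; ring
          _ ≤ ε / 2 := hc
          _ = _ := by rw [ENNReal.div_eq_inv_mul]
    _ = ε := ENNReal.add_halves ε

section Families

variable {X : Type*} [MeasurableSpace X] {U : Type*} [NormedAddCommGroup U] [ProperSpace U]
  [MeasurableSpace U] [BorelSpace U] {τ : Measure ℝ} [IsLocallyFiniteMeasure τ]
  {lam : Measure X} [SigmaFinite lam]

/-- The moment of order `q` of the one-point measures. -/
noncomputable def kMoment (lam : Measure X) (q : ℝ) (ρ : (Fin 1 → X) → Measure (Fin 1 → U)) :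
    ℝ≥0∞ :=
  ∫⁻ x, ∫⁻ ξ, ‖ξ 0‖ₑ ^ q ∂(ρ x) ∂(Measure.pi fun _ => lam)

/-- Tails are estimated one component at a time. By consistency the law of a component is the
one-point measure, whose moment is integrable over bounded time windows times all of `X`; these
windows exhaust the base. -/
lemma isTightMeasureSet_of_kMoment_le {ι : Type*}
    {κ : ι → ∀ k : ℕ, Kernel (ℝ × (Fin k → X)) (Fin k → U)} [∀ n k, IsMarkovKernel (κ n k)]
    (hκ : ∀ n, IsConsistentFamily τ lam (κ n)) {q : ℝ} (hq : 0 < q) {C : ℝ≥0}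
    (hC : ∀ n, ∀ᵐ t ∂τ, kMoment lam q (fun x => κ n 1 (t, x)) ≤ C) (k : ℕ)
    (μ : Measure (ℝ × (Fin k → X))) [IsFiniteMeasure μ] (hμ : μ ≪ baseMeasure τ lam k) :
    IsTightMeasureSet (range fun n => (μ ⊗ₘ κ n k).snd) := by
  have : SecondCountableTopology U := secondCountable_of_proper
  rw [isTightMeasureSet_iff_exists_isCompact_measure_compl_le]
  intro ε hε
  have hφ : Measurable fun ξ : Fin 1 → U => ‖ξ 0‖ₑ ^ q := by fun_prop
  -- tails of one component
  have hcomp (i : Fin k) : ∃ c : ℝ≥0, ∀ n, ∀ b : ℝ≥0, c ≤ b →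
      ∫⁻ z, κ n k z {ξ | (b : ℝ≥0∞) ≤ ‖ξ i‖ₑ ^ q} ∂μ ≤ ε / k := by
    have hinj : Function.Injective (fun _ : Fin 1 => i) := fun _ _ _ => Subsingleton.elim _ _
    have hπ := quasiMeasurePreserving_base (τ := τ) (lam := lam) hinj
    let μ' := μ.map (fun z : ℝ × (Fin k → X) => (z.1, z.2 ∘ fun _ : Fin 1 => i))
    have hμ' : μ' ≪ baseMeasure τ lam 1 := (hμ.map hπ.measurable).trans hπ.absolutelyContinuous
    have : IsFiniteMeasure μ' := Measure.isFiniteMeasure_map _ _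
    obtain ⟨c, hc⟩ := exists_forall_lintegral_tail_le (m := baseMeasure τ lam 1)
      (κ := fun n => κ n 1) hφ
      (B := fun K : ℕ => Metric.closedBall (0 : ℝ) K ×ˢ univ)
      (fun K => measurableSet_closedBall.prod MeasurableSet.univ)
      (fun K L hKL => prod_mono (Metric.closedBall_subset_closedBall (by exact_mod_cast hKL))
        le_rfl)
      (fun a => by
        obtain ⟨K, hK⟩ := exists_nat_ge ‖a.1‖
        exact ⟨K, by simpa using hK⟩)
      (fun K => by
        have hfin : τ (Metric.closedBall (0 : ℝ) K) ≠ ∞ :=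
          (isCompact_closedBall _ _).measure_lt_top.ne
        refine ⟨C * (τ (Metric.closedBall (0 : ℝ) K)).toNNReal, fun n => ?_⟩
        rw [baseMeasure, ← Measure.prod_restrict, Measure.restrict_univ,
          lintegral_prod _ hφ.lintegral_kernel.aemeasurable]
        calc _ ≤ ∫⁻ t in Metric.closedBall (0 : ℝ) K, (C : ℝ≥0∞) ∂τ :=
              lintegral_mono_ae (ae_restrict_of_ae (hC n))
          _ = _ := by simp [ENNReal.coe_toNNReal hfin])
      μ' hμ' (ε := ε / k) (ENNReal.div_pos hε.ne' (by simp))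
    refine ⟨c, fun n b hb => ?_⟩
    have hS : MeasurableSet {ξ : Fin 1 → U | (b : ℝ≥0∞) ≤ ‖ξ 0‖ₑ ^ q} :=
      measurableSet_le measurable_const hφ
    have h1 := hc n _ hS (fun ξ hξ => le_trans (by exact_mod_cast hb) hξ)
    rw [lintegral_map (Kernel.measurable_coe _ hS) hπ.measurable] at h1
    refine le_trans (le_of_eq (lintegral_congr_ae ?_)) h1
    filter_upwards [hμ.ae_le ((hκ n).marginal hinj)] with z hz
    rw [hz, Measure.map_apply (measurable_comp_index _) hS]
    rfl
  choose c hc using hcomp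
  let b : ℝ≥0 := ∑ i, c i
  refine ⟨Metric.closedBall 0 ((b : ℝ) ^ q⁻¹), isCompact_closedBall _ _, ?_⟩
  rintro _ ⟨n, rfl⟩
  have hms : MeasurableSet (Metric.closedBall (0 : Fin k → U) ((b : ℝ) ^ q⁻¹))ᶜ :=
    measurableSet_closedBall.compl
  rw [Measure.snd_apply hms, Measure.compProd_apply (measurable_snd hms)]
  calc _ ≤ ∫⁻ z, ∑ i, κ n k z {ξ | (b : ℝ≥0∞) ≤ ‖ξ i‖ₑ ^ q} ∂μ := by
        refine lintegral_mono fun z => ?_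
        refine (measure_mono ?_).trans (measure_iUnion_fintype_le _ _)
        intro ξ hξ
        simp only [mem_preimage, mem_compl_iff, Metric.mem_closedBall, dist_zero_right] at hξ
        rw [pi_norm_le_iff_of_nonneg (by positivity)] at hξ
        push Not at hξ
        obtain ⟨i, hi⟩ := hξ
        refine mem_iUnion.2 ⟨i, ?_⟩
        have h2 : (b : ℝ) ≤ ‖ξ i‖ ^ q := by
          calc (b : ℝ) = ((b : ℝ) ^ q⁻¹) ^ q := by
                rw [← Real.rpow_mul (by positivity), inv_mul_cancel₀ hq.ne', Real.rpow_one]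
            _ ≤ _ := by gcongr
        change (b : ℝ≥0∞) ≤ ‖ξ i‖ₑ ^ q
        rw [← ofReal_norm, ENNReal.ofReal_rpow_of_nonneg (norm_nonneg _) hq.le,
          ← ENNReal.ofReal_coe_nnreal]
        exact ENNReal.ofReal_le_ofReal h2
    _ = ∑ i, ∫⁻ z, κ n k z {ξ | (b : ℝ≥0∞) ≤ ‖ξ i‖ₑ ^ q} ∂μ := by
        refine lintegral_finsetSum _ fun i _ => Kernel.measurable_coe _ ?_
        exact measurableSet_le measurable_const (by fun_prop)
    _ ≤ ∑ i : Fin k, ε / k := by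
        gcongr with i
        exact hc i n b (Finset.single_le_sum (f := c) (fun _ _ => zero_le) (Finset.mem_univ i))
    _ ≤ ε := by
        rw [Finset.sum_const, Finset.card_univ, Fintype.card_fin, nsmul_eq_mul]
        exact ENNReal.mul_div_le

end Families

/-! ### The modulus of continuity in terms of kernels -/

section Modulus

variable {X : Type*} [PseudoMetricSpace X] [SecondCountableTopology X] [MeasurableSpace X]
  [BorelSpace X] {U : Type*} [NormedAddCommGroup U] [SecondCountableTopology U]
  [MeasurableSpace U] [BorelSpace U]

/-- The density of the uniform distribution on the ball around `x`, at `y`. -/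
noncomputable def ballWeight (lam : Measure X) (r : ℝ) (x y : X) : ℝ≥0∞ :=
  (Metric.ball x r).indicator (fun _ => (lam (Metric.ball x r))⁻¹) y

lemma measurable_measure_ball (lam : Measure X) [SFinite lam] (r : ℝ) :
    Measurable fun x => lam (Metric.ball x r) := by
  have : MeasurableSet {p : X × X | dist p.2 p.1 < r} :=
    measurableSet_lt (by fun_prop) measurable_const
  exact measurable_measure_prodMk_left this

lemma measurable_ballWeight (lam : Measure X) [SFinite lam] (r : ℝ) :
    Measurable fun p : X × X => ballWeight lam r p.1 p.2 := by
  have h : MeasurableSet {p : X × X | dist p.2 p.1 < r} :=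
    measurableSet_lt (by fun_prop) measurable_const
  exact (((measurable_measure_ball lam r).comp measurable_fst).inv).indicator h

/-- The modulus of continuity of the two-point measures. -/
noncomputable def kModulus (lam : Measure X) (q r : ℝ)
    (ρ : (Fin 2 → X) → Measure (Fin 2 → U)) : ℝ≥0∞ :=
  ∫⁻ x, ballWeight lam r (x 0) (x 1) * ∫⁻ ξ, ‖ξ 0 - ξ 1‖ₑ ^ q ∂(ρ x)
    ∂(Measure.pi fun _ => lam)

lemma coe_nnnorm_rpow {V : Type*} [SeminormedAddCommGroup V] {q : ℝ} (hq : 0 ≤ q) (v : V) :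
    ((‖v‖₊ ^ q : ℝ≥0) : ℝ≥0∞) = ‖v‖ₑ ^ q := by
  rw [ENNReal.coe_rpow_of_nonneg _ hq]; rfl

/-- The measure on `[0,T') × X²` whose pairing is the time-integrated modulus of continuity. -/
noncomputable def modulusMeasure (τ : Measure ℝ) (lam : Measure X) (r : ℝ) :
    Measure (ℝ × (Fin 2 → X)) :=
  (baseMeasure τ lam 2).withDensity fun z => ballWeight lam r (z.2 0) (z.2 1)

variable {lam : Measure X} [SigmaFinite lam]

lemma measurable_ballWeight_apply (r : ℝ) {k : ℕ} (i j : Fin k) :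
    Measurable fun x : Fin k → X => ballWeight lam r (x i) (x j) :=
  (measurable_ballWeight lam r).comp (by fun_prop : Measurable fun x : Fin k → X => (x i, x j))

lemma lintegral_kModulus (τ : Measure ℝ) [SFinite τ] (q r : ℝ)
    (κ : Kernel (ℝ × (Fin 2 → X)) (Fin 2 → U)) [IsMarkovKernel κ] :
    ∫⁻ t, kModulus lam q r (fun x => κ (t, x)) ∂τ =
      ∫⁻ z, ∫⁻ ξ, ‖ξ 0 - ξ 1‖ₑ ^ q ∂(κ z) ∂(modulusMeasure τ lam r) := by
  have h1 : Measurable fun z : ℝ × (Fin 2 → X) => ballWeight lam r (z.2 0) (z.2 1) :=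
    (measurable_ballWeight_apply r 0 1).comp measurable_snd
  have h2 : Measurable fun z => ∫⁻ ξ : Fin 2 → U, ‖ξ 0 - ξ 1‖ₑ ^ q ∂(κ z) :=
    Measurable.lintegral_kernel (by fun_prop)
  rw [modulusMeasure, lintegral_withDensity_eq_lintegral_mul _ h1 h2, baseMeasure,
    lintegral_prod _ (h1.mul h2).aemeasurable]
  rfl

lemma measurable_kModulus {A : Type*} [MeasurableSpace A] (q r : ℝ)
    (κ : Kernel (A × (Fin 2 → X)) (Fin 2 → U)) [IsMarkovKernel κ] :
    Measurable fun t => kModulus lam q r (fun x => κ (t, x)) := by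
  have h1 : Measurable fun z : A × (Fin 2 → X) => ballWeight lam r (z.2 0) (z.2 1) :=
    (measurable_ballWeight_apply r 0 1).comp measurable_snd
  have h2 : Measurable fun z => ∫⁻ ξ : Fin 2 → U, ‖ξ 0 - ξ 1‖ₑ ^ q ∂(κ z) :=
    Measurable.lintegral_kernel (by fun_prop)
  exact (h1.mul h2).lintegral_prod_right

end Modulus

lemma kModulus_congr {X U : Type*} [PseudoMetricSpace X] [MeasurableSpace X]
    [NormedAddCommGroup U] [MeasurableSpace U] {lam : Measure X} {q r : ℝ}
    {ρ ρ' : (Fin 2 → X) → Measure (Fin 2 → U)}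
    (h : ρ =ᵐ[Measure.pi fun _ => lam] ρ') : kModulus lam q r ρ = kModulus lam q r ρ' := by
  refine lintegral_congr_ae ?_
  filter_upwards [h] with x hx
  rw [hx]

lemma kMoment_congr {X U : Type*} [MeasurableSpace X] [NormedAddCommGroup U] [MeasurableSpace U]
    {lam : Measure X} {q : ℝ} {ρ ρ' : (Fin 1 → X) → Measure (Fin 1 → U)}
    (h : ρ =ᵐ[Measure.pi fun _ => lam] ρ') : kMoment lam q ρ = kMoment lam q ρ' := by
  refine lintegral_congr_ae ?_
  filter_upwards [h] with x hx
  rw [hx]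

lemma measurePreserving_funUnique_fin_one {X : Type*} [MeasurableSpace X] (lam : Measure X) :
    MeasurePreserving (MeasurableEquiv.funUnique (Fin 1) X).symm lam
      (Measure.pi fun _ : Fin 1 => lam) := by
  convert (measurePreserving_funUnique lam (Fin 1)).symm

section Bridge

variable {d N : ℕ} {p : ℝ≥0∞} {D : Set (EuclideanSpace ℝ (Fin d))} {T : EReal}

/-- No measurability of `ρ` is needed, because passing between D and D¹ is a measurable equivalence.
-/
lemma cmMoment_eq_kMoment
    (ρ : (Fin 1 → EuclideanSpace ℝ (Fin d)) → Measure (Fin 1 → EuclideanSpace ℝ (Fin N))) :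
    cmMoment p D ρ = kMoment (volume.restrict D) p.toReal ρ := by
  have h : MeasurePreserving (MeasurableEquiv.funUnique (Fin 1) (EuclideanSpace ℝ (Fin d))).symm
      (volume.restrict D) (Measure.pi fun _ : Fin 1 => volume.restrict D) :=
    measurePreserving_funUnique_fin_one _
  rw [kMoment, ← h.lintegral_comp_emb (MeasurableEquiv.measurableEmbedding _)]
  refine lintegral_congr fun x => ?_
  have e : (MeasurableEquiv.funUnique (Fin 1) (EuclideanSpace ℝ (Fin d))).symm x = ![x] := by
    funext i
    fin_cases i
    rfl
  rw [e]

/-- The iterated integral becomes an integral over D² by Tonelli's theorem. This requires joint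
measurability, which `ρ` itself lacks and its kernel representative `η` supplies. -/
lemma cmModulus_eq_kModulus (r : ℝ)
    (η : Kernel (Fin 2 → EuclideanSpace ℝ (Fin d)) (Fin 2 → EuclideanSpace ℝ (Fin N)))
    [IsMarkovKernel η]
    {ρ : (Fin 2 → EuclideanSpace ℝ (Fin d)) → Measure (Fin 2 → EuclideanSpace ℝ (Fin N))}
    (h : ρ =ᵐ[Measure.pi fun _ => volume.restrict D] η) :
    cmModulus p D r ρ = kModulus (volume.restrict D) p.toReal r ρ := by
  set lam : Measure (EuclideanSpace ℝ (Fin d)) := volume.restrict D with hlam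
  rw [kModulus_congr h]
  have hmp := (measurePreserving_finTwoArrow lam).symm
  have e2 (x : EuclideanSpace ℝ (Fin d) × EuclideanSpace ℝ (Fin d)) :
      (MeasurableEquiv.finTwoArrow (α := EuclideanSpace ℝ (Fin d))).symm x = ![x.1, x.2] := by
    funext i
    fin_cases i <;> rfl
  have hm : Measurable fun x : Fin 2 → EuclideanSpace ℝ (Fin d) =>
      ballWeight lam r (x 0) (x 1) * ∫⁻ ξ, ‖ξ 0 - ξ 1‖ₑ ^ p.toReal ∂(η x) :=
    (measurable_ballWeight_apply r 0 1).mul (Measurable.lintegral_kernel (by fun_prop))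
  have hm' : Measurable fun x : EuclideanSpace ℝ (Fin d) × EuclideanSpace ℝ (Fin d) =>
      ballWeight lam r (MeasurableEquiv.finTwoArrow.symm x 0) (MeasurableEquiv.finTwoArrow.symm x 1) *
        ∫⁻ ξ, ‖ξ 0 - ξ 1‖ₑ ^ p.toReal ∂(η (MeasurableEquiv.finTwoArrow.symm x)) :=
    hm.comp (MeasurableEquiv.measurable _)
  rw [kModulus, ← hmp.lintegral_comp_emb (MeasurableEquiv.measurableEmbedding _),
    lintegral_prod _ hm'.aemeasurable]
  have hae := Measure.ae_ae_of_ae_prod (hmp.quasiMeasurePreserving.ae h)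
  rw [cmModulus]
  refine lintegral_congr_ae ?_
  filter_upwards [hae] with x hx
  rw [laverage_eq]
  have hres : (volume.restrict (D ∩ Metric.ball x r) : Measure (EuclideanSpace ℝ (Fin d))) =
      lam.restrict (Metric.ball x r) := by
    rw [hlam, Measure.restrict_restrict Metric.isOpen_ball.measurableSet, inter_comm]
  have hball : lam (Metric.ball x r) = lam.restrict (Metric.ball x r) univ := by simp
  rw [hres, ENNReal.div_eq_inv_mul, ← hball]
  have hm2 : Measurable fun y => ∫⁻ ξ, ‖ξ 0 - ξ 1‖ₑ ^ p.toReal ∂(η ![x, y]) := by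
    have h3 : Measurable fun x : Fin 2 → EuclideanSpace ℝ (Fin d) =>
      ∫⁻ ξ, ‖ξ 0 - ξ 1‖ₑ ^ p.toReal ∂(η x) := Measurable.lintegral_kernel (by fun_prop)
    refine h3.comp (measurable_pi_lambda _ fun i => ?_)
    fin_cases i
    · exact measurable_const
    · exact measurable_id
  have hcongr : ∫⁻ y in Metric.ball x r, ∫⁻ ξ, ‖ξ 0 - ξ 1‖ₑ ^ p.toReal ∂(ρ ![x, y]) ∂lam =
      ∫⁻ y in Metric.ball x r, ∫⁻ ξ, ‖ξ 0 - ξ 1‖ₑ ^ p.toReal ∂(η ![x, y]) ∂lam := by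
    refine lintegral_congr_ae (ae_restrict_of_ae ?_)
    filter_upwards [hx] with y hy
    rw [e2] at hy
    rw [hy]
  rw [hcongr, ← lintegral_const_mul _ hm2, ← lintegral_indicator Metric.isOpen_ball.measurableSet]
  refine lintegral_congr fun y => ?_
  simp only [e2, ballWeight]
  by_cases hy : y ∈ Metric.ball x r
  · simp [hy]
  · simp [hy]

lemma measurableSet_cmTime (T : EReal) : MeasurableSet (cmTime T) := by
  have h : Measurable fun t : ℝ => (t : EReal) := measurable_coe_real_ereal
  exact (measurableSet_le measurable_const measurable_id).inter
    (measurableSet_lt h measurable_const)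

lemma restrict_Ico_cmTimeMeasure {T' : ℝ} (hT' : (T' : EReal) < T) :
    (cmTimeMeasure T).restrict (Ico 0 T') = volume.restrict (Ico 0 T') := by
  rw [cmTimeMeasure, Measure.restrict_restrict measurableSet_Ico, inter_eq_left.2]
  exact fun t ht => ⟨ht.1, (EReal.coe_lt_coe_iff.2 ht.2).trans hT'⟩

lemma cmSpaceTimeMeasure_eq_restrict (k : ℕ) :
    cmSpaceTimeMeasure D T k = volume.restrict (cmTime T ×ˢ cmPower D k) := by
  rw [cmSpaceTimeMeasure, cmTimeMeasure, cmSpaceMeasure, Measure.prod_restrict]; rfl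

lemma ae_mem_cmTime : ∀ᵐ t ∂(cmTimeMeasure T), t ∈ cmTime T :=
  ae_restrict_mem (measurableSet_cmTime T)

lemma ae_mem_cmPower (hD : MeasurableSet D) (k : ℕ) :
    ∀ᵐ x ∂(cmSpaceMeasure D k), x ∈ cmPower D k :=
  ae_restrict_mem (MeasurableSet.univ_pi fun _ => hD)

lemma ae_mem_prod (hD : MeasurableSet D) (k : ℕ) :
    ∀ᵐ z ∂(cmSpaceTimeMeasure D T k), z.1 ∈ cmTime T ∧ z.2 ∈ cmPower D k := by
  rw [cmSpaceTimeMeasure_eq_restrict]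
  exact ae_restrict_mem ((measurableSet_cmTime T).prod (MeasurableSet.univ_pi fun _ => hD))

end Bridge

/-! ### Symmetry and consistency of stable limits -/

namespace IsConsistentFamily

/-- Consistency is preserved under stable convergence. -/
lemma of_stableTendsto {X : Type*} [MetricSpace X] [SecondCountableTopology X] [MeasurableSpace X]
    [BorelSpace X] {U : Type*} [NormedAddCommGroup U] [ProperSpace U]
    [MeasurableSpace U] [BorelSpace U] {τ : Measure ℝ} [SigmaFinite τ] {lam : Measure X}
    [SigmaFinite lam] {κ : ℕ → ∀ k : ℕ, Kernel (ℝ × (Fin k → X)) (Fin k → U)}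
    {κ' : ∀ k : ℕ, Kernel (ℝ × (Fin k → X)) (Fin k → U)}
    [∀ n k, IsMarkovKernel (κ n k)] [∀ k, IsMarkovKernel (κ' k)]
    (h : ∀ n, IsConsistentFamily τ lam (κ n))
    (hlim : ∀ k, StableTendsto (baseMeasure τ lam k) (fun n => κ n k) (κ' k)) :
    IsConsistentFamily τ lam κ' := by
  have : SecondCountableTopology U := secondCountable_of_proper
  have key {j k : ℕ} (ι : Fin j → Fin k) (hι : Function.Injective ι) :
      ∀ᵐ z ∂(baseMeasure τ lam k), κ' j (z.1, z.2 ∘ ι) = (κ' k z).map (fun ξ => ξ ∘ ι) := by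
    have hm := measurable_comp_index (U := U) ι
    have hπ := quasiMeasurePreserving_base (τ := τ) (lam := lam) hι
    have hcont : Continuous fun ξ : Fin k → U => ξ ∘ ι :=
      continuous_pi fun i => continuous_apply (ι i)
    -- Both sides of the identity are stable limits of sequences that agree a.e. for every n, so
    -- they coincide by uniqueness of the limit.
    have h1 := (hlim j).comap hπ
    have h2 := (hlim k).map hcont
    have hM (n : ℕ) := Kernel.IsMarkovKernel.map (κ n k) hm
    have hM' := Kernel.IsMarkovKernel.map (κ' k) hm
    have h3 := h2.congr_left (η := fun n => (κ n j).comap _ hπ.measurable) (fun n => by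
      filter_upwards [(h n).marginal hι] with z hz
      rw [Kernel.comap_apply, Kernel.map_apply _ hm]
      exact hz.symm)
    filter_upwards [h1.unique h3] with z hz
    rw [Kernel.comap_apply, Kernel.map_apply _ hm] at hz
    exact hz
  exact ⟨fun k σ => key σ σ.injective, fun k => key _ (Fin.castSucc_injective k)⟩

end IsConsistentFamily

/-! ### Comparison of the moduli of continuity at different scales -/

section Weights

variable {X : Type*} [PseudoMetricSpace X] [MeasurableSpace X] [OpensMeasurableSpace X]

/-- Only an inequality holds in general, since a ball of measure 0 or ∞ gives zero. -/
lemma lintegral_ballWeight_right_le (lam : Measure X) (r : ℝ) (x : X) :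
    ∫⁻ y, ballWeight lam r x y ∂lam ≤ 1 := by
  simp only [ballWeight]
  rw [lintegral_indicator Metric.isOpen_ball.measurableSet, setLIntegral_const]
  exact ENNReal.inv_mul_le_one _

lemma lintegral_ballWeight_right_eq (lam : Measure X) {r : ℝ} {x : X}
    (h0 : lam (Metric.ball x r) ≠ 0) (h1 : lam (Metric.ball x r) ≠ ∞) :
    ∫⁻ y, ballWeight lam r x y ∂lam = 1 := by
  simp only [ballWeight]
  rw [lintegral_indicator Metric.isOpen_ball.measurableSet, setLIntegral_const]
  exact ENNReal.inv_mul_cancel h0 h1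

/-- The averaging operators over balls are bounded on `L¹`, uniformly in the radius. -/
lemma exists_lintegral_ballWeight_left_le (E : Type*) [NormedAddCommGroup E] [NormedSpace ℝ E]
    [ProperSpace E] [MeasurableSpace E] [BorelSpace E] :
    ∃ n : ℕ, ∀ (lam : Measure E) (r : ℝ) (y : E), ∫⁻ x, ballWeight lam r x y ∂lam ≤ n := by
  obtain ⟨t, -, htfin, ht⟩ := Metric.finite_approx_of_totallyBounded
    (isCompact_closedBall (0 : E) 1).totallyBounded (1 / 2) (by norm_num)
  refine ⟨htfin.toFinset.card, fun lam r y => ?_⟩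
  rcases le_or_gt r 0 with hr | hr
  · simp [ballWeight, Metric.ball_eq_empty.2 hr]
  -- The half-balls have their centres at a rescaled finite net of the unit ball. If x lies in `B
  -- c`, then `B c` is contained in the ball of radius r around x, so the weight is at most the
  -- inverse measure of `B c`, and each half-ball contributes at most one. No doubling property of
  -- `lam` is involved.
  let B : E → Set E := fun c => Metric.ball (y + r • c) (r / 2)
  have hle (x : E) : ballWeight lam r x y ≤
      ∑ c ∈ htfin.toFinset, (B c).indicator (fun _ => (lam (B c))⁻¹) x := by
    by_cases hx : y ∈ Metric.ball x r
    · have h1 : r⁻¹ • (x - y) ∈ Metric.closedBall (0 : E) 1 := by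
        rw [Metric.mem_ball, dist_comm, dist_eq_norm] at hx
        rw [mem_closedBall_zero_iff, norm_smul, Real.norm_of_nonneg (by positivity),
          inv_mul_le_iff₀ hr]
        linarith
      obtain ⟨c, hc, hxc⟩ := mem_iUnion₂.1 (ht h1)
      have hxB : x ∈ B c := by
        rw [Metric.mem_ball, dist_eq_norm] at hxc ⊢
        have : x - (y + r • c) = r • (r⁻¹ • (x - y) - c) := by
          rw [smul_sub, smul_inv_smul₀ hr.ne']; abel
        rw [this, norm_smul, Real.norm_of_nonneg hr.le]
        nlinarith
      have hsub : B c ⊆ Metric.ball x r := by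
        intro w hw
        rw [Metric.mem_ball] at hw hxB ⊢
        calc dist w x ≤ dist w (y + r • c) + dist x (y + r • c) := dist_triangle_right _ _ _
          _ < r := by linarith
      refine le_trans ?_ (Finset.single_le_sum (f := fun c => (B c).indicator
        (fun _ => (lam (B c))⁻¹) x) (fun _ _ => zero_le) (htfin.mem_toFinset.2 hc))
      simp only [ballWeight, hx, indicator_of_mem, hxB]
      exact ENNReal.inv_le_inv.2 (measure_mono hsub)
    · simp [ballWeight, hx]
  calc ∫⁻ x, ballWeight lam r x y ∂lam
      ≤ ∫⁻ x, ∑ c ∈ htfin.toFinset, (B c).indicator (fun _ => (lam (B c))⁻¹) x ∂lam :=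
        lintegral_mono hle
    _ = ∑ c ∈ htfin.toFinset, (lam (B c))⁻¹ * lam (B c) := by
        rw [lintegral_finsetSum _ fun c _ =>
          measurable_const.indicator Metric.isOpen_ball.measurableSet]
        refine Finset.sum_congr rfl fun c _ => ?_
        rw [lintegral_indicator Metric.isOpen_ball.measurableSet, setLIntegral_const]
    _ ≤ ∑ c ∈ htfin.toFinset, 1 := Finset.sum_le_sum fun c _ => ENNReal.inv_mul_le_one _
    _ = _ := by simp

lemma measurableSet_ball_subset (D : Set X) (s : ℝ) :
    MeasurableSet {x : X | Metric.ball x s ⊆ D} := by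
  have h : {x : X | Metric.ball x s ⊆ D}ᶜ = ⋃ w ∈ Dᶜ, Metric.ball w s := by
    ext x
    simp only [mem_compl_iff, mem_ofPred_eq, mem_iUnion, not_subset, Metric.mem_ball]
    constructor
    · rintro ⟨w, hw, hwD⟩
      exact ⟨w, hwD, by rwa [dist_comm]⟩
    · rintro ⟨w, hwD, hw⟩
      exact ⟨w, by rwa [dist_comm], hwD⟩
  rw [← MeasurableSet.compl_iff, h]
  exact (isOpen_biUnion fun _ _ => Metric.isOpen_ball).measurableSet

end Weights

section Scales

variable {E : Type*} [NormedAddCommGroup E] [NormedSpace ℝ E] [FiniteDimensional ℝ E]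
  [MeasurableSpace E] [BorelSpace E] {vol : Measure E} [vol.IsAddHaarMeasure]
  {D : Set E} {a : E → ℝ≥0∞} {δ : E → E → ℝ≥0∞} {c : ℝ≥0}

/-- The part of the modulus near the boundary is controlled by the moments near the boundary. -/
lemma setLIntegral_modulus_boundary_le {n : ℕ}
    (hn : ∀ (lam : Measure E) (r : ℝ) (y : E), ∫⁻ x, ballWeight lam r x y ∂lam ≤ n)
    (ha : Measurable a)
    (hbd : ∀ᵐ x ∂vol.restrict D, ∀ᵐ y ∂vol.restrict D, δ x y ≤ c * (a x + a y))
    {r s : ℝ} (hrs : r ≤ s) :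
    ∫⁻ x in {x | Metric.ball x (2 * s) ⊆ D}ᶜ, ∫⁻ y, ballWeight (vol.restrict D) r x y * δ x y
        ∂(vol.restrict D) ∂(vol.restrict D) ≤
      c * ((1 + n) * ∫⁻ x in {x | Metric.ball x (3 * s) ⊆ D}ᶜ, a x ∂(vol.restrict D)) := by
  set lam := vol.restrict D with hlam
  set K := {x | Metric.ball x (2 * s) ⊆ D} with hK
  set K' := {x | Metric.ball x (3 * s) ⊆ D} with hK'
  have hKm : MeasurableSet K := measurableSet_ball_subset _ _
  have hKm' : MeasurableSet K' := measurableSet_ball_subset _ _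
  have hw := measurable_ballWeight lam r
  -- The layer for y has width `3 * s` instead of `2 * s` because y may be further inside than x by
  -- less than r ≤ s.
  have hsub {x y : E} (hx : x ∉ K) (hy : y ∈ Metric.ball x r) : y ∉ K' := by
    intro hy'
    apply hx
    refine Subset.trans (fun w hw => ?_) (show Metric.ball y (3 * s) ⊆ D from hy')
    rw [Metric.mem_ball] at hw hy ⊢
    calc dist w y ≤ dist w x + dist y x := dist_triangle_right _ _ _
      _ < 3 * s := by linarith
  have hKK : Kᶜ ⊆ K'ᶜ := by
    refine compl_subset_compl.2 fun x hx => ?_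
    rcases le_or_gt 0 s with h | h
    · exact (Metric.ball_subset_ball (by linarith)).trans (show Metric.ball x (3 * s) ⊆ D from hx)
    · simp [hK, Metric.ball_eq_empty.2 (show 2 * s ≤ 0 by linarith)]
  calc ∫⁻ x in Kᶜ, ∫⁻ y, ballWeight lam r x y * δ x y ∂lam ∂lam
      ≤ ∫⁻ x in Kᶜ, ∫⁻ y, c * (ballWeight lam r x y * a x +
          ballWeight lam r x y * K'ᶜ.indicator a y) ∂lam ∂lam := by
        refine lintegral_mono_ae ?_
        rw [ae_restrict_iff' hKm.compl]
        filter_upwards [hbd] with x hx hxK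
        refine lintegral_mono_ae ?_
        filter_upwards [hx] with y hy
        by_cases hyb : y ∈ Metric.ball x r
        · have h1 : y ∈ K'ᶜ := hsub hxK hyb
          rw [indicator_of_mem h1, ← mul_add, mul_left_comm]
          gcongr
        · simp [ballWeight, hyb]
    _ ≤ ∫⁻ x in Kᶜ, c * (a x + ∫⁻ y, ballWeight lam r x y * K'ᶜ.indicator a y ∂lam) ∂lam := by
        refine lintegral_mono fun x => ?_
        have h2 : Measurable fun y => ballWeight lam r x y := hw.comp measurable_prodMk_left
        have h3 : Measurable fun y => ballWeight lam r x y * K'ᶜ.indicator a y :=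
          h2.mul (ha.indicator hKm'.compl)
        rw [lintegral_const_mul' _ _ ENNReal.coe_ne_top, lintegral_add_right _ h3,
          lintegral_mul_const _ h2]
        gcongr
        exact mul_le_of_le_one_left' (lintegral_ballWeight_right_le _ _ _)
    _ = c * (∫⁻ x in Kᶜ, a x ∂lam +
          ∫⁻ x in Kᶜ, ∫⁻ y, ballWeight lam r x y * K'ᶜ.indicator a y ∂lam ∂lam) := by
        have h4 : Measurable fun x => ∫⁻ y, ballWeight lam r x y * K'ᶜ.indicator a y ∂lam :=
          (hw.mul ((ha.indicator hKm'.compl).comp measurable_snd)).lintegral_prod_right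
        rw [lintegral_const_mul' _ _ ENNReal.coe_ne_top, lintegral_add_left ha]
    _ ≤ c * (∫⁻ x in K'ᶜ, a x ∂lam + n * ∫⁻ x in K'ᶜ, a x ∂lam) := by
        gcongr
        -- After exchanging the integrals the weight is integrated over its centre, where the bound
        -- is the covering constant `n` rather than one.
        calc ∫⁻ x in Kᶜ, ∫⁻ y, ballWeight lam r x y * K'ᶜ.indicator a y ∂lam ∂lam
            ≤ ∫⁻ x, ∫⁻ y, ballWeight lam r x y * K'ᶜ.indicator a y ∂lam ∂lam :=
              setLIntegral_le_lintegral _ _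
          _ = ∫⁻ y, ∫⁻ x, ballWeight lam r x y * K'ᶜ.indicator a y ∂lam ∂lam :=
              lintegral_lintegral_swap
                (hw.mul ((ha.indicator hKm'.compl).comp measurable_snd)).aemeasurable
          _ ≤ ∫⁻ y, n * K'ᶜ.indicator a y ∂lam := by
              refine lintegral_mono fun y => ?_
              have h2 : Measurable fun x => ballWeight lam r x y := hw.comp measurable_prodMk_right
              rw [lintegral_mul_const _ h2]
              gcongr
              exact hn _ _ _
          _ = n * ∫⁻ x in K'ᶜ, a x ∂lam := by
              rw [lintegral_const_mul _ (ha.indicator hKm'.compl),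
                lintegral_indicator hKm'.compl]
    _ = c * ((1 + n) * ∫⁻ x in K'ᶜ, a x ∂lam) := by rw [add_mul, one_mul]

/-- The part of the modulus in the interior is controlled by the modulus at any larger scale. -/
lemma setLIntegral_modulus_interior_le (hδ : Measurable (Function.uncurry δ))
    (htri : ∀ᵐ x ∂vol.restrict D, ∀ᵐ y ∂vol.restrict D, ∀ᵐ z ∂vol.restrict D,
      δ x y ≤ c * (δ x z + δ y z))
    {r s S : ℝ} (hr : 0 < r) (hrS : r ≤ S / 2) (hSs : S ≤ s) :
    ∫⁻ x in {x | Metric.ball x (2 * s) ⊆ D}, ∫⁻ y, ballWeight (vol.restrict D) r x y * δ x y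
        ∂(vol.restrict D) ∂(vol.restrict D) ≤
      c * (2 * (2 ^ Module.finrank ℝ E *
        ∫⁻ x, ∫⁻ y, ballWeight (vol.restrict D) S x y * δ x y ∂(vol.restrict D)
          ∂(vol.restrict D))) := by
  set lam := vol.restrict D with hlam
  set K := {x | Metric.ball x (2 * s) ⊆ D} with hK
  set C₂ : ℝ≥0∞ := 2 ^ Module.finrank ℝ E with hC₂
  have hC₂fin : C₂ ≠ ∞ := ENNReal.pow_ne_top (by simp)
  have hKm : MeasurableSet K := measurableSet_ball_subset _ _
  have hS : 0 < S := by linarith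
  have : ProperSpace E := FiniteDimensional.proper ℝ E
  let V : ℝ → ℝ≥0∞ := fun ρ => vol (Metric.ball (0 : E) ρ)
  have hV0 {ρ : ℝ} (hρ : 0 < ρ) : V ρ ≠ 0 := (Metric.measure_ball_pos vol _ hρ).ne'
  have hVtop (ρ : ℝ) : V ρ ≠ ∞ := measure_ball_lt_top.ne
  have hVS : (V (S / 2))⁻¹ = C₂ * (V S)⁻¹ := by
    have h1 : V S = C₂ * V (S / 2) := by
      have := Measure.addHaar_ball_mul_of_pos vol (0 : E) (r := 2) two_pos (S / 2)
      rw [mul_div_cancel₀ _ two_ne_zero] at this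
      rw [show V S = _ from this, ENNReal.ofReal_pow two_pos.le]
      simp [hC₂, V]
    rw [h1, ENNReal.mul_inv (Or.inr (hVtop _)) (Or.inl hC₂fin), ← mul_assoc,
      ENNReal.mul_inv_cancel (by simp [hC₂]) hC₂fin, one_mul]
  have hballV (x : E) (ρ : ℝ) : vol (Metric.ball x ρ) = V ρ :=
    Measure.addHaar_ball_center vol x ρ
  have hle (x : E) (ρ : ℝ) : lam (Metric.ball x ρ) ≤ V ρ := by
    rw [← hballV x]; exact Measure.restrict_apply_le _ _
  have heq {x : E} (hx : x ∈ K) {ρ : ℝ} (hρ : ρ ≤ 2 * s) : lam (Metric.ball x ρ) = V ρ := by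
    rw [hlam, Measure.restrict_apply Metric.isOpen_ball.measurableSet, inter_eq_left.2, hballV]
    exact (Metric.ball_subset_ball hρ).trans hx
  have hw (ρ : ℝ) := measurable_ballWeight lam ρ
  let G : E → ℝ≥0∞ := fun y => ∫⁻ z, ballWeight lam S y z * δ y z ∂lam
  have hG : Measurable G := ((hw S).mul hδ).lintegral_prod_right
  have hwr (x : E) : Measurable fun y => ballWeight lam r x y := (hw r).comp measurable_prodMk_left
  have hwh (x : E) : Measurable fun y => ballWeight lam (S / 2) x y :=
    (hw _).comp measurable_prodMk_left
  have hδ1 (x : E) : Measurable fun y => δ x y := hδ.comp measurable_prodMk_left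
  -- This is the weight with its normalisation frozen at the volume of the full ball. For x in `K`
  -- it agrees with the weight of the ball around x, and as a function of x it has mass at most one
  -- for every y.
  let u : E → E → ℝ≥0∞ := fun x y => (Metric.ball y r).indicator (fun _ => (V r)⁻¹) x
  have hu : Measurable fun p : E × E => u p.1 p.2 := by
    have h : MeasurableSet {p : E × E | dist p.1 p.2 < r} :=
      measurableSet_lt (by fun_prop) measurable_const
    exact (measurable_const : Measurable fun _ : E × E => (V r)⁻¹).indicator h
  -- comparison of weights
  have hcmp1 {x : E} (hx : x ∈ K) (z : E) :
      ballWeight lam (S / 2) x z ≤ C₂ * ballWeight lam S x z := by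
    by_cases hz : z ∈ Metric.ball x (S / 2)
    · have hz' : z ∈ Metric.ball x S := Metric.ball_subset_ball (by linarith) hz
      simp only [ballWeight, hz, hz', indicator_of_mem]
      rw [heq hx (by linarith), hVS, heq hx (by linarith)]
    · simp [ballWeight, hz]
  have hcmp2 {x : E} (hx : x ∈ K) (y z : E) :
      ballWeight lam r x y * ballWeight lam (S / 2) x z ≤ u x y * (C₂ * ballWeight lam S y z) := by
    by_cases hy : y ∈ Metric.ball x r
    · by_cases hz : z ∈ Metric.ball x (S / 2)
      · have hx' : x ∈ Metric.ball y r := by rwa [Metric.mem_ball, dist_comm]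
        have hz' : z ∈ Metric.ball y S := by
          rw [Metric.mem_ball] at hy hz ⊢
          calc dist z y ≤ dist z x + dist y x := dist_triangle_right _ _ _
            _ < S := by linarith
        simp only [ballWeight, hz, hz', hy, hx', indicator_of_mem, u]
        rw [heq hx (by linarith), heq hx (by linarith), hVS]
        gcongr
        exact hle _ _
      · simp [ballWeight, hz]
    · simp [ballWeight, hy]
  have hpt {x : E} (hx : x ∈ K) (htx : ∀ᵐ y ∂lam, ∀ᵐ z ∂lam, δ x y ≤ c * (δ x z + δ y z)) :
      ∫⁻ y, ballWeight lam r x y * δ x y ∂lam ≤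
        c * (C₂ * G x + ∫⁻ y, u x y * (C₂ * G y) ∂lam) := by
    have hone : ∫⁻ z, ballWeight lam (S / 2) x z ∂lam = 1 := by
      refine lintegral_ballWeight_right_eq _ ?_ ?_
      · rw [heq hx (by linarith)]; exact hV0 (by linarith)
      · rw [heq hx (by linarith)]; exact hVtop _
    calc ∫⁻ y, ballWeight lam r x y * δ x y ∂lam
        ≤ ∫⁻ y, c * (ballWeight lam r x y * (C₂ * G x) + u x y * (C₂ * G y)) ∂lam := by
          refine lintegral_mono_ae ?_
          filter_upwards [htx] with y hy
          -- An auxiliary point z, averaged over the ball of radius S/2 around x, is inserted in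
          -- order to use the triangle inequality. As y is within r ≤ S/2 of x, z is within S of
          -- both points, and halving the radius costs only the factor `C₂`.
          calc ballWeight lam r x y * δ x y
              = ∫⁻ z, ballWeight lam r x y * δ x y * ballWeight lam (S / 2) x z ∂lam := by
                rw [lintegral_const_mul _ (hwh x), hone, mul_one]
            _ ≤ ∫⁻ z, c * (ballWeight lam r x y * (C₂ * (ballWeight lam S x z * δ x z)) +
                  u x y * (C₂ * (ballWeight lam S y z * δ y z))) ∂lam := by
                refine lintegral_mono_ae ?_
                filter_upwards [hy] with z hz
                calc ballWeight lam r x y * δ x y * ballWeight lam (S / 2) x z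
                    ≤ ballWeight lam r x y * (c * (δ x z + δ y z)) *
                        ballWeight lam (S / 2) x z := by gcongr
                  _ = c * (ballWeight lam r x y * (ballWeight lam (S / 2) x z * δ x z) +
                      (ballWeight lam r x y * ballWeight lam (S / 2) x z) * δ y z) := by ring
                  _ ≤ c * (ballWeight lam r x y * ((C₂ * ballWeight lam S x z) * δ x z) +
                      (u x y * (C₂ * ballWeight lam S y z)) * δ y z) := by
                      refine mul_le_mul_right (add_le_add (mul_le_mul_right
                        (mul_le_mul_left (hcmp1 hx z) _) _)
                        (mul_le_mul_left (hcmp2 hx y z) _)) _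
                  _ = _ := by ring
            _ = c * (ballWeight lam r x y * (C₂ * G x) + u x y * (C₂ * G y)) := by
                have m1 (y : E) : Measurable fun z => ballWeight lam S y z * δ y z :=
                  ((hw S).comp measurable_prodMk_left).mul (hδ1 y)
                rw [lintegral_const_mul' _ _ ENNReal.coe_ne_top,
                  lintegral_add_left (((m1 x).const_mul C₂).const_mul _),
                  lintegral_const_mul _ ((m1 x).const_mul C₂), lintegral_const_mul _ (m1 x),
                  lintegral_const_mul _ ((m1 y).const_mul C₂), lintegral_const_mul _ (m1 y)]
      _ = c * ((∫⁻ y, ballWeight lam r x y ∂lam) * (C₂ * G x) +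
            ∫⁻ y, u x y * (C₂ * G y) ∂lam) := by
          rw [lintegral_const_mul' _ _ ENNReal.coe_ne_top,
            lintegral_add_left ((hwr x).mul_const _), lintegral_mul_const _ (hwr x)]
      _ ≤ _ :=
          mul_le_mul_right (add_le_add
            (mul_le_of_le_one_left' (lintegral_ballWeight_right_le _ _ _)) le_rfl) _
  have huG : Measurable fun p : E × E => u p.1 p.2 * (C₂ * G p.2) :=
    hu.mul ((hG.comp measurable_snd).const_mul _)
  calc ∫⁻ x in K, ∫⁻ y, ballWeight lam r x y * δ x y ∂lam ∂lam
      ≤ ∫⁻ x in K, c * (C₂ * G x + ∫⁻ y, u x y * (C₂ * G y) ∂lam) ∂lam := by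
        refine lintegral_mono_ae ?_
        rw [ae_restrict_iff' hKm]
        filter_upwards [htri] with x hx hxK using hpt hxK hx
    _ ≤ ∫⁻ x, c * (C₂ * G x + ∫⁻ y, u x y * (C₂ * G y) ∂lam) ∂lam :=
        setLIntegral_le_lintegral _ _
    _ = c * (C₂ * ∫⁻ x, G x ∂lam + ∫⁻ x, ∫⁻ y, u x y * (C₂ * G y) ∂lam ∂lam) := by
        rw [lintegral_const_mul' _ _ ENNReal.coe_ne_top, lintegral_add_left (hG.const_mul _),
          lintegral_const_mul _ hG]
    _ ≤ c * (C₂ * ∫⁻ x, G x ∂lam + C₂ * ∫⁻ x, G x ∂lam) := by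
        gcongr
        rw [lintegral_lintegral_swap huG.aemeasurable, ← lintegral_const_mul _ hG]
        refine lintegral_mono fun y => ?_
        have m2 : Measurable fun x => u x y := hu.comp measurable_prodMk_right
        rw [lintegral_mul_const _ m2]
        refine mul_le_of_le_one_left' ?_
        simp only [u]
        rw [lintegral_indicator Metric.isOpen_ball.measurableSet, setLIntegral_const]
        exact (mul_le_mul_right (hle _ _) _).trans (ENNReal.inv_mul_le_one _)
    _ = _ := by rw [← two_mul]

/-- If the modulus of continuity is small at arbitrarily small scales, then it tends to zero. -/
lemma tendsto_modulus_of_frequently [SFinite vol] (hD : IsOpen D) (ha : Measurable a)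
    (hafin : ∫⁻ x, a x ∂(vol.restrict D) ≠ ∞) (hδ : Measurable (Function.uncurry δ))
    (hbd : ∀ᵐ x ∂vol.restrict D, ∀ᵐ y ∂vol.restrict D, δ x y ≤ c * (a x + a y))
    (htri : ∀ᵐ x ∂vol.restrict D, ∀ᵐ y ∂vol.restrict D, ∀ᵐ z ∂vol.restrict D,
      δ x y ≤ c * (δ x z + δ y z))
    (hfreq : ∀ ε : ℝ≥0∞, 0 < ε → ∃ᶠ S in 𝓝[>] (0 : ℝ),
      ∫⁻ x, ∫⁻ y, ballWeight (vol.restrict D) S x y * δ x y ∂(vol.restrict D)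
        ∂(vol.restrict D) ≤ ε) :
    Tendsto (fun r => ∫⁻ x, ∫⁻ y, ballWeight (vol.restrict D) r x y * δ x y ∂(vol.restrict D)
      ∂(vol.restrict D)) (𝓝[>] 0) (𝓝 0) := by
  have : ProperSpace E := FiniteDimensional.proper ℝ E
  obtain ⟨n, hn⟩ := exists_lintegral_ballWeight_left_le E
  set lam := vol.restrict D with hlam
  -- the boundary layer
  have hlim : Tendsto (fun j : ℕ => c * ((1 + n) *
      ∫⁻ x in {x | Metric.ball x (3 * (1 / ((j : ℝ) + 1))) ⊆ D}ᶜ, a x ∂lam)) atTop (𝓝 0) := by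
    have h1 : Tendsto (fun j : ℕ => ∫⁻ x, {x | Metric.ball x (3 * (1 / ((j : ℝ) + 1))) ⊆ D}ᶜ.indicator
        a x ∂lam) atTop (𝓝 (∫⁻ _, 0 ∂lam)) := by
      refine tendsto_lintegral_of_dominated_convergence a
        (fun j => ha.indicator (measurableSet_ball_subset _ _).compl)
        (fun j => ae_of_all _ fun x => indicator_le_self _ _ _) hafin ?_
      filter_upwards [ae_restrict_mem hD.measurableSet] with x hx
      obtain ⟨ε, hε, hball⟩ := Metric.isOpen_iff.1 hD x hx
      refine tendsto_const_nhds.congr' ?_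
      have h2 : Tendsto (fun j : ℕ => 3 * (1 / ((j : ℝ) + 1))) atTop (𝓝 (3 * 0)) :=
        tendsto_one_div_add_atTop_nhds_zero_nat.const_mul 3
      rw [mul_zero] at h2
      filter_upwards [h2.eventually (gt_mem_nhds hε)] with j hj
      have h3 : x ∈ {x | Metric.ball x (3 * (1 / ((j : ℝ) + 1))) ⊆ D} :=
        (Metric.ball_subset_ball hj.le).trans hball
      have h5 : x ∉ {x | Metric.ball x (3 * (1 / ((j : ℝ) + 1))) ⊆ D}ᶜ := fun h => h h3
      exact (indicator_of_notMem h5 _).symm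
    simp_rw [lintegral_indicator (measurableSet_ball_subset D _).compl] at h1
    rw [lintegral_zero] at h1
    have h4 := ENNReal.Tendsto.const_mul (a := (c : ℝ≥0∞) * (1 + n)) h1
      (Or.inr (ENNReal.mul_ne_top (by simp) (by simp)))
    rw [mul_zero] at h4
    exact h4.congr fun j => by rw [mul_assoc]
  set C₂ : ℝ≥0∞ := 2 ^ Module.finrank ℝ E with hC₂
  have hC₂fin : C₂ ≠ ∞ := ENNReal.pow_ne_top (by simp)
  rw [ENNReal.tendsto_nhds_zero]
  intro ε hε
  have hε2 : 0 < ε / 2 := ENNReal.half_pos hε.ne'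
  -- The boundary layer `s` is fixed first. Only then is a good scale S ≤ s selected, after which
  -- every r ≤ S/2 is admissible.
  obtain ⟨j, hj⟩ := (hlim.eventually (ge_mem_nhds hε2)).exists
  set s : ℝ := 1 / ((j : ℝ) + 1) with hs
  have hs0 : 0 < s := by positivity
  have hKm : MeasurableSet {x | Metric.ball x (2 * s) ⊆ D} := measurableSet_ball_subset _ _
  have hB : (c : ℝ≥0∞) * (2 * C₂) ≠ ∞ :=
    ENNReal.mul_ne_top (by simp) (ENNReal.mul_ne_top (by simp) hC₂fin)
  obtain ⟨η, hη0, hη⟩ : ∃ η : ℝ≥0∞, 0 < η ∧ (c : ℝ≥0∞) * (2 * C₂) * η ≤ ε / 2 := by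
    refine ⟨ε / 2 / ((c : ℝ≥0∞) * (2 * C₂)), ENNReal.div_pos hε2.ne' hB, ENNReal.mul_div_le⟩
  obtain ⟨S, hSη, hS0, hSs⟩ := ((hfreq η hη0).and_eventually
    (Ioc_mem_nhdsGT hs0)).exists
  filter_upwards [Ioc_mem_nhdsGT (show 0 < S / 2 by positivity)] with r hr
  rw [← lintegral_add_compl _ hKm, ← ENNReal.add_halves ε]
  refine add_le_add ?_ ?_
  · refine (setLIntegral_modulus_interior_le hδ htri hr.1 hr.2 hSs).trans ?_
    refine le_trans ?_ hη
    rw [mul_assoc, mul_assoc]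
    gcongr
  · exact (setLIntegral_modulus_boundary_le hn ha hbd (by linarith [hr.2])).trans hj

end Scales

/-! ### Integration over finite powers -/

section Powers

variable {X : Type*} [MeasurableSpace X]

lemma piFinSuccAbove_zero_symm (n : ℕ) :
    ⇑(MeasurableEquiv.piFinSuccAbove (fun _ : Fin (n + 1) => X) 0).symm =
      fun p : X × (Fin n → X) => (Matrix.vecCons p.1 p.2 : Fin (n + 1) → X) := by
  ext p i
  change Fin.insertNth (α := fun _ => X) 0 p.1 p.2 i = _
  rw [Fin.insertNth_zero']
  rfl

lemma measurePreserving_vecCons (lam : Measure X) [SigmaFinite lam] (n : ℕ) :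
    MeasurePreserving (fun p : X × (Fin n → X) => (Matrix.vecCons p.1 p.2 : Fin (n + 1) → X))
      (lam.prod (Measure.pi fun _ => lam)) (Measure.pi fun _ => lam) := by
  have h := (measurePreserving_piFinSuccAbove (fun _ : Fin (n + 1) => lam) 0).symm
  rwa [piFinSuccAbove_zero_symm] at h

lemma measurableEmbedding_vecCons (n : ℕ) : MeasurableEmbedding
    (fun p : X × (Fin n → X) => (Matrix.vecCons p.1 p.2 : Fin (n + 1) → X)) :=
  piFinSuccAbove_zero_symm (X := X) n ▸ (MeasurableEquiv.piFinSuccAbove (fun _ : Fin (n + 1) => X) 0).symm.measurableEmbedding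

lemma ae_pi_fin_zero {lam : Measure X} {P : (Fin 0 → X) → Prop}
    (h : ∀ᵐ w ∂(Measure.pi fun _ : Fin 0 => lam), P w) : P ![] := by
  rw [Measure.pi_of_empty _ ![]] at h
  obtain ⟨w, hw⟩ := h.exists
  rwa [Subsingleton.elim ![] w]

lemma lintegral_pi_fin_zero {lam : Measure X} (f : (Fin 0 → X) → ℝ≥0∞) :
    ∫⁻ w, f w ∂(Measure.pi fun _ => lam) = f ![] := by
  rw [Measure.pi_of_empty _ ![], lintegral_dirac]

variable {lam : Measure X} [SigmaFinite lam]

lemma ae_ae_vecCons {n : ℕ} {P : (Fin (n + 1) → X) → Prop}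
    (h : ∀ᵐ w ∂(Measure.pi fun _ => lam), P w) :
    ∀ᵐ x ∂lam, ∀ᵐ w ∂(Measure.pi fun _ : Fin n => lam), P (Matrix.vecCons x w) :=
  Measure.ae_ae_of_ae_prod ((measurePreserving_vecCons lam n).quasiMeasurePreserving.ae h)

lemma lintegral_vecCons {n : ℕ} {f : (Fin (n + 1) → X) → ℝ≥0∞} (hf : Measurable f) :
    ∫⁻ w, f w ∂(Measure.pi fun _ => lam) =
      ∫⁻ x, ∫⁻ w, f (Matrix.vecCons x w) ∂(Measure.pi fun _ : Fin n => lam) ∂lam := by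
  have hmp := measurePreserving_vecCons lam n
  rw [← hmp.lintegral_comp_emb (measurableEmbedding_vecCons n)]
  exact lintegral_prod _ (hf.comp hmp.measurable).aemeasurable

lemma ae_ae_fin_one {P : (Fin 1 → X) → Prop} (h : ∀ᵐ w ∂(Measure.pi fun _ => lam), P w) :
    ∀ᵐ x ∂lam, P ![x] :=
  (ae_ae_vecCons h).mono fun _ hx => ae_pi_fin_zero hx

lemma ae_ae_fin_two {P : (Fin 2 → X) → Prop} (h : ∀ᵐ w ∂(Measure.pi fun _ => lam), P w) :
    ∀ᵐ x ∂lam, ∀ᵐ y ∂lam, P ![x, y] :=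
  (ae_ae_vecCons h).mono fun _ hx => ae_ae_fin_one hx

lemma ae_ae_fin_three {P : (Fin 3 → X) → Prop} (h : ∀ᵐ w ∂(Measure.pi fun _ => lam), P w) :
    ∀ᵐ x ∂lam, ∀ᵐ y ∂lam, ∀ᵐ z ∂lam, P ![x, y, z] :=
  (ae_ae_vecCons h).mono fun _ hx => ae_ae_fin_two hx

lemma measurable_vecCons {A : Type*} [MeasurableSpace A] {n : ℕ} {f : A → X}
    {g : A → Fin n → X} (hf : Measurable f) (hg : Measurable g) :
    Measurable fun a => (Matrix.vecCons (f a) (g a) : Fin (n + 1) → X) :=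
  (measurableEmbedding_vecCons n).measurable.comp (hf.prodMk hg)

lemma lintegral_pi_fin_one {f : (Fin 1 → X) → ℝ≥0∞} (hf : Measurable f) :
    ∫⁻ w, f w ∂(Measure.pi fun _ => lam) = ∫⁻ x, f ![x] ∂lam := by
  rw [lintegral_vecCons hf]
  exact lintegral_congr fun x => lintegral_pi_fin_zero _

lemma lintegral_pi_fin_two {f : (Fin 2 → X) → ℝ≥0∞} (hf : Measurable f) :
    ∫⁻ w, f w ∂(Measure.pi fun _ => lam) = ∫⁻ x, ∫⁻ y, f ![x, y] ∂lam ∂lam := by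
  rw [lintegral_vecCons hf]
  exact lintegral_congr fun x =>
    lintegral_pi_fin_one (hf.comp (measurable_vecCons measurable_const measurable_id))

end Powers

/-! ### Slices of consistent families -/

section Slice

lemma IsConsistentFamily.mono {X U : Type*} [MeasurableSpace X] [MeasurableSpace U]
    {τ τ' : Measure ℝ} [SFinite τ] [SFinite τ'] {lam : Measure X} [SigmaFinite lam]
    {κ : ∀ k : ℕ, Kernel (ℝ × (Fin k → X)) (Fin k → U)}
    (h : IsConsistentFamily τ lam κ) (hτ : τ' ≪ τ) : IsConsistentFamily τ' lam κ := by
  have hac (k : ℕ) : baseMeasure τ' lam k ≪ baseMeasure τ lam k :=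
    hτ.prod Measure.AbsolutelyContinuous.rfl
  exact ⟨fun k σ => (hac k).ae_le (h.symmetry k σ), fun k => (hac _).ae_le (h.consistency k)⟩

lemma rpow_add_le_two_mul {q : ℝ} (hq : 1 ≤ q) (a b : ℝ≥0∞) :
    (a + b) ^ q ≤ ((2 ^ (q - 1) : ℝ≥0) : ℝ≥0∞) * (a ^ q + b ^ q) := by
  rw [ENNReal.coe_rpow_of_nonneg _ (by linarith)]
  exact ENNReal.rpow_add_le_mul_rpow_add_rpow a b hq

/-- For almost every time, the moduli of continuity of a consistent family vanish in the limit if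
their time integrals do. -/
lemma IsConsistentFamily.ae_tendsto_kModulus {E : Type*} [NormedAddCommGroup E] [NormedSpace ℝ E]
    [FiniteDimensional ℝ E] [MeasurableSpace E] [BorelSpace E] {vol : Measure E}
    [vol.IsAddHaarMeasure] {D : Set E} (hD : IsOpen D) {U : Type*}
    [NormedAddCommGroup U] [SecondCountableTopology U] [MeasurableSpace U] [BorelSpace U]
    {τ : Measure ℝ} [SigmaFinite τ] [SigmaFinite vol]
    {κ : ∀ k : ℕ, Kernel (ℝ × (Fin k → E)) (Fin k → U)} [∀ k, IsMarkovKernel (κ k)]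
    (hκ : IsConsistentFamily τ (vol.restrict D) κ) {q : ℝ} (hq : 1 ≤ q)
    (hmom : ∀ᵐ t ∂τ, kMoment (vol.restrict D) q (fun x => κ 1 (t, x)) ≠ ∞)
    (hmod : Tendsto (fun r => ∫⁻ t, kModulus (vol.restrict D) q r (fun x => κ 2 (t, x)) ∂τ)
      (𝓝[>] 0) (𝓝 0)) :
    ∀ᵐ t ∂τ, Tendsto (fun r => kModulus (vol.restrict D) q r (fun x => κ 2 (t, x)))
      (𝓝[>] 0) (𝓝 0) := by
  have : ProperSpace E := FiniteDimensional.proper ℝ E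
  have : SecondCountableTopology E := secondCountable_of_proper
  set lam := vol.restrict D with hlam
  have hS : Tendsto (fun j : ℕ => 1 / ((j : ℝ) + 1)) atTop (𝓝[>] 0) :=
    tendsto_nhdsWithin_iff.2 ⟨tendsto_one_div_add_atTop_nhds_zero_nat,
      Eventually.of_forall fun j => by simp only [mem_Ioi]; positivity⟩
  have hlim : ∀ᵐ t ∂τ, liminf (fun j : ℕ =>
      kModulus lam q (1 / ((j : ℝ) + 1)) (fun x => κ 2 (t, x))) atTop = 0 := by
    have hm (r : ℝ) : Measurable fun t => kModulus lam q r (fun x => κ 2 (t, x)) :=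
      measurable_kModulus q r (κ 2)
    -- Convergence to zero of the time integrals gives, by Fatou's lemma, only a vanishing lower
    -- limit along the scales 1/(j+1) at a.e. time. Comparison of scales upgrades this to a limit.
    refine (lintegral_eq_zero_iff (.liminf fun j => hm _)).1 (le_antisymm ?_ zero_le)
    refine (lintegral_liminf_le fun j => hm _).trans ?_
    exact (hmod.comp hS).liminf_eq.le
  -- The three two-point measures are marginals of the three-point measure. There the pointwise
  -- triangle inequality for ξ₀, ξ₁, ξ₂ gives the one for `δ`.
  have hinj01 : Function.Injective ![(0 : Fin 3), 1] := by decide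
  have hinj02 : Function.Injective ![(0 : Fin 3), 2] := by decide
  have hinj12 : Function.Injective ![(1 : Fin 3), 2] := by decide
  have hinj0 : Function.Injective ![(0 : Fin 2)] := by decide
  have hinj1 : Function.Injective ![(1 : Fin 2)] := by decide
  filter_upwards [hlim, hmom, ae_ae_of_ae_base (hκ.marginal hinj01),
    ae_ae_of_ae_base (hκ.marginal hinj02), ae_ae_of_ae_base (hκ.marginal hinj12),
    ae_ae_of_ae_base (hκ.marginal hinj0), ae_ae_of_ae_base (hκ.marginal hinj1)]
    with t hlim hmom h01 h02 h12 h0 h1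
  let δ : E → E → ℝ≥0∞ := fun x y => ∫⁻ ξ, ‖ξ 0 - ξ 1‖ₑ ^ q ∂(κ 2 (t, ![x, y]))
  let a : E → ℝ≥0∞ := fun x => ∫⁻ ξ, ‖ξ 0‖ₑ ^ q ∂(κ 1 (t, ![x]))
  have hmδ : Measurable fun w : Fin 2 → E => ∫⁻ ξ, ‖ξ 0 - ξ 1‖ₑ ^ q ∂(κ 2 (t, w)) := by
    have h : Measurable fun z : ℝ × (Fin 2 → E) => ∫⁻ ξ, ‖ξ 0 - ξ 1‖ₑ ^ q ∂(κ 2 z) :=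
      Measurable.lintegral_kernel (by fun_prop)
    exact h.comp measurable_prodMk_left
  have hma : Measurable fun w : Fin 1 → E => ∫⁻ ξ, ‖ξ 0‖ₑ ^ q ∂(κ 1 (t, w)) := by
    have h : Measurable fun z : ℝ × (Fin 1 → E) => ∫⁻ ξ, ‖ξ 0‖ₑ ^ q ∂(κ 1 z) :=
      Measurable.lintegral_kernel (by fun_prop)
    exact h.comp measurable_prodMk_left
  have hδ : Measurable (Function.uncurry δ) :=
    hmδ.comp (measurable_vecCons measurable_fst
      (measurable_vecCons measurable_snd measurable_const))
  have ha : Measurable a := hma.comp (measurable_vecCons measurable_id measurable_const)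
  have hafin : ∫⁻ x, a x ∂lam ≠ ∞ := by
    rw [← lintegral_pi_fin_one hma]
    exact hmom
  have heq (r : ℝ) : kModulus lam q r (fun x => κ 2 (t, x)) =
      ∫⁻ x, ∫⁻ y, ballWeight lam r x y * δ x y ∂lam ∂lam :=
    lintegral_pi_fin_two ((measurable_ballWeight_apply r 0 1).mul hmδ)
  simp_rw [heq] at hlim ⊢
  refine tendsto_modulus_of_frequently (c := 2 ^ (q - 1)) hD ha hafin hδ ?_ ?_ ?_
  · filter_upwards [ae_ae_fin_two h0, ae_ae_fin_two h1] with x hx0 hx1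
    filter_upwards [hx0, hx1] with y h0 h1
    have e0 : a x = ∫⁻ ξ, ‖ξ 0‖ₑ ^ q ∂(κ 2 (t, ![x, y])) := by
      have e : ![x, y] ∘ ![(0 : Fin 2)] = ![x] := by ext i; fin_cases i; rfl
      simp only [e] at h0
      simp only [a]
      rw [h0, lintegral_map (by fun_prop) (measurable_comp_index _)]
      rfl
    have e1 : a y = ∫⁻ ξ, ‖ξ 1‖ₑ ^ q ∂(κ 2 (t, ![x, y])) := by
      have e : ![x, y] ∘ ![(1 : Fin 2)] = ![y] := by ext i; fin_cases i; rfl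
      simp only [e] at h1
      simp only [a]
      rw [h1, lintegral_map (by fun_prop) (measurable_comp_index _)]
      rfl
    rw [e0, e1, ← lintegral_add_left (by fun_prop), ← lintegral_const_mul _ (by fun_prop)]
    refine lintegral_mono fun ξ => le_trans ?_ (rpow_add_le_two_mul hq _ _)
    exact ENNReal.rpow_le_rpow enorm_sub_le (by linarith)
  · filter_upwards [ae_ae_fin_three h01, ae_ae_fin_three h02, ae_ae_fin_three h12]
      with x hx1 hx2 hx3
    filter_upwards [hx1, hx2, hx3] with y hy1 hy2 hy3
    filter_upwards [hy1, hy2, hy3] with z h1 h2 h3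
    have e1 : δ x y = ∫⁻ ξ, ‖ξ 0 - ξ 1‖ₑ ^ q ∂(κ 3 (t, ![x, y, z])) := by
      have e : ![x, y, z] ∘ ![(0 : Fin 3), 1] = ![x, y] := by ext i; fin_cases i <;> rfl
      simp only [e] at h1
      simp only [δ]
      rw [h1, lintegral_map (by fun_prop) (measurable_comp_index _)]
      rfl
    have e2 : δ x z = ∫⁻ ξ, ‖ξ 0 - ξ 2‖ₑ ^ q ∂(κ 3 (t, ![x, y, z])) := by
      have e : ![x, y, z] ∘ ![(0 : Fin 3), 2] = ![x, z] := by ext i; fin_cases i <;> rfl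
      simp only [e] at h2
      simp only [δ]
      rw [h2, lintegral_map (by fun_prop) (measurable_comp_index _)]
      rfl
    have e3 : δ y z = ∫⁻ ξ, ‖ξ 1 - ξ 2‖ₑ ^ q ∂(κ 3 (t, ![x, y, z])) := by
      have e : ![x, y, z] ∘ ![(1 : Fin 3), 2] = ![y, z] := by ext i; fin_cases i <;> rfl
      simp only [e] at h3
      simp only [δ]
      rw [h3, lintegral_map (by fun_prop) (measurable_comp_index _)]
      rfl
    rw [e1, e2, e3, ← lintegral_add_left (by fun_prop), ← lintegral_const_mul _ (by fun_prop)]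
    refine lintegral_mono fun ξ => le_trans ?_ (rpow_add_le_two_mul hq _ _)
    refine ENNReal.rpow_le_rpow ?_ (by linarith)
    rw [← enorm_neg (ξ 1 - ξ 2), neg_sub, ← sub_add_sub_cancel (ξ 0) (ξ 2) (ξ 1)]
    exact enorm_add_le _ _
  · intro ε hε
    have hf : ∃ᶠ j : ℕ in atTop,
        ∫⁻ x, ∫⁻ y, ballWeight lam (1 / ((j : ℝ) + 1)) x y * δ x y ∂lam ∂lam < ε :=
      frequently_lt_of_liminf_lt (by isBoundedDefault) (by rw [hlim]; exact hε)
    exact hS.frequently (hf.mono fun j hj => hj.le)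

end Slice

section Time

variable {T : EReal}

/-- Diagonal continuity is controlled only on [0,T') with T' < T. Rational endpoints suffice, so
countably many null sets are united. -/
lemma ae_cmTimeMeasure_of_forall_Ico {P : ℝ → Prop}
    (h : ∀ T' : ℝ, 0 < T' → (T' : EReal) < T → ∀ᵐ t ∂volume.restrict (Ico 0 T'), P t) :
    ∀ᵐ t ∂(cmTimeMeasure T), P t := by
  have h1 : ∀ᵐ t : ℝ, ∀ T' : ℚ, 0 < (T' : ℝ) → ((T' : ℝ) : EReal) < T → t ∈ Ico (0 : ℝ) T' → P t := by
    rw [ae_all_iff]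
    intro T'
    by_cases h0 : 0 < (T' : ℝ) ∧ ((T' : ℝ) : EReal) < T
    · filter_upwards [(ae_restrict_iff' measurableSet_Ico).1 (h T' h0.1 h0.2)] with t ht _ _
      exact ht
    · exact ae_of_all _ fun t ha hb => absurd ⟨ha, hb⟩ h0
  rw [cmTimeMeasure, ae_restrict_iff' (measurableSet_cmTime T)]
  filter_upwards [h1] with t ht htT
  obtain ⟨T', h2, h3⟩ := EReal.lt_iff_exists_rat_btwn.1 htT.2
  have h4 : t < T' := by exact_mod_cast h2
  exact ht T' (htT.1.trans_lt h4) h3 ⟨htT.1, h4⟩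

end Time

/-! ### The limit of a sequence of correlation measures -/

section Bridge

variable {d N : ℕ} {p : ℝ≥0∞} {D : Set (EuclideanSpace ℝ (Fin d))} {T : EReal}

lemma cmTimeMeasure_ne_zero (hT : 0 < T) : cmTimeMeasure T ≠ 0 := by
  obtain ⟨T', h0, h1⟩ := EReal.lt_iff_exists_real_btwn.1 hT
  have h0' : 0 < T' := by exact_mod_cast h0
  intro h
  have h2 := restrict_Ico_cmTimeMeasure h1
  rw [h, Measure.restrict_zero] at h2
  have h3 : volume (Ico 0 T') = 0 := by
    rw [← Measure.restrict_apply_univ, ← h2]; rfl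
  rw [Real.volume_Ico, sub_zero, ENNReal.ofReal_eq_zero] at h3
  linarith

lemma baseMeasure_ne_zero {X : Type*} [MeasurableSpace X] {τ : Measure ℝ} [SFinite τ]
    {lam : Measure X} [SigmaFinite lam] (hτ : τ ≠ 0) (hlam : lam ≠ 0) (k : ℕ) :
    baseMeasure τ lam k ≠ 0 := by
  rw [← Measure.measure_univ_ne_zero, baseMeasure, ← univ_prod_univ, Measure.prod_prod,
    Measure.pi_univ]
  exact mul_ne_zero (Measure.measure_univ_ne_zero.2 hτ)
    (Finset.prod_ne_zero_iff.2 fun _ _ => Measure.measure_univ_ne_zero.2 hlam)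

lemma ae_cmMoment_le {ν : ℕ → ∀ k : ℕ, ℝ → (Fin k → EuclideanSpace ℝ (Fin d)) →
      Measure (Fin k → EuclideanSpace ℝ (Fin N))} {C : ℝ≥0∞}
    (hbound : ⨆ n, essSup (fun t => cmMoment p D (ν n 1 t)) (cmTimeMeasure T) ≤ C) (n : ℕ) :
    ∀ᵐ t ∂(cmTimeMeasure T), cmMoment p D (ν n 1 t) ≤ C := by
  filter_upwards [ENNReal.ae_le_essSup fun t => cmMoment p D (ν n 1 t)] with t ht
  exact (ht.trans (le_iSup (fun n => essSup (fun t => cmMoment p D (ν n 1 t))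
    (cmTimeMeasure T)) n)).trans hbound

/-! ### Moments, moduli and pairings in terms of representing kernels -/

section Represent

variable {ν : ∀ k : ℕ, ℝ → (Fin k → EuclideanSpace ℝ (Fin d)) →
    Measure (Fin k → EuclideanSpace ℝ (Fin N))}
  {κ : ∀ k : ℕ, Kernel (ℝ × (Fin k → EuclideanSpace ℝ (Fin d)))
    (Fin k → EuclideanSpace ℝ (Fin N))} [∀ k, IsMarkovKernel (κ k)]

lemma ae_cmMoment_eq (h : ∀ k, 1 ≤ k →
      ∀ᵐ z ∂(baseMeasure (cmTimeMeasure T) (volume.restrict D) k), ν k z.1 z.2 = κ k z) :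
    ∀ᵐ t ∂(cmTimeMeasure T), cmMoment p D (ν 1 t) =
      kMoment (volume.restrict D) p.toReal (fun x => κ 1 (t, x)) := by
  filter_upwards [ae_ae_of_ae_base (h 1 le_rfl)] with t ht
  rw [cmMoment_eq_kMoment]
  exact kMoment_congr ht

lemma ae_cmModulus_eq (h : ∀ k, 1 ≤ k →
      ∀ᵐ z ∂(baseMeasure (cmTimeMeasure T) (volume.restrict D) k), ν k z.1 z.2 = κ k z) :
    ∀ᵐ t ∂(cmTimeMeasure T), ∀ r, cmModulus p D r (ν 2 t) =
      kModulus (volume.restrict D) p.toReal r (fun x => κ 2 (t, x)) := by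
  filter_upwards [ae_ae_of_ae_base (h 2 one_le_two)] with t ht r
  have hm : Measurable fun x : Fin 2 → EuclideanSpace ℝ (Fin d) => (t, x) :=
    measurable_prodMk_left
  rw [cmModulus_eq_kModulus r ((κ 2).comap _ hm) ht]
  exact kModulus_congr ht

lemma setLIntegral_cmModulus_eq (h : ∀ k, 1 ≤ k →
      ∀ᵐ z ∂(baseMeasure (cmTimeMeasure T) (volume.restrict D) k), ν k z.1 z.2 = κ k z)
    {T' : ℝ} (hT' : (T' : EReal) < T) (r : ℝ) :
    ∫⁻ t in Ico 0 T', cmModulus p D r (ν 2 t) =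
      ∫⁻ z, ∫⁻ ξ, ‖ξ 0 - ξ 1‖ₑ ^ p.toReal ∂(κ 2 z)
        ∂(modulusMeasure (volume.restrict (Ico 0 T')) (volume.restrict D) r) := by
  rw [← lintegral_kModulus, ← restrict_Ico_cmTimeMeasure hT']
  refine lintegral_congr_ae (ae_restrict_of_ae ?_)
  filter_upwards [ae_cmModulus_eq h] with t ht using ht r

lemma modulusMeasure_absolutelyContinuous {T' : ℝ} (hT' : (T' : EReal) < T) (r : ℝ) :
    modulusMeasure (volume.restrict (Ico 0 T')) (volume.restrict D) r ≪
      baseMeasure (cmTimeMeasure T) (volume.restrict D) 2 := by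
  refine (withDensity_absolutelyContinuous _ _).trans ?_
  rw [← restrict_Ico_cmTimeMeasure hT']
  exact Measure.absolutelyContinuous_restrict.prod Measure.AbsolutelyContinuous.rfl

lemma cmPairing_eq (h : ∀ k, 1 ≤ k →
      ∀ᵐ z ∂(baseMeasure (cmTimeMeasure T) (volume.restrict D) k), ν k z.1 z.2 = κ k z)
    {k : ℕ} (hk : 1 ≤ k)
    (g : ℝ × (Fin k → EuclideanSpace ℝ (Fin d)) → C₀(Fin k → EuclideanSpace ℝ (Fin N), ℝ)) :
    cmPairing D T k (ν k) g = ∫ z, ∫ ξ, (g z).toBCF ξ ∂(κ k z)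
      ∂(baseMeasure (cmTimeMeasure T) (volume.restrict D) k) := by
  rw [cmPairing, cmSpaceTimeMeasure_eq]
  refine integral_congr_ae ?_
  filter_upwards [h k hk] with z hz
  rw [hz]
  rfl

/-- The factor φ is absorbed into the base measure as a density. What remains is the integral of a
nonnegative continuous function of the state over an absolutely continuous base measure, which is
the setting of lower semicontinuity. -/
lemma cmPairingNonneg_eq (hD : MeasurableSet D) (h : ∀ k, 1 ≤ k →
      ∀ᵐ z ∂(baseMeasure (cmTimeMeasure T) (volume.restrict D) k), ν k z.1 z.2 = κ k z)
    {k : ℕ} (hk : 1 ≤ k) {φ : ℝ → (Fin k → EuclideanSpace ℝ (Fin d)) → ℝ}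
    {f : (Fin k → EuclideanSpace ℝ (Fin N)) → ℝ}
    (hφ : AEStronglyMeasurable (fun z : ℝ × (Fin k → EuclideanSpace ℝ (Fin d)) => φ z.1 z.2)
      (baseMeasure (cmTimeMeasure T) (volume.restrict D) k))
    (hφ0 : ∀ t ∈ cmTime T, ∀ x ∈ cmPower D k, 0 ≤ φ t x) (hf : Continuous f) :
    cmPairingNonneg D T k (ν k) (fun t x ξ => φ t x * f ξ) =
      ∫⁻ z, ∫⁻ ξ, ((f ξ).toNNReal : ℝ≥0∞) ∂(κ k z)
        ∂((baseMeasure (cmTimeMeasure T) (volume.restrict D) k).withDensity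
          fun z => ENNReal.ofReal (φ z.1 z.2)) := by
  have hm : Measurable fun ξ => ((f ξ).toNNReal : ℝ≥0∞) := hf.measurable.ennreal_ofReal
  rw [lintegral_withDensity_eq_lintegral_mul₀ hφ.aemeasurable.ennreal_ofReal
    (Measurable.lintegral_kernel hm).aemeasurable, cmPairingNonneg, cmSpaceTimeMeasure_eq]
  refine lintegral_congr_ae ?_
  have h2 := ae_mem_prod (T := T) hD k
  rw [cmSpaceTimeMeasure_eq] at h2
  filter_upwards [h k hk, h2] with z hz hz2
  rw [hz, Pi.mul_apply, ← lintegral_const_mul _ hm]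
  refine lintegral_congr fun ξ => ?_
  rw [ENNReal.ofReal_mul (hφ0 _ hz2.1 _ hz2.2)]
  rfl

end Represent

lemma integrable_toBCF {A V : Type*} [MeasurableSpace A] [TopologicalSpace V] {m : Measure A}
    {g : A → C₀(V, ℝ)} (hg : Integrable g m) : Integrable (fun a => (g a).toBCF) m := by
  refine hg.norm.mono' ?_ (ae_of_all _ fun a => le_rfl)
  exact ZeroAtInftyContinuousMap.isometry_toBCF.continuous.comp_aestronglyMeasurable hg.1

/-- A limit of correlation measures, represented by kernels. -/
theorem exists_limit_kernels [Fact (1 ≤ p)] (hp : p ≠ ∞) (hDopen : IsOpen D) (hDne : D.Nonempty)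
    (hT : 0 < T)
    {ν : ℕ → ∀ k : ℕ, ℝ → (Fin k → EuclideanSpace ℝ (Fin d)) →
      Measure (Fin k → EuclideanSpace ℝ (Fin N))}
    (hν : ∀ n, IsTimeDepCorrelationMeasure p D T (ν n)) {C : ℝ≥0}
    (hC : ∀ n, ∀ᵐ t ∂(cmTimeMeasure T), cmMoment p D (ν n 1 t) ≤ C) :
    ∃ (s : ℕ → ℕ) (κ : ℕ → ∀ k : ℕ, Kernel (ℝ × (Fin k → EuclideanSpace ℝ (Fin d)))
        (Fin k → EuclideanSpace ℝ (Fin N)))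
      (κ' : ∀ k : ℕ, Kernel (ℝ × (Fin k → EuclideanSpace ℝ (Fin d)))
        (Fin k → EuclideanSpace ℝ (Fin N))),
      StrictMono s ∧ (∀ n k, IsMarkovKernel (κ n k)) ∧ (∀ k, IsMarkovKernel (κ' k)) ∧
      (∀ n, IsConsistentFamily (cmTimeMeasure T) (volume.restrict D) (κ n)) ∧
      IsConsistentFamily (cmTimeMeasure T) (volume.restrict D) κ' ∧
      (∀ n, ∀ k, 1 ≤ k → ∀ᵐ z ∂(baseMeasure (cmTimeMeasure T) (volume.restrict D) k),
        ν n k z.1 z.2 = κ n k z) ∧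
      ∀ k, StableTendsto (baseMeasure (cmTimeMeasure T) (volume.restrict D) k)
        (fun j => κ (s j) k) (κ' k) := by
  have hq : 0 < p.toReal := ENNReal.toReal_pos (one_pos.trans_le Fact.out).ne' hp
  have hlam : (volume.restrict D : Measure (EuclideanSpace ℝ (Fin d))) ≠ 0 := by
    rw [Ne, Measure.restrict_eq_zero]
    exact (hDopen.measure_pos _ hDne).ne'
  have hne (k : ℕ) : NeZero (baseMeasure (cmTimeMeasure T)
      (volume.restrict D : Measure (EuclideanSpace ℝ (Fin d))) k) :=
    ⟨baseMeasure_ne_zero (cmTimeMeasure_ne_zero hT) hlam k⟩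
  have : IsLocallyFiniteMeasure (cmTimeMeasure T) := by
    unfold cmTimeMeasure; infer_instance
  choose κ hκM hκ hrep using fun n => (hν n).exists_kernel
  obtain ⟨s, hs, κ', hκ'M, hlim⟩ := exists_subseq_stableTendsto
    (fun k => baseMeasure (cmTimeMeasure T)
      (volume.restrict D : Measure (EuclideanSpace ℝ (Fin d))) k) κ
    (fun k μ hμ hac => isTightMeasureSet_of_kMoment_le hκ hq (C := C) (fun n => by
      filter_upwards [hC n, ae_cmMoment_eq (p := p) (hrep n)] with t ht1 ht2
      exact ht2 ▸ ht1) k μ hac)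
  exact ⟨s, κ, κ', hs, hκM, hκ'M, hκ, .of_stableTendsto (fun j => hκ (s j)) hlim, hrep, hlim⟩

/-- The family of measures given by consistent kernels is a correlation measure. -/
lemma IsConsistentFamily.isTimeDepCorrelationMeasure [Fact (1 ≤ p)] (hp : p ≠ ∞)
    (hDopen : IsOpen D)
    {κ : ∀ k : ℕ, Kernel (ℝ × (Fin k → EuclideanSpace ℝ (Fin d)))
      (Fin k → EuclideanSpace ℝ (Fin N))} [∀ k, IsMarkovKernel (κ k)]
    (hκ : IsConsistentFamily (cmTimeMeasure T) (volume.restrict D) κ) {C : ℝ≥0}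
    (hC : ∀ᵐ t ∂(cmTimeMeasure T),
      kMoment (volume.restrict D) p.toReal (fun x => κ 1 (t, x)) ≤ C)
    (hmod : ∀ T' : ℝ, 0 < T' → (T' : EReal) < T → Tendsto (fun r =>
      ∫⁻ t in Ico 0 T', kModulus (volume.restrict D) p.toReal r (fun x => κ 2 (t, x)))
      (𝓝[>] 0) (𝓝 0)) :
    IsTimeDepCorrelationMeasure p D T fun k t x => κ k (t, x) := by
  have hq : 1 ≤ p.toReal := by
    simpa using ENNReal.toReal_mono hp (Fact.out : 1 ≤ p)
  have hmeas (k : ℕ) (f : (Fin k → EuclideanSpace ℝ (Fin N)) →ᵇ ℝ) :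
      StronglyMeasurable fun z : ℝ × (Fin k → EuclideanSpace ℝ (Fin d)) =>
        ∫ ξ, f ξ ∂(κ k (z.1, z.2)) := stronglyMeasurable_integral_bcf (κ k) f
  have hmeast (k : ℕ) (f : (Fin k → EuclideanSpace ℝ (Fin N)) →ᵇ ℝ) (t : ℝ) :
      StronglyMeasurable fun x => ∫ ξ, f ξ ∂(κ k (t, x)) :=
    (hmeas k f).comp_measurable measurable_prodMk_left
  have hkmod (t r : ℝ) : cmModulus p D r (fun x => κ 2 (t, x)) =
      kModulus (volume.restrict D) p.toReal r (fun x => κ 2 (t, x)) :=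
    cmModulus_eq_kModulus r ((κ 2).comap (fun x => (t, x)) measurable_prodMk_left) (ae_of_all _ fun _ => rfl)
  have hdiag : ∀ᵐ t ∂(cmTimeMeasure T), Tendsto (fun r =>
      kModulus (volume.restrict D) p.toReal r (fun x => κ 2 (t, x))) (𝓝[>] 0) (𝓝 0) := by
    refine ae_cmTimeMeasure_of_forall_Ico fun T' h0 h1 => ?_
    have hac : volume.restrict (Ico 0 T') ≪ cmTimeMeasure T := by
      rw [← restrict_Ico_cmTimeMeasure h1]; exact Measure.absolutelyContinuous_restrict
    exact (hκ.mono hac).ae_tendsto_kModulus hDopen hq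
      (hac.ae_le (hC.mono fun t ht => (ht.trans_lt ENNReal.coe_lt_top).ne)) (hmod T' h0 h1)
  refine ⟨fun k _ => ⟨fun f => (hmeas k f.toBCF).aestronglyMeasurable,
    1, ae_of_all _ fun z => by simp⟩, ?_, ?_, fun T' h0 h1 => ?_⟩
  · have hsym : ∀ᵐ t ∂(cmTimeMeasure T), ∀ k : ℕ, ∀ σ : Equiv.Perm (Fin k),
        ∀ᵐ x ∂(Measure.pi fun _ => volume.restrict D),
          κ k (t, x ∘ σ) = (κ k (t, x)).map (fun ξ => ξ ∘ σ) :=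
      ae_all_iff.2 fun k => ae_all_iff.2 fun σ => ae_ae_of_ae_base (hκ.symmetry k σ)
    have hcons : ∀ᵐ t ∂(cmTimeMeasure T), ∀ k : ℕ,
        ∀ᵐ x ∂(Measure.pi fun _ : Fin (k + 1) => volume.restrict D),
          κ k (t, x ∘ Fin.castSucc) = (κ (k + 1) (t, x)).map (fun ξ => ξ ∘ Fin.castSucc) :=
      ae_all_iff.2 fun k => ae_ae_of_ae_base (hκ.consistency k)
    filter_upwards [hsym, hcons, hC, hdiag] with t h1 h2 h3 h4
    refine ⟨fun k _ => ⟨fun f => (hmeast k f.toBCF t).aestronglyMeasurable,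
      1, ae_of_all _ fun z => by simp⟩, fun k _ => ae_of_all _ fun x => inferInstance,
      fun k _ f => (hmeast k f t).aestronglyMeasurable, fun k _ σ f => ?_, fun k _ f => ?_, ?_, ?_⟩
    · rw [cmSpaceMeasure_eq_pi]
      filter_upwards [h1 k σ] with x hx
      change ∫ ξ, f ξ ∂(κ k (t, x ∘ σ)) = _
      rw [hx, integral_map (measurable_comp_index σ).aemeasurable
        (ContinuousMapClass.map_continuous f).aestronglyMeasurable]
      rfl
    · rw [cmSpaceMeasure_eq_pi]
      filter_upwards [h2 k] with x hx
      change _ = ∫ ξ, f ξ ∂(κ k (t, x ∘ Fin.castSucc))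
      rw [hx, integral_map (measurable_comp_index _).aemeasurable
        (ContinuousMapClass.map_continuous f).aestronglyMeasurable]
      rfl
    · rw [cmMoment_eq_kMoment]
      exact h3.trans_lt ENNReal.coe_lt_top
    · simpa only [hkmod] using h4
  · refine (essSup_le_of_ae_le (C : ℝ≥0∞) ?_).trans_lt ENNReal.coe_lt_top
    filter_upwards [hC] with t ht
    rw [cmMoment_eq_kMoment]
    exact ht
  · simpa only [hkmod] using hmod T' h0 h1

/-- Weak* limits inherit uniform bounds on the moments. -/
lemma StableTendsto.ae_kMoment_le {X U : Type*} [MeasurableSpace X] {lam : Measure X}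
    [SigmaFinite lam] [NormedAddCommGroup U] [SecondCountableTopology U] [MeasurableSpace U]
    [BorelSpace U] {τ : Measure ℝ} [SigmaFinite τ] {κ : ℕ → Kernel (ℝ × (Fin 1 → X)) (Fin 1 → U)}
    {κ' : Kernel (ℝ × (Fin 1 → X)) (Fin 1 → U)} [∀ n, IsMarkovKernel (κ n)] [IsMarkovKernel κ']
    (h : StableTendsto (baseMeasure τ lam 1) κ κ') {q : ℝ} (hq : 0 ≤ q) {C : ℝ≥0∞}
    (hC : ∀ n, ∀ᵐ t ∂τ, kMoment lam q (fun x => κ n (t, x)) ≤ C) :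
    ∀ᵐ t ∂τ, kMoment lam q (fun x => κ' (t, x)) ≤ C := by
  have hm (η : Kernel (ℝ × (Fin 1 → X)) (Fin 1 → U)) [IsMarkovKernel η] :
      Measurable fun z => ∫⁻ ξ, ‖ξ 0‖ₑ ^ q ∂(η z) := Measurable.lintegral_kernel (by fun_prop)
  have hk (η : Kernel (ℝ × (Fin 1 → X)) (Fin 1 → U)) [IsMarkovKernel η] :
      Measurable fun t => kMoment lam q (fun x => η (t, x)) := (hm η).lintegral_prod_right
  -- Lower semicontinuity is available only after integration in time. Testing it on measurable sets
  -- of times of finite measure recovers the bound for a.e. time.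
  refine ae_le_of_forall_setLIntegral_le_of_sigmaFinite (hk κ') fun B hB _ => ?_
  have heq (η : Kernel (ℝ × (Fin 1 → X)) (Fin 1 → U)) [IsMarkovKernel η] :
      ∫⁻ t in B, kMoment lam q (fun x => η (t, x)) ∂τ =
        ∫⁻ z, ∫⁻ ξ, ((‖ξ 0‖₊ ^ q : ℝ≥0) : ℝ≥0∞) ∂(η z) ∂(baseMeasure (τ.restrict B) lam 1) := by
    simp_rw [coe_nnnorm_rpow hq]
    rw [baseMeasure, lintegral_prod _ (hm η).aemeasurable]
    rfl
  have hac : baseMeasure (τ.restrict B) lam 1 ≪ baseMeasure τ lam 1 :=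
    Measure.absolutelyContinuous_restrict.prod Measure.AbsolutelyContinuous.rfl
  rw [heq]
  refine (h.lintegral_le_liminf hac (f := fun ξ => ‖ξ 0‖₊ ^ q)
    (by have := NNReal.continuous_rpow_const hq; fun_prop)).trans ?_
  refine liminf_le_of_frequently_le' (Frequently.of_forall fun n => ?_)
  rw [← heq]
  exact lintegral_mono_ae (ae_restrict_of_ae (hC n))

end Bridge

/-! ### Decoupling for correlation measures with a dual measure on `L^p` -/

section Powers

variable {X : Type*} [MeasurableSpace X] {lam : Measure X} [SigmaFinite lam]

lemma measurePreserving_append (lam : Measure X) [SigmaFinite lam] (b m : ℕ) :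
    MeasurePreserving (fun p : (Fin b → X) × (Fin m → X) => (Fin.append p.1 p.2 : Fin (b + m) → X))
      ((Measure.pi fun _ => lam).prod (Measure.pi fun _ => lam)) (Measure.pi fun _ => lam) := by
  have h1 := measurePreserving_sumPiEquivProdPi_symm (fun _ : Fin b ⊕ Fin m => lam)
  have h2 := measurePreserving_piCongrLeft (fun _ : Fin (b + m) => lam) finSumFinEquiv
  have h3 := h2.comp h1
  convert h3 using 1
  funext p
  refine (MeasurableEquiv.piCongrLeft (fun _ : Fin (b + m) => X) finSumFinEquiv).symm.injective ?_
  simp only [Function.comp_apply, MeasurableEquiv.symm_apply_apply]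
  funext i
  rcases i with i | i
  · exact Fin.append_left p.1 p.2 i
  · exact Fin.append_right p.1 p.2 i

lemma lintegral_append {b m : ℕ} {f : (Fin (b + m) → X) → ℝ≥0∞} (hf : Measurable f) :
    ∫⁻ w, f w ∂(Measure.pi fun _ => lam) =
      ∫⁻ x, ∫⁻ y, f (Fin.append x y) ∂(Measure.pi fun _ : Fin m => lam)
        ∂(Measure.pi fun _ : Fin b => lam) := by
  have hmp := measurePreserving_append lam b m
  rw [← hmp.map_eq, lintegral_map hf hmp.measurable]
  exact lintegral_prod _ (hf.comp hmp.measurable).aemeasurable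

lemma lintegral_prod_pi {n : ℕ} {f : Fin n → X → ℝ≥0∞} (hf : ∀ i, Measurable (f i)) :
    ∫⁻ w, ∏ i, f i (w i) ∂(Measure.pi fun _ => lam) = ∏ i, ∫⁻ x, f i x ∂lam := by
  induction n with
  | zero => simp
  | succ n ih =>
    have h1 (i : Fin (n + 1)) : Measurable fun w : Fin (n + 1) → X => f i (w i) :=
      (hf i).comp (measurable_pi_apply i)
    rw [lintegral_vecCons (Finset.measurable_fun_prod _ fun i _ => h1 i)]
    simp only [Fin.prod_univ_succ, Matrix.cons_val_zero, Matrix.cons_val_succ]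
    have h2 : Measurable fun w : Fin n → X => ∏ i : Fin n, f i.succ (w i) :=
      Finset.measurable_fun_prod _ fun i _ => (hf i.succ).comp (measurable_pi_apply i)
    simp_rw [lintegral_const_mul _ h2, ih fun i => hf i.succ]
    rw [lintegral_mul_const _ (hf 0)]

end Powers

section Decoupling

variable {X : Type*} [MeasurableSpace X] {lam : Measure X} [IsFiniteMeasure lam]
  {U : Type*} [NormedAddCommGroup U] [ProperSpace U] [MeasurableSpace U] [BorelSpace U]
  {p : ℝ≥0∞} [Fact (1 ≤ p)]

/-- The duality between a family of measures on `U^l` and a measure on `L^p`. -/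
def IsDualAt (lam : Measure X) (p : ℝ≥0∞) [Fact (1 ≤ p)] (l : ℕ)
    (ρ : (Fin l → X) → Measure (Fin l → U)) (μ : @Measure (Lp U p lam) (borel _)) : Prop :=
  ∀ g : (Fin l → X) → C₀(Fin l → U, ℝ), Integrable g (Measure.pi fun _ => lam) →
    ∫ x, ∫ ξ, g x ξ ∂(ρ x) ∂(Measure.pi fun _ => lam) =
      ∫ u, ∫ x, g x (fun i => u (x i)) ∂(Measure.pi fun _ => lam) ∂μ

lemma measurable_eval_Lp (u : Lp U p lam) (l : ℕ) :
    Measurable fun (x : Fin l → X) (i : Fin l) => u (x i) :=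
  measurable_pi_lambda _ fun i =>
    (Lp.stronglyMeasurable u).measurable.comp (measurable_pi_apply i)

/-- Convergence in L^p gives a.e. convergence along a further subsequence, hence a.e. convergence at
all l points at once. Dominated convergence applies since `w` and `h` are bounded and the measure is
finite. -/
lemma continuous_integral_eval_Lp {l : ℕ} {w : (Fin l → X) → ℝ} (hw : Measurable w) {R : ℝ}
    (hwR : ∀ x, |w x| ≤ R) (h : C₀(Fin l → U, ℝ)) :
    Continuous fun u : Lp U p lam =>
      ∫ x, w x * h (fun i => u (x i)) ∂(Measure.pi fun _ => lam) := by
  have : SecondCountableTopology U := secondCountable_of_proper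
  refine continuous_iff_seqContinuous.2 fun v u hv => ?_
  refine tendsto_of_subseq_tendsto fun ns hns => ?_
  obtain ⟨ms, -, hms⟩ :=
    (tendstoInMeasure_of_tendsto_Lp (hv.comp hns)).exists_seq_tendsto_ae
  refine ⟨ms, ?_⟩
  refine tendsto_integral_of_dominated_convergence (fun _ => R * ‖h‖) (fun n => ?_)
    (integrable_const _) (fun n => ae_of_all _ fun x => ?_) ?_
  · exact (hw.mul ((ContinuousMapClass.map_continuous h).measurable.comp
      (measurable_eval_Lp _ l))).aestronglyMeasurable
  · rw [norm_mul]
    exact mul_le_mul (hwR x) (h.toBCF.norm_coe_le_norm _) (norm_nonneg _)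
      ((abs_nonneg _).trans (hwR x))
  · have h1 : ∀ i : Fin l, ∀ᵐ x ∂(Measure.pi fun _ : Fin l => lam),
        Tendsto (fun n => (v ∘ ns) (ms n) (x i)) atTop (𝓝 (u (x i))) := fun i =>
      (Measure.tendsto_eval_ae_ae (μ := fun _ : Fin l => lam) (i := i)).eventually hms
    filter_upwards [ae_all_iff.2 h1] with x hx
    exact (((ContinuousMapClass.map_continuous h).tendsto _).comp
      (tendsto_pi_nhds.2 hx)).const_mul _

/-- This is the duality in [0,∞], tested with `w * h`. Bounded data on finite measure spaces make
all real integrals converge, and continuity in u provides measurability for the Borel σ-algebra of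
L^p. -/
lemma IsDualAt.lintegral_eq {l : ℕ} {ρ : Kernel (Fin l → X) (Fin l → U)} [IsMarkovKernel ρ]
    {μ : @Measure (Lp U p lam) (borel _)} (hμ : @IsProbabilityMeasure _ (borel _) μ)
    (hdual : IsDualAt lam p l ρ μ)
    {w : (Fin l → X) → ℝ≥0} (hw : Measurable w) {R : ℝ≥0} (hwR : ∀ x, w x ≤ R)
    {h : C₀(Fin l → U, ℝ)} (h0 : ∀ ξ, 0 ≤ h ξ) :
    ∫⁻ x, w x * ∫⁻ ξ, ENNReal.ofReal (h ξ) ∂(ρ x) ∂(Measure.pi fun _ => lam) =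
      @lintegral _ (borel _) μ fun u =>
        ∫⁻ x, w x * ENNReal.ofReal (h (fun i => u (x i))) ∂(Measure.pi fun _ => lam) := by
  let _ : MeasurableSpace (Lp U p lam) := borel _
  have : BorelSpace (Lp U p lam) := ⟨rfl⟩
  have : SecondCountableTopology U := secondCountable_of_proper
  have hwm : Measurable fun x => (w x : ℝ) := by fun_prop
  have hcont := continuous_integral_eval_Lp (p := p) (lam := lam) hwm (R := R)
    (fun x => by rw [abs_of_nonneg (NNReal.coe_nonneg _)]; exact_mod_cast hwR x) h
  have hhm : Measurable h := (ContinuousMapClass.map_continuous h).measurable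
  have hhb (ξ) : ‖h ξ‖ ≤ ‖h‖ := h.toBCF.norm_coe_le_norm ξ
  have hb (x : Fin l → X) {a : ℝ} (ha : ‖a‖ ≤ ‖h‖) : ‖(w x : ℝ) * a‖ ≤ R * ‖h‖ := by
    rw [norm_mul, Real.norm_of_nonneg (NNReal.coe_nonneg _)]
    exact mul_le_mul (by exact_mod_cast hwR x) ha (norm_nonneg _) R.2
  -- the inner integrals
  have hinner (u : Lp U p lam) :
      ∫⁻ x, w x * ENNReal.ofReal (h (fun i => u (x i))) ∂(Measure.pi fun _ => lam) =
        ENNReal.ofReal (∫ x, (w x : ℝ) * h (fun i => u (x i)) ∂(Measure.pi fun _ => lam)) := by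
    rw [ofReal_integral_eq_lintegral_ofReal]
    · refine lintegral_congr fun x => ?_
      rw [ENNReal.ofReal_mul (NNReal.coe_nonneg _), ENNReal.ofReal_coe_nnreal]
    · exact Integrable.of_bound ((hwm.mul (hhm.comp
        (measurable_eval_Lp u l))).aestronglyMeasurable) (R * ‖h‖)
        (ae_of_all _ fun x => hb x (hhb _))
    · exact ae_of_all _ fun x => mul_nonneg (NNReal.coe_nonneg _) (h0 _)
  have hFm : StronglyMeasurable fun x => ∫ ξ, h ξ ∂(ρ x) :=
    stronglyMeasurable_integral_bcf ρ h.toBCF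
  have hleft : ∫⁻ x, w x * ∫⁻ ξ, ENNReal.ofReal (h ξ) ∂(ρ x) ∂(Measure.pi fun _ => lam) =
      ENNReal.ofReal (∫ x, (w x : ℝ) * ∫ ξ, h ξ ∂(ρ x) ∂(Measure.pi fun _ => lam)) := by
    rw [ofReal_integral_eq_lintegral_ofReal]
    · refine lintegral_congr fun x => ?_
      rw [ENNReal.ofReal_mul (NNReal.coe_nonneg _), ENNReal.ofReal_coe_nnreal,
        ofReal_integral_eq_lintegral_ofReal (show Integrable h (ρ x) from h.toBCF.integrable _)
          (ae_of_all _ h0)]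
    · exact Integrable.of_bound ((hwm.stronglyMeasurable.mul hFm).aestronglyMeasurable)
        (R * ‖h‖) (ae_of_all _ fun x => hb x (norm_integral_bcf_le h.toBCF))
    · exact ae_of_all _ fun x => mul_nonneg (NNReal.coe_nonneg _) (integral_nonneg h0)
  simp_rw [hinner]
  rw [hleft, ← ofReal_integral_eq_lintegral_ofReal]
  · congr 1
    have hg : Integrable (fun x => (w x : ℝ) • h) (Measure.pi fun _ : Fin l => lam) :=
      (Integrable.of_bound hwm.aestronglyMeasurable R
        (ae_of_all _ fun x => by
          rw [Real.norm_of_nonneg (NNReal.coe_nonneg _)]; exact_mod_cast hwR x)).smul_const h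
    have := hdual _ hg
    simp only [ZeroAtInftyContinuousMap.smul_apply, smul_eq_mul, integral_const_mul] at this
    exact this
  · refine Integrable.of_bound hcont.measurable.aestronglyMeasurable
      ((Measure.pi fun _ : Fin l => lam).real univ * (R * ‖h‖)) (ae_of_all _ fun u => ?_)
    refine (norm_integral_le_of_norm_le_const (ae_of_all _ fun x => hb x (hhb _))).trans ?_
    rw [mul_comm]
  · exact ae_of_all _ fun u =>
      integral_nonneg fun x => mul_nonneg (NNReal.coe_nonneg _) (h0 _)

/-- The truncation needed to test with C₀ functions involves all the points. It is dominated by a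
truncation in the first b points only, which leaves the other factors free to be integrated out. -/
lemma tent_append_le {b m : ℕ} (n : ℕ) (ξ : Fin (b + m) → U) :
    tent n ξ ≤ tent n (ξ ∘ Fin.castAdd m) := by
  refine tsub_le_tsub_left (Real.toNNReal_le_toNNReal ?_) 1
  gcongr
  exact (pi_norm_le_iff_of_nonneg (norm_nonneg _)).2 fun i => norm_le_pi_norm ξ _

lemma lintegral_one_add_enorm_rpow_le (hp : p ≠ ∞) {M : ℝ≥0} {u : Lp U p lam} (hu : ‖u‖ ≤ M) :
    ∫⁻ x, (1 + ‖u x‖ₑ ^ p.toReal) ∂lam ≤ lam univ + (M : ℝ≥0∞) ^ p.toReal := by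
  have h0 : p ≠ 0 := (one_pos.trans_le (Fact.out : 1 ≤ p)).ne'
  rw [lintegral_add_left measurable_const, lintegral_const, one_mul]
  refine add_le_add le_rfl ?_
  have h1 : ∫⁻ x, ‖u x‖ₑ ^ p.toReal ∂lam = eLpNorm u p lam ^ p.toReal := by
    rw [eLpNorm_eq_lintegral_rpow_enorm_toReal h0 hp, ← ENNReal.rpow_mul,
      one_div_mul_cancel (ENNReal.toReal_pos h0 hp).ne', ENNReal.rpow_one]
  rw [h1]
  refine ENNReal.rpow_le_rpow ?_ ENNReal.toReal_nonneg
  rw [← ENNReal.ofReal_coe_nnreal, ← Lp.enorm_def, ← ofReal_norm]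
  exact ENNReal.ofReal_le_ofReal hu

/-- The points beyond the first `b` ones are decoupled at the price of a constant. -/
theorem IsDualAt.lintegral_decoupled_le (hp : p ≠ ∞) {b m : ℕ}
    {ρ : Kernel (Fin (b + m) → X) (Fin (b + m) → U)} [IsMarkovKernel ρ]
    {ρ₀ : Kernel (Fin b → X) (Fin b → U)} [IsMarkovKernel ρ₀]
    {μ : @Measure (Lp U p lam) (borel _)} (hμ : @IsProbabilityMeasure _ (borel _) μ)
    (h : IsDualAt lam p (b + m) ρ μ) (h₀ : IsDualAt lam p b ρ₀ μ) {M : ℝ≥0}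
    (hM : ∀ᵐ u ∂μ, ‖u‖ ≤ M) {w : (Fin b → X) → ℝ≥0∞} (hw : Measurable w)
    {H : (Fin b → U) → ℝ≥0} (hH : Continuous H) :
    ∫⁻ x, w (x ∘ Fin.castAdd m) * ∫⁻ ξ, (H (ξ ∘ Fin.castAdd m) *
        ∏ j, (1 + ‖ξ (Fin.natAdd b j)‖ₑ ^ p.toReal)) ∂(ρ x) ∂(Measure.pi fun _ => lam) ≤
      (lam univ + (M : ℝ≥0∞) ^ p.toReal) ^ m *
        ∫⁻ x, w x * ∫⁻ ξ, H ξ ∂(ρ₀ x) ∂(Measure.pi fun _ => lam) := by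
  let _ : MeasurableSpace (Lp U p lam) := borel _
  have : BorelSpace (Lp U p lam) := ⟨rfl⟩
  have : SecondCountableTopology U := secondCountable_of_proper
  set B : ℝ≥0∞ := lam univ + (M : ℝ≥0∞) ^ p.toReal with hB
  have hq : 0 ≤ p.toReal := ENNReal.toReal_nonneg
  have hBfin : B ^ m ≠ ∞ := ENNReal.pow_ne_top
    (ENNReal.add_ne_top.2 ⟨measure_ne_top _ _, ENNReal.rpow_ne_top_of_nonneg hq (by simp)⟩)
  -- Duality is available only for bounded weights and functions vanishing at infinity. The
  -- inequality is proved with `w` cut at height n and a tent factor, uniformly in n, and extended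
  -- by monotone convergence.
  let w' : ℕ → (Fin b → X) → ℝ≥0 := fun n x => (min (w x) n).toNNReal
  have hw'c (n : ℕ) (x) : (w' n x : ℝ≥0∞) = min (w x) n :=
    ENNReal.coe_toNNReal (ne_top_of_le_ne_top (ENNReal.natCast_ne_top n) (min_le_right _ _))
  have hw'm (n : ℕ) : Measurable (w' n) := (hw.min measurable_const).ennreal_toNNReal
  have hw'b (n : ℕ) (x) : w' n x ≤ n := by
    have : (w' n x : ℝ≥0∞) ≤ n := (hw'c n x).le.trans (min_le_right _ _)
    exact_mod_cast this
  let P : (Fin (b + m) → U) → ℝ≥0 := fun ξ =>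
    H (ξ ∘ Fin.castAdd m) * ∏ j, (1 + ‖ξ (Fin.natAdd b j)‖₊ ^ p.toReal)
  have hcast : Continuous fun ξ : Fin (b + m) → U => ξ ∘ Fin.castAdd m :=
    continuous_pi fun i => continuous_apply _
  have hP : Continuous P := by
    have h1 := NNReal.continuous_rpow_const hq
    refine (hH.comp hcast).mul (continuous_finsetProd _ fun j _ => ?_)
    exact continuous_const.add (h1.comp (continuous_nnnorm.comp (continuous_apply _)))
  have hPe (ξ : Fin (b + m) → U) : (P ξ : ℝ≥0∞) = H (ξ ∘ Fin.castAdd m) *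
      ∏ j, (1 + ‖ξ (Fin.natAdd b j)‖ₑ ^ p.toReal) := by
    simp only [P, ENNReal.coe_mul, ENNReal.ofNNReal_finsetProd, ENNReal.coe_add, ENNReal.coe_one,
      coe_nnnorm_rpow hq]
  have hPc : Continuous fun ξ => (P ξ : ℝ) := NNReal.continuous_coe.comp hP
  have hHc : Continuous fun ξ => (H ξ : ℝ) := NNReal.continuous_coe.comp hH
  -- the truncated inequality
  have key (n : ℕ) : ∫⁻ x, w' n (x ∘ Fin.castAdd m) * ∫⁻ ξ, ((tent n ξ * P ξ : ℝ≥0) : ℝ≥0∞)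
        ∂(ρ x) ∂(Measure.pi fun _ => lam) ≤
      B ^ m * ∫⁻ x, w x * ∫⁻ ξ, H ξ ∂(ρ₀ x) ∂(Measure.pi fun _ => lam) := by
    have e1 := h.lintegral_eq hμ (w := fun x => w' n (x ∘ Fin.castAdd m))
      ((hw'm n).comp (measurable_comp_index _)) (fun x => hw'b n _)
      (h := tentMul n (fun ξ => (P ξ : ℝ)) hPc)
      (fun ξ => mul_nonneg (NNReal.coe_nonneg _) (NNReal.coe_nonneg _))
    have e2 := h₀.lintegral_eq hμ (hw'm n) (hw'b n)
      (h := tentMul n (fun ξ => (H ξ : ℝ)) hHc)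
      (fun ξ => mul_nonneg (NNReal.coe_nonneg _) (NNReal.coe_nonneg _))
    simp only [tentMul_apply, ← NNReal.coe_mul, ENNReal.ofReal_coe_nnreal] at e1 e2
    rw [e1]
    calc _ ≤ ∫⁻ u, B ^ m * ∫⁻ x, w' n x * (tent n (fun i => u (x i)) *
            H (fun i => u (x i)) : ℝ≥0) ∂(Measure.pi fun _ => lam) ∂μ := by
          refine lintegral_mono_ae ?_
          filter_upwards [hM] with u hu
          have hum := (Lp.stronglyMeasurable u).measurable
          have hev := measurable_eval_Lp u b
          have m1 : Measurable fun x : Fin b → X => (w' n x : ℝ≥0∞) *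
              (tent n (fun i => u (x i)) * H (fun i => u (x i)) : ℝ≥0) :=
            (hw'm n).coe_nnreal_ennreal.mul
              ((((continuous_tent n).measurable.comp hev).mul
                (hH.measurable.comp hev)).coe_nnreal_ennreal)
          have m2 : Measurable fun x => 1 + ‖u x‖ₑ ^ p.toReal := by fun_prop
          have m3 : Measurable fun y : Fin m → X => ∏ j, (1 + ‖u (y j)‖ₑ ^ p.toReal) :=
            Finset.measurable_fun_prod _ fun j _ => m2.comp (measurable_pi_apply j)
          -- For a fixed function u the integrand is a product over the points, so Tonelli's theorem
          -- factors it. Each of the last m factors is at most `B` because ‖u‖ ≤ M.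
          calc _ ≤ ∫⁻ x : Fin (b + m) → X, (w' n (x ∘ Fin.castAdd m) *
                (tent n (fun i => u ((x ∘ Fin.castAdd m) i)) *
                  H (fun i => u ((x ∘ Fin.castAdd m) i)) : ℝ≥0)) *
                ∏ j, (1 + ‖u (x (Fin.natAdd b j))‖ₑ ^ p.toReal) ∂(Measure.pi fun _ => lam) := by
                refine lintegral_mono fun x => ?_
                rw [ENNReal.coe_mul, hPe, mul_assoc, ENNReal.coe_mul, mul_assoc]
                refine mul_le_mul_right (mul_le_mul_left ?_ _) _
                exact ENNReal.coe_le_coe.2 (tent_append_le n fun i => u (x i))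
            _ = (∫⁻ x, w' n x * (tent n (fun i => u (x i)) *
                  H (fun i => u (x i)) : ℝ≥0) ∂(Measure.pi fun _ => lam)) *
                ∫⁻ y : Fin m → X, ∏ j, (1 + ‖u (y j)‖ₑ ^ p.toReal)
                  ∂(Measure.pi fun _ => lam) := by
                rw [lintegral_append]
                · have ea (x : Fin b → X) (y : Fin m → X) :
                      Fin.append x y ∘ Fin.castAdd m = x := by
                    funext i; exact Fin.append_left x y i
                  simp only [ea, Fin.append_right]
                  simp_rw [lintegral_const_mul _ m3]
                  rw [lintegral_mul_const _ m1]
                · refine (m1.comp (measurable_comp_index (Fin.castAdd m))).mul ?_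
                  exact Finset.measurable_fun_prod _ fun j _ =>
                    m2.comp (measurable_pi_apply (Fin.natAdd b j))
            _ ≤ _ := by
                rw [mul_comm, lintegral_prod_pi (f := fun _ x => 1 + ‖u x‖ₑ ^ p.toReal)
                  fun _ => m2, Finset.prod_const, Finset.card_univ, Fintype.card_fin]
                gcongr
                exact lintegral_one_add_enorm_rpow_le hp hu
      _ = B ^ m * ∫⁻ x, w' n x * ∫⁻ ξ, ((tent n ξ * H ξ : ℝ≥0) : ℝ≥0∞) ∂(ρ₀ x)
            ∂(Measure.pi fun _ => lam) := by
          rw [lintegral_const_mul' _ _ hBfin, e2]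
      _ ≤ _ := by
          gcongr with x ξ
          · rw [hw'c]; exact min_le_left _ _
          · exact mul_le_of_le_one_left' (tent_le_one n _)
  -- passage to the limit
  have mP (n : ℕ) : Measurable fun ξ => ((tent n ξ * P ξ : ℝ≥0) : ℝ≥0∞) :=
    (((continuous_tent n).mul hP).measurable).coe_nnreal_ennreal
  have mI (n : ℕ) : Measurable fun x => (w' n (x ∘ Fin.castAdd m) : ℝ≥0∞) *
      ∫⁻ ξ, ((tent n ξ * P ξ : ℝ≥0) : ℝ≥0∞) ∂(ρ x) :=
    ((hw'm n).comp (measurable_comp_index _)).coe_nnreal_ennreal.mul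
      (mP n).lintegral_kernel
  refine le_trans ?_ (iSup_le key)
  rw [← lintegral_iSup mI]
  · refine lintegral_mono fun x => ?_
    have h1 : ∫⁻ ξ, (P ξ : ℝ≥0∞) ∂(ρ x) =
        ⨆ n, ∫⁻ ξ, ((tent n ξ * P ξ : ℝ≥0) : ℝ≥0∞) ∂(ρ x) := by
      rw [← lintegral_iSup mP fun n n' hn ξ =>
        ENNReal.coe_le_coe.2 (mul_le_mul_left (tent_mono hn ξ) _)]
      refine lintegral_congr fun ξ => ?_
      refine tendsto_nhds_unique ?_ (tendsto_atTop_iSup fun n n' hn =>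
        ENNReal.coe_le_coe.2 (mul_le_mul_left (tent_mono hn ξ) _))
      have := (tendsto_tent ξ).mul_const (P ξ)
      rw [one_mul] at this
      exact ENNReal.tendsto_coe.2 this
    have h2 : w (x ∘ Fin.castAdd m) = ⨆ n : ℕ, (w' n (x ∘ Fin.castAdd m) : ℝ≥0∞) := by
      simp_rw [hw'c]
      rw [← inf_iSup_eq, ENNReal.iSup_natCast, inf_top_eq]
    simp_rw [← hPe]
    rw [h1, h2, ENNReal.iSup_mul]
    refine iSup_le fun i => ?_
    rw [ENNReal.mul_iSup]
    -- The product of two monotone suprema is reached along the diagonal.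
    refine iSup_le fun j => le_iSup_of_le (max i j) (mul_le_mul' ?_ (lintegral_mono fun ξ => ?_))
    · rw [hw'c, hw'c]
      exact min_le_min le_rfl (by exact_mod_cast le_max_left i j)
    · exact ENNReal.coe_le_coe.2 (mul_le_mul_left (tent_mono (le_max_right i j) ξ) _)
  · intro n n' hn x
    refine mul_le_mul' ?_ (lintegral_mono fun ξ => ?_)
    · rw [hw'c, hw'c]
      exact min_le_min le_rfl (by exact_mod_cast hn)
    · exact ENNReal.coe_le_coe.2 (mul_le_mul_left (tent_mono hn ξ) _)

end Decoupling

/-! ### Observables do not depend on the space variables -/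

section Averaging

variable {X : Type*} [MeasurableSpace X]

/-- The constant is the mass of the forgotten factors, finite because `lam` is finite. This gives L¹
bounds, beyond preservation of null sets. -/
lemma exists_map_comp_injective_eq (lam : Measure X) [IsFiniteMeasure lam] {j k : ℕ}
    {ι : Fin j → Fin k} (hι : Function.Injective ι) :
    ∃ c : ℝ≥0, (Measure.pi fun _ : Fin k => lam).map (fun x => x ∘ ι) =
      (c : ℝ≥0∞) • Measure.pi fun _ : Fin j => lam := by
  classical
  let P : Fin k → Prop := fun i => i ∈ range ι
  let : Fintype {i // P i} := Subtype.fintype P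
  let e : Fin j ≃ {i // P i} := Equiv.ofInjective ι hι
  have h1 := measurePreserving_piEquivPiSubtypeProd (fun _ : Fin k => lam) P
  have h3 := (measurePreserving_piCongrLeft (fun _ : {i // P i} => lam) e).symm
  refine ⟨((Measure.pi fun _ : {i // ¬ P i} => lam) univ).toNNReal, ?_⟩
  rw [ENNReal.coe_toNNReal (measure_ne_top _ _), ← h3.map_eq, ← Measure.map_smul,
    ← Measure.map_fst_prod, ← h1.map_eq, Measure.map_map measurable_fst h1.measurable,
    Measure.map_map h3.measurable (measurable_fst.comp h1.measurable)]
  rfl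

/-- A sum of integrable functions of some of the variables is bounded at some point, by a constant
depending only on the bounds of the integrals. -/
lemma exists_forall_exists_sum_le {lam : Measure X} [IsFiniteMeasure lam] (hlam : lam ≠ 0)
    {S : Type*} [Fintype S] {k : ℕ} {j : S → ℕ} (ι : ∀ s, Fin (j s) → Fin k)
    (hι : ∀ s, Function.Injective (ι s)) (C : ℝ≥0) :
    ∃ C' : ℝ≥0, ∀ φ : ∀ s, (Fin (j s) → X) → ℝ,
      (∀ s, AEStronglyMeasurable (φ s) (Measure.pi fun _ => lam)) →
      (∀ s, ∫⁻ x, ENNReal.ofReal (φ s x) ∂(Measure.pi fun _ => lam) ≤ C) →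
      ∀ A : Set (Fin k → X), (∀ᵐ x ∂(Measure.pi fun _ => lam), x ∈ A) →
      ∃ x ∈ A, ∑ s, φ s (x ∘ ι s) ≤ C' := by
  choose c hc using fun s => exists_map_comp_injective_eq lam (hι s)
  set π : Measure (Fin k → X) := Measure.pi fun _ => lam with hπ
  have hπ0 : π ≠ 0 := by
    rw [← Measure.measure_univ_ne_zero, hπ, Measure.pi_univ]
    exact Finset.prod_ne_zero_iff.2 fun _ _ => Measure.measure_univ_ne_zero.2 hlam
  have hfin : (∑ s, c s * C : ℝ≥0) / π univ ≠ ∞ :=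
    ENNReal.div_ne_top ENNReal.coe_ne_top (Measure.measure_univ_ne_zero.2 hπ0)
  refine ⟨((∑ s, c s * C : ℝ≥0) / π univ).toNNReal, fun φ hφ hφC A hA => ?_⟩
  have hac (s : S) : π.map (fun x => x ∘ ι s) ≪ Measure.pi fun _ => lam := by
    rw [hc]; exact Measure.smul_absolutelyContinuous
  have hm (s : S) : AEMeasurable (fun x => ENNReal.ofReal (φ s (x ∘ ι s))) π :=
    ((hφ s).aemeasurable.ennreal_ofReal.mono_ac (hac s)).comp_measurable
      (measurable_comp_index _)
  -- A function does not exceed its average at some point outside any given null set. The average is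
  -- bounded by quantities that do not depend on φ.
  obtain ⟨x, hxA, hx⟩ := exists_notMem_null_le_laverage hπ0
    (Finset.aemeasurable_fun_sum Finset.univ fun s _ => hm s) hA
  refine ⟨x, not_not.1 hxA, ?_⟩
  rw [laverage_eq] at hx
  have h1 : ∫⁻ x, ∑ s, ENNReal.ofReal (φ s (x ∘ ι s)) ∂π ≤ (∑ s, c s * C : ℝ≥0) := by
    rw [lintegral_finsetSum' _ fun s _ => hm s, ENNReal.ofNNReal_finsetSum]
    refine Finset.sum_le_sum fun s _ => ?_
    rw [← lintegral_map' ((hφ s).aemeasurable.ennreal_ofReal.mono_ac (hac s))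
      (measurable_comp_index (ι s)).aemeasurable, hc, lintegral_smul_measure, ENNReal.coe_mul]
    exact mul_le_mul_right (hφC s) _
  have h2 := hx.trans (ENNReal.div_le_div_right h1 _)
  rw [← ENNReal.coe_toNNReal hfin] at h2
  have h3 : ENNReal.ofReal (∑ s, φ s (x ∘ ι s)) ≤
      (((∑ s, c s * C : ℝ≥0) / π univ).toNNReal : ℝ≥0∞) := by
    refine le_trans ?_ h2
    have : ∑ s, φ s (x ∘ ι s) ≤ ∑ s, (ENNReal.ofReal (φ s (x ∘ ι s))).toReal :=
      Finset.sum_le_sum fun s _ => by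
        rw [ENNReal.toReal_ofReal']; exact le_max_left _ _
    refine (ENNReal.ofReal_le_ofReal this).trans ?_
    rw [← ENNReal.toReal_sum fun s _ => ENNReal.ofReal_ne_top]
    exact ENNReal.ofReal_toReal_le
  exact (ENNReal.ofReal_le_ofReal_iff (NNReal.coe_nonneg _)).1 (by
    rwa [ENNReal.ofReal_coe_nnreal])

end Averaging

/-! ### Profiles of observables as functions of time and state -/

section Observables

variable {d N : ℕ} {p : ℝ≥0∞} {D : Set (EuclideanSpace ℝ (Fin d))} {T : EReal}

lemma prod_rpow_le_prod_one_add {U : Type*} [NormedAddCommGroup U] {n : ℕ} (A : Finset (Fin n))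
    (ξ : Fin n → U) (q : ℝ) : ∏ i ∈ A, ‖ξ i‖ ^ q ≤ ∏ i, (1 + ‖ξ i‖ ^ q) := by
  have h0 (i : Fin n) : 0 ≤ ‖ξ i‖ ^ q := Real.rpow_nonneg (norm_nonneg _) _
  calc ∏ i ∈ A, ‖ξ i‖ ^ q ≤ ∏ i ∈ A, (1 + ‖ξ i‖ ^ q) :=
        Finset.prod_le_prod (fun i _ => h0 i) fun i _ => by linarith
    _ ≤ ∏ i, (1 + ‖ξ i‖ ^ q) := by
        refine Finset.prod_le_prod_of_subset_of_one_le (Finset.subset_univ _)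
          (fun i _ => by linarith [h0 i]) fun i _ _ => by linarith [h0 i]

/-- The functions in `𝓗^{k,p}` grow at most like `∏ (1 + |ξ_i|^p)`, up to functions of `x`. -/
lemma MemH.exists_bound {k : ℕ} {g : ℝ → (Fin k → EuclideanSpace ℝ (Fin d)) →
      (Fin k → EuclideanSpace ℝ (Fin N)) → ℝ} (hg : MemH p D T k g) :
    ∃ (C : ℝ≥0) (φ : ∀ s : Finset (Fin k), ℝ → (Fin sᶜ.card → EuclideanSpace ℝ (Fin d)) → ℝ),
      ∀ᵐ t ∂(cmTimeMeasure T),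
        (∀ s, AEStronglyMeasurable (φ s t) (Measure.pi fun _ => volume.restrict D)) ∧
        (∀ s, ∫⁻ x, ENNReal.ofReal (φ s t x) ∂(Measure.pi fun _ => volume.restrict D) ≤ C) ∧
        (∀ s : Finset (Fin k), ∀ x ∈ cmPower D sᶜ.card, 0 ≤ φ s t x) ∧
        ∀ x ∈ cmPower D k, ∀ ξ, |g t x ξ| ≤
          (∑ s, φ s t (x ∘ sᶜ.orderEmbOfFin rfl)) * ∏ i, (1 + ‖ξ i‖ ^ p.toReal) := by
  obtain ⟨-, φ, hφ, hbd⟩ := hg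
  have hcard (s : Finset (Fin k)) : sᶜ.card ≤ k := by
    simpa using Finset.card_le_univ sᶜ
  choose C hC using fun s : Finset (Fin k) => (hφ _ (hcard s)).bounded
  refine ⟨∑ s, C s, fun s => φ sᶜ.card, ?_⟩
  have hmeas : ∀ᵐ t ∂(cmTimeMeasure T), ∀ s : Finset (Fin k),
      AEStronglyMeasurable (φ sᶜ.card t) (Measure.pi fun _ => volume.restrict D) := by
    refine ae_all_iff.2 fun s => ?_
    have := (hφ _ (hcard s)).measurable
    rw [cmSpaceTimeMeasure_eq] at this
    exact this.prodMk_left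
  filter_upwards [hbd, hmeas, ae_all_iff.2 hC, ae_mem_cmTime] with t h1 h2 h3 h4
  refine ⟨h2, fun s => ?_, fun s x hx => (hφ _ (hcard s)).nonneg t h4 x hx, fun x hx ξ => ?_⟩
  · have := h3 s
    rw [cmSpaceMeasure_eq_pi] at this
    refine this.trans (ENNReal.coe_le_coe.2 ?_)
    exact Finset.single_le_sum (f := C) (fun _ _ => zero_le) (Finset.mem_univ s)
  · refine (h1 x hx ξ).trans ?_
    rw [Finset.sum_mul]
    refine Finset.sum_le_sum fun s _ => ?_
    exact mul_le_mul_of_nonneg_left (prod_rpow_le_prod_one_add _ _ _)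
      ((hφ _ (hcard s)).nonneg t h4 _ fun i _ => hx _ (mem_univ _))

/-- An observable satisfying the local Lipschitz condition does not depend on the space
variables. It is represented by a Carathéodory function of time and state. -/
theorem MemHOne.exists_profile {k : ℕ} {g : ℝ → (Fin (k + 1) → EuclideanSpace ℝ (Fin d)) →
      (Fin (k + 1) → EuclideanSpace ℝ (Fin N)) → ℝ} (hg : MemHOne p D T k g) (hDopen : IsOpen D)
    (hDconn : IsConnected D) (hDb : Bornology.IsBounded D) :
    ∃ (G : ℝ → (Fin (k + 1) → EuclideanSpace ℝ (Fin N)) → ℝ) (C : ℝ≥0),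
      Measurable (Function.uncurry G) ∧ (∀ t, Continuous (G t)) ∧
      (∀ t ξ, |G t ξ| ≤ C * ∏ i, (1 + ‖ξ i‖ ^ p.toReal)) ∧
      (∀ t ξ ζ, |G t ζ - G t ξ| ≤ C * ∑ i, ‖ζ i - ξ i‖ * max ‖ξ i‖ ‖ζ i‖ ^ (p.toReal - 1) *
        ∏ j, (1 + ‖ξ (i.succAbove j)‖ ^ p.toReal)) ∧
      ∀ᵐ t ∂(cmTimeMeasure T), ∀ x ∈ cmPower D (k + 1), ∀ ξ, g t x ξ = G t ξ := by
  set lam : Measure (EuclideanSpace ℝ (Fin d)) := volume.restrict D with hlam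
  have : IsFiniteMeasure lam := ⟨by
    rw [hlam, Measure.restrict_apply_univ]; exact hDb.measure_lt_top⟩
  have hlam0 : lam ≠ 0 := by
    rw [Ne, hlam, Measure.restrict_eq_zero]
    exact (hDopen.measure_pos _ hDconn.nonempty).ne'
  obtain ⟨hgH, r, ψ, h, hr, -, hψ0, ⟨Cψ, hψ⟩, hhH, hh0, hlip⟩ := hg
  obtain ⟨C₁, φ₁, hφ₁⟩ := hgH.exists_bound
  obtain ⟨C₂, φ₂, hφ₂⟩ := hhH.exists_bound
  obtain ⟨C₁', hC₁'⟩ := exists_forall_exists_sum_le hlam0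
    (fun s : Finset (Fin (k + 1)) => ⇑(sᶜ.orderEmbOfFin rfl))
    (fun s => (sᶜ.orderEmbOfFin rfl).injective) C₁
  obtain ⟨C₂', hC₂'⟩ := exists_forall_exists_sum_le hlam0
    (fun s : Fin (k + 1) × Finset (Fin k) => s.1.succAbove ∘ ⇑(s.2ᶜ.orderEmbOfFin rfl))
    (fun s => Fin.succAbove_right_injective.comp (s.2ᶜ.orderEmbOfFin rfl).injective) C₂
  have hmemD (n : ℕ) : ∀ᵐ x ∂(Measure.pi fun _ : Fin n => lam), x ∈ cmPower D n := by
    have := ae_mem_cmPower hDopen.measurableSet n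
    rwa [cmSpaceMeasure_eq_pi] at this
  obtain ⟨y₀, hy₀⟩ := hDconn.nonempty
  let x₀ : Fin (k + 1) → EuclideanSpace ℝ (Fin d) := fun _ => y₀
  have hx₀ : x₀ ∈ cmPower D (k + 1) := fun _ _ => hy₀
  have hπ0 : (Measure.pi fun _ : Fin (k + 1) => lam) ≠ 0 := by
    rw [← Measure.measure_univ_ne_zero, Measure.pi_univ]
    exact Finset.prod_ne_zero_iff.2 fun _ _ => Measure.measure_univ_ne_zero.2 hlam0
  have : NeBot (ae (Measure.pi fun _ : Fin (k + 1) => lam)) := ae_neBot.2 hπ0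
  -- independence of the space variables
  have hconst : ∀ᵐ t ∂(cmTimeMeasure T), ∀ x ∈ cmPower D (k + 1), ∀ y ∈ cmPower D (k + 1),
      g t x = g t y := by
    filter_upwards [hlip] with t ht x hx y hy
    have hpre : IsPreconnected (cmPower D (k + 1)) :=
      isPreconnected_univ_pi fun _ => hDconn.isPreconnected
    refine hpre.induction₂ (fun x y => g t x = g t y) (fun x hx => ?_)
      (fun _ _ _ _ _ _ h1 h2 => h1.trans h2) (fun _ _ _ _ h => h.symm) hx hy
    filter_upwards [self_mem_nhdsWithin, nhdsWithin_le_nhds (Metric.ball_mem_nhds x hr)]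
      with y hy hyx
    -- With equal states the right-hand side of the Lipschitz condition vanishes, so g is locally
    -- constant in x.
    funext ζ
    have := ht x hx y hy hyx ζ ζ
    simp only [sub_self, norm_zero, zero_mul, Finset.sum_const_zero, mul_zero] at this
    exact sub_eq_zero.1 (abs_nonpos_iff.1 this)
  let C : ℝ := max C₁' (max Cψ 0 * C₂')
  have hCψ : 0 ≤ max Cψ 0 := le_max_right _ _
  have hC0 : 0 ≤ C := le_max_of_le_left C₁'.2
  -- the bounds
  have hgood : ∀ᵐ t ∂(cmTimeMeasure T), Continuous (g t x₀) ∧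
      (∀ ξ, |g t x₀ ξ| ≤ C * ∏ i, (1 + ‖ξ i‖ ^ p.toReal)) ∧
      (∀ ξ ζ, |g t x₀ ζ - g t x₀ ξ| ≤ C * ∑ i, ‖ζ i - ξ i‖ *
        max ‖ξ i‖ ‖ζ i‖ ^ (p.toReal - 1) * ∏ j, (1 + ‖ξ (i.succAbove j)‖ ^ p.toReal)) ∧
      ∀ x ∈ cmPower D (k + 1), ∀ ξ, g t x ξ = g t x₀ ξ := by
    have hcont := hgH.1.continuous
    rw [cmSpaceTimeMeasure_eq] at hcont
    filter_upwards [hconst, ae_ae_of_ae_base hcont, hφ₁, hφ₂, hlip, ae_mem_cmTime, hψ]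
      with t hcst hct h1 h2 hl htT hψt
    have hnn (ξ : Fin (k + 1) → EuclideanSpace ℝ (Fin N)) (s : Fin k → Fin (k + 1)) :
        0 ≤ ∏ j, (1 + ‖ξ (s j)‖ ^ p.toReal) :=
      Finset.prod_nonneg fun j _ => by positivity
    refine ⟨?_, fun ξ => ?_, fun ξ ζ => ?_, fun x hx ξ => by rw [hcst x hx x₀ hx₀]⟩
    · obtain ⟨x, hx1, hx2⟩ := (hct.and (hmemD (k + 1))).exists
      rwa [hcst x₀ hx₀ x hx2]
    -- As g does not depend on x, it is evaluated at a point where the sum of the coefficients is at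
    -- most its average. This replaces integrable coefficients by a constant that is uniform in t.
    · obtain ⟨x, hxD, hx⟩ := hC₁' (fun s => φ₁ s t) h1.1 h1.2.1 _ (hmemD _)
      rw [hcst x₀ hx₀ x hxD]
      refine (h1.2.2.2 x hxD ξ).trans (mul_le_mul_of_nonneg_right
        (hx.trans (le_max_left _ _)) ?_)
      exact Finset.prod_nonneg fun j _ => by positivity
    -- A single point has to serve for every deleted index i, so the sum to be averaged runs over
    -- pairs of an index and a subset.
    · obtain ⟨x, hxD, hx⟩ := hC₂' (fun s => φ₂ s.2 t) (fun s => h2.1 s.2) (fun s => h2.2.1 s.2)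
        _ (hmemD _)
      have hxi (i : Fin (k + 1)) : i.removeNth x ∈ cmPower D k := fun j _ => hxD _ (mem_univ _)
      have hsum (i : Fin (k + 1)) :
          ∑ s, φ₂ s t (i.removeNth x ∘ sᶜ.orderEmbOfFin rfl) ≤ C₂' := by
        refine le_trans ?_ hx
        rw [Fintype.sum_prod_type]
        refine Finset.single_le_sum (f := fun i : Fin (k + 1) => ∑ s : Finset (Fin k),
          φ₂ s t (x ∘ i.succAbove ∘ sᶜ.orderEmbOfFin rfl)) (fun i' _ => ?_) (Finset.mem_univ i)
        exact Finset.sum_nonneg fun s _ => h2.2.2.1 s _ fun j _ => hxD _ (mem_univ _)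
      rw [hcst x₀ hx₀ x hxD]
      refine (hl x hxD x hxD (by simpa using hr) ξ ζ).trans ?_
      have hCC : max Cψ 0 * C₂' ≤ C := le_max_right _ _
      have hS0 (i : Fin (k + 1)) : 0 ≤ ‖ζ i - ξ i‖ * max ‖ξ i‖ ‖ζ i‖ ^ (p.toReal - 1) := by
        positivity
      calc ψ t * ∑ i : Fin (k + 1), ‖ζ i - ξ i‖ * max ‖ξ i‖ ‖ζ i‖ ^ (p.toReal - 1) *
              h t (i.removeNth x) (i.removeNth ξ)
          ≤ max Cψ 0 * ∑ i : Fin (k + 1), ‖ζ i - ξ i‖ * max ‖ξ i‖ ‖ζ i‖ ^ (p.toReal - 1) *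
              (C₂' * ∏ j, (1 + ‖ξ (i.succAbove j)‖ ^ p.toReal)) := by
            refine mul_le_mul (hψt.trans (le_max_left _ _)) ?_ ?_ hCψ
            · refine Finset.sum_le_sum fun i _ => mul_le_mul_of_nonneg_left ?_ (hS0 i)
              refine (le_abs_self _).trans ((h2.2.2.2 _ (hxi i) _).trans ?_)
              exact mul_le_mul_of_nonneg_right (hsum i) (hnn ξ i.succAbove)
            · exact Finset.sum_nonneg fun i _ => mul_nonneg (hS0 i) (hh0 t htT _ (hxi i) _)
        _ = (max Cψ 0 * C₂') * ∑ i : Fin (k + 1), ‖ζ i - ξ i‖ *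
              max ‖ξ i‖ ‖ζ i‖ ^ (p.toReal - 1) *
              ∏ j, (1 + ‖ξ (i.succAbove j)‖ ^ p.toReal) := by
            rw [mul_assoc, Finset.mul_sum (a := (C₂' : ℝ))]
            congr 1
            exact Finset.sum_congr rfl fun i _ => by ring
        _ ≤ _ := by
            refine mul_le_mul_of_nonneg_right hCC ?_
            exact Finset.sum_nonneg fun i _ => mul_nonneg (hS0 i) (hnn ξ i.succAbove)
  -- measurability
  have hmeas (ξ) : AEStronglyMeasurable (fun t => g t x₀ ξ) (cmTimeMeasure T) := by
    have := hgH.1.measurable ξ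
    rw [cmSpaceTimeMeasure_eq] at this
    obtain ⟨x, hx1, hx2⟩ := (this.prodMk_right.and (hmemD (k + 1))).exists
    refine hx1.congr ?_
    filter_upwards [hconst] with t ht
    exact congrFun (ht x hx2 x₀ hx₀) ξ
  let e := TopologicalSpace.denseSeq (Fin (k + 1) → EuclideanSpace ℝ (Fin N))
  have hall := hgood.and (ae_all_iff.2 fun n => (hmeas (e n)).ae_eq_mk)
  -- The discarded times also include those where g differs from its measurable versions at a dense
  -- sequence of states. Setting G to zero there makes it measurable in t and its bounds valid for
  -- all t.
  obtain ⟨bad, hsub, hbadm, hbad0⟩ := exists_measurable_superset_of_null (ae_iff.1 hall)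
  have hbad {t} (ht : t ∉ bad) := not_not.1 fun h => ht (hsub h)
  let G : ℝ → (Fin (k + 1) → EuclideanSpace ℝ (Fin N)) → ℝ := fun t ξ =>
    badᶜ.indicator (fun t => g t x₀ ξ) t
  have hGin {t} (ht : t ∈ bad) : G t = 0 := by
    funext ξ; exact indicator_of_notMem (not_not.2 ht) _
  have hGout {t} (ht : t ∉ bad) : G t = g t x₀ := by
    funext ξ; exact indicator_of_mem (s := badᶜ) ht _
  have hGc (t : ℝ) : Continuous (G t) := by
    by_cases ht : t ∈ bad
    · rw [hGin ht]; exact continuous_zero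
    · rw [hGout ht]; exact (hbad ht).1.1
  have hGm (ξ) : Measurable fun t => G t ξ := by
    have hden := TopologicalSpace.denseRange_denseSeq
      (Fin (k + 1) → EuclideanSpace ℝ (Fin N))
    have hn (n : ℕ) : Measurable fun t => G t (e n) := by
      have : (fun t => G t (e n)) = badᶜ.indicator ((hmeas (e n)).mk _) := by
        funext t
        by_cases ht : t ∈ bad
        · rw [hGin ht, indicator_of_notMem (not_not.2 ht)]; rfl
        · rw [hGout ht, indicator_of_mem (s := badᶜ) ht]; exact (hbad ht).2 n
      rw [this]
      exact (hmeas (e n)).stronglyMeasurable_mk.measurable.indicator hbadm.compl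
    have hclos : ξ ∈ closure (range e) := hden ξ
    obtain ⟨v, hv, hlim⟩ := mem_closure_iff_seq_limit.1 hclos
    choose m hm using hv
    refine measurable_of_tendsto_metrizable (f := fun n t => G t (e (m n))) (fun n => hn (m n)) ?_
    rw [tendsto_pi_nhds]
    intro t
    simp only [hm]
    exact ((hGc t).tendsto ξ).comp hlim
  refine ⟨G, ⟨C, hC0⟩, ?_, hGc, fun t ξ => ?_, fun t ξ ζ => ?_, ?_⟩
  · have := measurable_uncurry_of_continuous_of_measurable (u := fun ξ t => G t ξ) hGc hGm
    exact this.comp measurable_swap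
  · by_cases ht : t ∈ bad
    · rw [hGin ht, Pi.zero_apply, abs_zero]
      exact mul_nonneg hC0 (Finset.prod_nonneg fun j _ => by positivity)
    · rw [hGout ht]; exact (hbad ht).1.2.1 ξ
  · by_cases ht : t ∈ bad
    · rw [hGin ht, Pi.zero_apply, Pi.zero_apply, sub_zero, abs_zero]
      exact mul_nonneg hC0 (Finset.sum_nonneg fun i _ =>
        mul_nonneg (by positivity) (Finset.prod_nonneg fun j _ => by positivity))
    · rw [hGout ht]; exact (hbad ht).1.2.2.1 ξ ζ
  · have : ∀ᵐ t ∂(cmTimeMeasure T), t ∉ bad := by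
      rw [ae_iff]; simpa using hbad0
    filter_upwards [this] with t ht x hx ξ
    rw [hGout ht]
    exact (hbad ht).1.2.2.2 x hx ξ

end Observables

/-! ### Stable convergence tested with Carathéodory functions -/

section Caratheodory

/-- A map into the continuous functions on a compact space is strongly measurable if it is
pointwise measurable. -/
lemma stronglyMeasurable_continuousMap {A K : Type*} [MeasurableSpace A] [MetricSpace K]
    [CompactSpace K] {f : A → C(K, ℝ)} (hf : ∀ x, Measurable fun a => f a x) :
    StronglyMeasurable f := by
  let _ : MeasurableSpace C(K, ℝ) := borel _
  have : BorelSpace C(K, ℝ) := ⟨rfl⟩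
  refine Measurable.stronglyMeasurable ?_
  -- The sets of functions mapping a compact L into an open O form a subbasis of the compact-open
  -- topology. By compactness, membership means that the distance from the values on L to the
  -- complement of O has a positive infimum, which a countable dense subset of L detects.
  have hgen := borel_eq_generateFrom_of_subbasis (α := C(K, ℝ)) (s := _) rfl
  refine @measurable_generateFrom _ _ _ _ _ ?_ |>.mono le_rfl hgen.le
  rintro _ ⟨L, hL, O, (hO : IsOpen O), rfl⟩
  rcases L.eq_empty_or_nonempty with rfl | hLne
  · have : f ⁻¹' {g | MapsTo g ∅ O} = univ := eq_univ_of_forall fun a => mapsTo_empty _ _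
    rw [this]
    exact MeasurableSet.univ
  have : Nonempty L := hLne.to_subtype
  let e := TopologicalSpace.denseSeq L
  have hcont (g : C(K, ℝ)) : Continuous fun x => Metric.infEDist (g x) Oᶜ :=
    Metric.continuous_infEDist.comp g.continuous
  have key : f ⁻¹' {g | MapsTo g L O} =
      {a | 0 < ⨅ n, Metric.infEDist (f a (e n)) Oᶜ} := by
    ext a
    constructor
    · intro h
      obtain ⟨x, hxL, hx⟩ := IsCompact.exists_isMinOn hL hLne (hcont (f a)).continuousOn
      have h1 : 0 < Metric.infEDist (f a x) Oᶜ := by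
        rw [pos_iff_ne_zero]
        intro h2
        rcases Oᶜ.eq_empty_or_nonempty with h3 | h3
        · rw [h3, Metric.infEDist_empty] at h2
          exact ENNReal.top_ne_zero h2
        · exact (Metric.mem_iff_infEDist_zero_of_closed hO.isClosed_compl).2 h2 (h hxL)
      exact h1.trans_le (le_iInf fun n => hx (e n).2)
    · intro h x hx
      by_contra hxO
      have h2 : ∀ y : L, ⨅ n, Metric.infEDist (f a (e n)) Oᶜ ≤
          Metric.infEDist (f a y) Oᶜ := by
        intro y
        have hcl : IsClosed {y : L | ⨅ n, Metric.infEDist (f a (e n)) Oᶜ ≤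
            Metric.infEDist (f a y) Oᶜ} :=
          isClosed_le continuous_const ((hcont (f a)).comp continuous_subtype_val)
        have := (TopologicalSpace.denseRange_denseSeq L).closure_eq ▸
          hcl.closure_subset_iff.2 (range_subset_iff.2 fun n =>
            iInf_le (fun n => Metric.infEDist (f a (e n)) Oᶜ) n)
        exact this (mem_univ y)
      have h3 := h2 ⟨x, hx⟩
      rw [Metric.infEDist_zero_of_mem (show f a x ∈ Oᶜ from hxO)] at h3
      exact (lt_of_lt_of_le h h3).false
  rw [key]
  refine measurableSet_lt measurable_const (Measurable.iInf fun n => ?_)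
  exact Metric.continuous_infEDist.measurable.comp (hf (e n))

variable {V : Type*} [NormedAddCommGroup V] [NormedSpace ℝ V]

/-- The radial retraction onto a closed ball. -/
noncomputable def ballRetract (R : ℝ) (hR : 0 < R) : C(V, Metric.closedBall (0 : V) R) where
  toFun ξ := ⟨(max 1 (‖ξ‖ / R))⁻¹ • ξ, by
    rw [mem_closedBall_zero_iff, norm_smul, Real.norm_of_nonneg (by positivity),
      inv_mul_le_iff₀ (by positivity)]
    calc ‖ξ‖ = ‖ξ‖ / R * R := by field_simp
      _ ≤ _ := by gcongr; exact le_max_right _ _⟩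
  continuous_toFun := by
    refine Continuous.subtype_mk (Continuous.smul (Continuous.inv₀ (by fun_prop) fun ξ => ?_)
      continuous_id) _
    positivity

lemma ballRetract_apply {R : ℝ} (hR : 0 < R) {ξ : V} (hξ : ‖ξ‖ ≤ R) :
    (ballRetract R hR ξ : V) = ξ := by
  simp only [ballRetract, ContinuousMap.coe_mk]
  rw [max_eq_left ((div_le_one hR).2 hξ), inv_one, one_smul]

/-- The truncation of a continuous function by a tent function. -/
noncomputable def tentBCF [ProperSpace V] (n : ℕ) (f : V → ℝ) (hf : Continuous f) : V →ᵇ ℝ :=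
  (tentMul n f hf).toBCF

lemma tent_eq_zero {n : ℕ} {ξ : V} (h : (n : ℝ) + 1 < ‖ξ‖) : tent n ξ = 0 := by
  refine tsub_eq_zero_of_le ?_
  rw [← Real.toNNReal_one]
  exact Real.toNNReal_le_toNNReal ((one_le_div (by positivity)).2 h.le)

lemma stronglyMeasurable_tentBCF [ProperSpace V] {A : Type*} [MeasurableSpace A] (n : ℕ)
    {f : A → V → ℝ} (hf : ∀ a, Continuous (f a)) (hm : ∀ ξ, Measurable fun a => f a ξ) :
    StronglyMeasurable fun a => tentBCF n (f a) (hf a) := by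
  have hR : (0 : ℝ) < n + 1 := by positivity
  let K := Metric.closedBall (0 : V) ((n : ℝ) + 1)
  have : CompactSpace K := isCompact_iff_compactSpace.1 (isCompact_closedBall _ _)
  let F : A → C(K, ℝ) := fun a => ⟨fun x => f a x, (hf a).comp continuous_subtype_val⟩
  have hF : StronglyMeasurable F := stronglyMeasurable_continuousMap fun x => hm x
  let θ : V →ᵇ ℝ := (tentMul n (fun _ => (1 : ℝ)) continuous_const).toBCF
  -- The tent vanishes outside the ball, so the truncated function depends only, and continuously,
  -- on the restriction to the ball. The retraction extends that restriction to the whole space.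
  let Ψ : C(K, ℝ) → V →ᵇ ℝ := fun g =>
    θ * (BoundedContinuousFunction.mkOfCompact g).compContinuous (ballRetract _ hR)
  have hΨ : Continuous Ψ := by
    refine continuous_const.mul ?_
    exact (BoundedContinuousFunction.continuous_compContinuous _).comp
      (ContinuousMap.isometryEquivBoundedOfCompact K ℝ).continuous
  have heq : (fun a => tentBCF n (f a) (hf a)) = Ψ ∘ F := by
    funext a
    ext ξ
    change (tent n ξ : ℝ) * f a ξ = (tent n ξ * 1) * f a (ballRetract _ hR ξ : V)
    rw [mul_one]
    rcases le_or_gt ‖ξ‖ ((n : ℝ) + 1) with h | h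
    · rw [ballRetract_apply hR h]
    · rw [tent_eq_zero h]; simp
  rw [heq]
  exact hΨ.comp_stronglyMeasurable hF

end Caratheodory

/-! ### Observables -/

section Observables

variable {U : Type*} [NormedAddCommGroup U]

/-- The growth function `∏ (1 + |ξ_i|^q)`. -/
noncomputable def growth (q : ℝ) {n : ℕ} (ξ : Fin n → U) : ℝ≥0∞ := ∏ i, (1 + ‖ξ i‖ₑ ^ q)

/-- The growth function with values in the nonnegative reals. -/
noncomputable def nngrowth (q : ℝ) {n : ℕ} (ξ : Fin n → U) : ℝ≥0 := ∏ i, (1 + ‖ξ i‖₊ ^ q)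

variable {q : ℝ}

lemma coe_nngrowth (hq : 0 ≤ q) {n : ℕ} (ξ : Fin n → U) : (nngrowth q ξ : ℝ≥0∞) = growth q ξ := by
  simp only [nngrowth, growth, ENNReal.ofNNReal_finsetProd, ENNReal.coe_add, ENNReal.coe_one,
    coe_nnnorm_rpow hq]

lemma ofReal_prod_one_add (hq : 0 ≤ q) {n : ℕ} (ξ : Fin n → U) :
    ENNReal.ofReal (∏ i, (1 + ‖ξ i‖ ^ q)) = growth q ξ := by
  rw [← coe_nngrowth hq, ← ENNReal.ofReal_coe_nnreal, nngrowth]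
  push_cast
  rfl

lemma continuous_nngrowth (hq : 0 ≤ q) {n : ℕ} :
    Continuous fun ξ : Fin n → U => nngrowth q ξ := by
  have h1 := NNReal.continuous_rpow_const hq
  exact continuous_finsetProd _ fun j _ =>
    continuous_const.add (h1.comp (continuous_nnnorm.comp (continuous_apply _)))

variable [MeasurableSpace U] [BorelSpace U] [ProperSpace U]

lemma measurable_growth {n : ℕ} : Measurable fun ξ : Fin n → U => growth q ξ := by
  unfold growth; fun_prop

/-- Carathéodory functions of time and state with growth of order `q`. -/
structure IsProfile (q : ℝ) (C : ℝ≥0) {n : ℕ} (G : ℝ → (Fin n → U) → ℝ) : Prop where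
  measurable : Measurable (Function.uncurry G)
  continuous : ∀ t, Continuous (G t)
  bound : ∀ t ξ, ‖G t ξ‖ₑ ≤ C * growth q ξ

variable {X : Type*} [MeasurableSpace X] {τ : Measure ℝ} {lam : Measure X}
  {n : ℕ} {G : ℝ → (Fin n → U) → ℝ} {C : ℝ≥0}

lemma IsProfile.abs_le (hG : IsProfile q C G) (hq : 0 ≤ q) (t : ℝ) (ξ : Fin n → U) :
    |G t ξ| ≤ C * ∏ i, (1 + ‖ξ i‖ ^ q) := by
  have h := hG.bound t ξ
  rw [← ofReal_prod_one_add hq, ← ENNReal.ofReal_coe_nnreal,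
    ← ENNReal.ofReal_mul (NNReal.coe_nonneg _), ← ofReal_norm] at h
  exact (ENNReal.ofReal_le_ofReal_iff (mul_nonneg (NNReal.coe_nonneg _)
    (Finset.prod_nonneg fun j _ => by positivity))).1 h

lemma IsProfile.stronglyMeasurable_integral (hG : IsProfile q C G)
    (κ : Kernel (ℝ × (Fin n → X)) (Fin n → U)) [IsMarkovKernel κ] :
    StronglyMeasurable fun z : ℝ × (Fin n → X) => ∫ ξ, G z.1 ξ ∂(κ z) := by
  refine StronglyMeasurable.integral_kernel_prod_right (f := fun (z : ℝ × (Fin n → X)) ξ => G z.1 ξ) ?_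
  have h : Measurable fun y : (ℝ × (Fin n → X)) × (Fin n → U) => (y.1.1, y.2) := by fun_prop
  exact (hG.measurable.comp h).stronglyMeasurable

lemma IsProfile.integrable (hG : IsProfile q C G) {ρ : Measure (Fin n → U)}
    (hρ : ∫⁻ ξ, growth q ξ ∂ρ ≠ ∞) (t : ℝ) : Integrable (G t) ρ := by
  have : SecondCountableTopology U := secondCountable_of_proper
  refine ⟨(hG.continuous t).aestronglyMeasurable, ?_⟩
  refine (lintegral_mono (hG.bound t)).trans_lt ?_
  rw [lintegral_const_mul' _ _ ENNReal.coe_ne_top]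
  exact ENNReal.mul_lt_top ENNReal.coe_lt_top hρ.lt_top

lemma IsProfile.enorm_integral_le (hG : IsProfile q C G) (ρ : Measure (Fin n → U)) (t : ℝ) :
    ‖∫ ξ, G t ξ ∂ρ‖ₑ ≤ C * ∫⁻ ξ, growth q ξ ∂ρ := by
  refine (enorm_integral_le_lintegral_enorm _).trans ?_
  rw [← lintegral_const_mul' _ _ ENNReal.coe_ne_top]
  exact lintegral_mono (hG.bound t)

lemma ae_lintegral_growth_ne_top {m : Measure (ℝ × (Fin n → X))}
    {κ : Kernel (ℝ × (Fin n → X)) (Fin n → U)} [IsMarkovKernel κ]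
    (h : ∫⁻ z, ∫⁻ ξ, growth q ξ ∂(κ z) ∂m ≠ ∞) : ∀ᵐ z ∂m, ∫⁻ ξ, growth q ξ ∂(κ z) ≠ ∞ := by
  filter_upwards [ae_lt_top (measurable_growth.lintegral_kernel) h] with z hz using hz.ne

lemma IsProfile.integrable_integral (hG : IsProfile q C G) {m : Measure (ℝ × (Fin n → X))}
    {κ : Kernel (ℝ × (Fin n → X)) (Fin n → U)} [IsMarkovKernel κ]
    (h : ∫⁻ z, ∫⁻ ξ, growth q ξ ∂(κ z) ∂m ≠ ∞) :
    Integrable (fun z : ℝ × (Fin n → X) => ∫ ξ, G z.1 ξ ∂(κ z)) m := by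
  refine ⟨(hG.stronglyMeasurable_integral κ).aestronglyMeasurable, ?_⟩
  refine (lintegral_mono fun z => hG.enorm_integral_le (κ z) z.1).trans_lt ?_
  rw [lintegral_const_mul' _ _ ENNReal.coe_ne_top]
  exact ENNReal.mul_lt_top ENNReal.coe_lt_top h.lt_top

/-- The mass of the growth function which is lost in a truncation. -/
noncomputable def tailMass (q : ℝ) (i : ℕ) (m : Measure (ℝ × (Fin n → X)))
    (κ : Kernel (ℝ × (Fin n → X)) (Fin n → U)) : ℝ≥0∞ :=
  ∫⁻ z, ∫⁻ ξ, ((1 - tent i ξ : ℝ≥0) : ℝ≥0∞) * growth q ξ ∂(κ z) ∂m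

variable [NormedSpace ℝ U]

/-- Weak convergence of observables for kernels with uniformly integrable growth. -/
lemma StableTendsto.tendsto_integral_profile (hq : 0 ≤ q) (hG : IsProfile q C G)
    {m : Measure (ℝ × (Fin n → X))} [IsFiniteMeasure m]
    {κ : ℕ → Kernel (ℝ × (Fin n → X)) (Fin n → U)} {κ' : Kernel (ℝ × (Fin n → X)) (Fin n → U)}
    [∀ j, IsMarkovKernel (κ j)] [IsMarkovKernel κ'] (h : StableTendsto m κ κ')
    (hA : ∀ j, ∫⁻ z, ∫⁻ ξ, growth q ξ ∂(κ j z) ∂m ≠ ∞)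
    (hA' : ∫⁻ z, ∫⁻ ξ, growth q ξ ∂(κ' z) ∂m ≠ ∞)
    (htail : ∀ ε : ℝ≥0∞, 0 < ε → ∃ i, tailMass q i m κ' ≤ ε ∧
      ∀ᶠ j in atTop, tailMass q i m (κ j) ≤ ε)
    {w : ℝ × (Fin n → X) → ℝ} (hw : Measurable w) {R : ℝ≥0} (hwR : ∀ z, ‖w z‖ₑ ≤ R) :
    Tendsto (fun j => ∫ z : ℝ × (Fin n → X), w z * ∫ ξ, G z.1 ξ ∂(κ j z) ∂m) atTop
      (𝓝 (∫ z : ℝ × (Fin n → X), w z * ∫ ξ, G z.1 ξ ∂(κ' z) ∂m)) := by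
  have : SecondCountableTopology U := secondCountable_of_proper
  -- The truncated observable is an integrable map into the bounded continuous functions, so stable
  -- convergence applies to it. The error is at most `R * C` times the lost growth mass.
  let H (i : ℕ) (z : ℝ × (Fin n → X)) : (Fin n → U) →ᵇ ℝ :=
    w z • tentBCF i (G z.1) (hG.continuous z.1)
  have hHapp (i : ℕ) (z) (ξ) : H i z ξ = w z * (tent i ξ * G z.1 ξ) := rfl
  have hHb (i : ℕ) (z : ℝ × (Fin n → X)) (ξ) : ‖tentBCF i (G z.1) (hG.continuous z.1) ξ‖ ≤
      C * ((1 + ((i : ℝ) + 1) ^ q) ^ n) := by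
    have e : ‖tentBCF i (G z.1) (hG.continuous z.1) ξ‖ = tent i ξ * ‖G z.1 ξ‖ := by
      change ‖(tent i ξ : ℝ) * G z.1 ξ‖ = _
      rw [norm_mul, Real.norm_of_nonneg (NNReal.coe_nonneg _)]
    rw [e]
    rcases le_or_gt ‖ξ‖ ((i : ℝ) + 1) with h | h
    · refine (mul_le_of_le_one_left (norm_nonneg _) (tent_le_one i ξ)).trans ?_
      refine (hG.abs_le hq z.1 ξ).trans ?_
      gcongr
      calc ∏ l, (1 + ‖ξ l‖ ^ q) ≤ ∏ _l : Fin n, (1 + ((i : ℝ) + 1) ^ q) := by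
            refine Finset.prod_le_prod (fun l _ => by positivity) fun l _ => ?_
            have := (norm_le_pi_norm ξ l).trans h
            gcongr
        _ = _ := by simp
    · rw [tent_eq_zero h]
      simp only [NNReal.coe_zero, zero_mul]
      positivity
  have hHi (i : ℕ) : Integrable (H i) m := by
    have h1 : StronglyMeasurable fun z : ℝ × (Fin n → X) =>
        tentBCF i (G z.1) (hG.continuous z.1) :=
      stronglyMeasurable_tentBCF i (fun z : ℝ × (Fin n → X) => hG.continuous z.1) fun ξ =>
        hG.measurable.comp (measurable_fst.prodMk measurable_const)
    refine Integrable.of_bound (C := R * (C * ((1 + ((i : ℝ) + 1) ^ q) ^ n)))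
      (hw.stronglyMeasurable.smul h1).aestronglyMeasurable (ae_of_all _ fun z => ?_)
    rw [norm_smul]
    refine mul_le_mul ?_ ((BoundedContinuousFunction.norm_le (by positivity)).2 (hHb i z))
      (norm_nonneg _) R.2
    have := hwR z
    rw [← ofReal_norm, ← ENNReal.ofReal_coe_nnreal] at this
    exact (ENNReal.ofReal_le_ofReal_iff (NNReal.coe_nonneg R)).1 this
  -- the truncation error
  have herr (η : Kernel (ℝ × (Fin n → X)) (Fin n → U)) [IsMarkovKernel η]
      (hη : ∫⁻ z, ∫⁻ ξ, growth q ξ ∂(η z) ∂m ≠ ∞) (i : ℕ) :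
      ‖∫ z : ℝ × (Fin n → X), w z * ∫ ξ, G z.1 ξ ∂(η z) ∂m - ∫ z, ∫ ξ, H i z ξ ∂(η z) ∂m‖ₑ ≤
        R * C * tailMass q i m η := by
    have i1 : Integrable (fun z : ℝ × (Fin n → X) => w z * ∫ ξ, G z.1 ξ ∂(η z)) m := by
      refine (hG.integrable_integral hη).bdd_mul hw.aestronglyMeasurable (c := R)
        (ae_of_all _ fun z => ?_)
      have := hwR z
      rw [← ofReal_norm, ← ENNReal.ofReal_coe_nnreal] at this
      exact (ENNReal.ofReal_le_ofReal_iff (NNReal.coe_nonneg R)).1 this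
    have i2 := StableTendsto.integrable_integral_of_integrable η (hHi i)
    rw [← integral_sub i1 i2]
    refine (enorm_integral_le_lintegral_enorm _).trans ?_
    rw [tailMass, ← lintegral_const_mul' _ _ (ENNReal.mul_ne_top (by simp) (by simp))]
    refine lintegral_mono_ae ?_
    filter_upwards [ae_lintegral_growth_ne_top hη] with z hz
    have i3 := hG.integrable hz z.1
    rw [← integral_const_mul, ← integral_sub (i3.const_mul _) ((H i z).integrable _),
      ← lintegral_const_mul' _ _ (ENNReal.mul_ne_top (by simp) (by simp))]
    refine (enorm_integral_le_lintegral_enorm _).trans (lintegral_mono fun ξ => ?_)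
    have e : w z * G z.1 ξ - H i z ξ = w z * (((1 - tent i ξ : ℝ≥0) : ℝ) * G z.1 ξ) := by
      rw [hHapp, NNReal.coe_sub (tent_le_one i ξ)]
      push_cast; ring
    rw [e, enorm_mul, enorm_mul]
    calc _ ≤ (R : ℝ≥0∞) * (((1 - tent i ξ : ℝ≥0) : ℝ≥0∞) * (C * growth q ξ)) := by
          gcongr
          · exact hwR z
          · exact le_of_eq (by rw [← ofReal_norm, Real.norm_of_nonneg (NNReal.coe_nonneg _),
              ENNReal.ofReal_coe_nnreal])
          · exact hG.bound _ _
      _ = _ := by ring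
  rw [Metric.tendsto_nhds]
  intro ε hε
  obtain ⟨η, hη0, hη⟩ : ∃ η : ℝ≥0∞, 0 < η ∧ (R : ℝ≥0∞) * C * η ≤ ENNReal.ofReal (ε / 4) := by
    have hB : (R : ℝ≥0∞) * C ≠ ∞ := ENNReal.mul_ne_top (by simp) (by simp)
    exact ⟨ENNReal.ofReal (ε / 4) / (R * C), ENNReal.div_pos
      (by simpa using hε) hB, ENNReal.mul_div_le⟩
  obtain ⟨i, hi', hi⟩ := htail η hη0
  have hconv (a b : ℝ) (hab : ‖a - b‖ₑ ≤ ENNReal.ofReal (ε / 4)) : |a - b| ≤ ε / 4 := by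
    rwa [← ofReal_norm, ENNReal.ofReal_le_ofReal_iff (by positivity)] at hab
  filter_upwards [hi, Metric.tendsto_nhds.1 (h.tendsto_integral_of_integrable (hHi i)) (ε / 4)
    (by positivity)] with j hj1 hj2
  have e1 := hconv _ _ ((herr (κ j) (hA j) i).trans ((mul_le_mul_right hj1 _).trans hη))
  have e2 := hconv _ _ ((herr κ' hA' i).trans ((mul_le_mul_right hi' _).trans hη))
  rw [Real.dist_eq] at hj2 ⊢
  rw [abs_le] at e1 e2
  rw [abs_lt] at hj2 ⊢
  constructor <;> linarith

end Observables

/-! ### Continuity in space of the averaged observables -/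

section Increments

/-- If δ ≥ ηa, then max(a,b) ≤ (1+1/η)δ and δ^q controls the product. Otherwise max(a,b) ≤ 2a and
the product is at most η·2^(q-1)·a^q. The choice of η makes the last factor at most ε. -/
lemma exists_mul_max_rpow_le {q : ℝ} (hq : 1 ≤ q) {ε : ℝ} (hε : 0 < ε) :
    ∃ c : ℝ≥0, ∀ a b δ : ℝ, 0 ≤ a → 0 ≤ b → 0 ≤ δ → b ≤ a + δ →
      δ * max a b ^ (q - 1) ≤ ε * a ^ q + c * δ ^ q := by
  have hq1 : 0 ≤ q - 1 := by linarith
  have hmul (s : ℝ) (hs : 0 ≤ s) : s * s ^ (q - 1) = s ^ q := by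
    rcases hs.eq_or_lt with rfl | hs
    · rw [zero_mul, Real.zero_rpow (by linarith)]
    · rw [mul_comm, ← Real.rpow_add_one hs.ne', sub_add_cancel]
  set η : ℝ := min 1 (ε / 2 ^ (q - 1)) with hη
  have h2 : (0 : ℝ) < 2 ^ (q - 1) := by positivity
  have hη0 : 0 < η := lt_min one_pos (by positivity)
  have hη1 : η ≤ 1 := min_le_left _ _
  refine ⟨NNReal.mk ((1 + 1 / η) ^ (q - 1)) (by positivity), fun a b δ ha hb hδ hab => ?_⟩
  have hmax : max a b ≤ a + δ := max_le (by linarith) hab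
  have hm0 : 0 ≤ max a b := le_max_of_le_left ha
  rw [NNReal.coe_mk]
  rcases le_or_gt (η * a) δ with h | h
  · have h1 : a ≤ 1 / η * δ := by
      rw [one_div, ← div_eq_inv_mul, le_div_iff₀ hη0]; linarith
    calc δ * max a b ^ (q - 1) ≤ δ * ((1 + 1 / η) * δ) ^ (q - 1) := by
          gcongr; linarith
      _ = (1 + 1 / η) ^ (q - 1) * δ ^ q := by
          rw [Real.mul_rpow (by positivity) hδ, ← hmul δ hδ]; ring
      _ ≤ _ := le_add_of_nonneg_left (by positivity)
  · calc δ * max a b ^ (q - 1) ≤ (η * a) * (2 * a) ^ (q - 1) := by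
          gcongr
          nlinarith
      _ = (η * 2 ^ (q - 1)) * a ^ q := by
          rw [Real.mul_rpow (by positivity) ha, ← hmul a ha]; ring
      _ ≤ ε * a ^ q := by
          gcongr
          exact (le_div_iff₀ h2).1 (min_le_right _ _)
      _ ≤ _ := le_add_of_nonneg_right (by positivity)

variable {U : Type*} [NormedAddCommGroup U]

/-- The increment between the first two states, times the growth function of the others. -/
noncomputable def incrementGrowth (q : ℝ) {k : ℕ} (ξ : Fin (2 + k) → U) : ℝ≥0∞ :=
  ‖ξ (Fin.castAdd k 0) - ξ (Fin.castAdd k 1)‖ₑ ^ q * growth q (ξ ∘ Fin.natAdd 2)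

/-- A local Lipschitz condition adapted to growth of order `q`. -/
def IsLipschitzProfile (q : ℝ) (C : ℝ≥0) {k : ℕ} (G : ℝ → (Fin (k + 1) → U) → ℝ) : Prop :=
  ∀ t ξ ζ, |G t ζ - G t ξ| ≤ C * ∑ i, ‖ζ i - ξ i‖ * max ‖ξ i‖ ‖ζ i‖ ^ (q - 1) *
    ∏ j, (1 + ‖ξ (i.succAbove j)‖ ^ q)

/-- The positions of a pair of points in two copies of a configuration, followed by the other
points of the first copy. -/
def pairIndex {k : ℕ} (i : Fin (k + 1)) : Fin (2 + k) → Fin ((k + 1) + (k + 1)) :=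
  Fin.append ![Fin.castAdd (k + 1) i, Fin.natAdd (k + 1) i] (Fin.castAdd (k + 1) ∘ i.succAbove)

lemma pairIndex_injective {k : ℕ} (i : Fin (k + 1)) : Function.Injective (pairIndex i) := by
  have hne (a b : Fin (k + 1)) : Fin.castAdd (k + 1) a ≠ Fin.natAdd (k + 1) b := by
    intro h
    have := congrArg Fin.val h
    simp only [Fin.val_castAdd, Fin.val_natAdd] at this
    omega
  refine Fin.append_injective_iff.2 ⟨?_, ?_, ?_⟩
  · intro a b hab
    fin_cases a <;> fin_cases b
    · rfl
    · exact absurd hab (hne _ _)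
    · exact absurd hab.symm (hne _ _)
    · rfl
  · exact (Fin.castAdd_injective _ _).comp Fin.succAbove_right_injective
  · intro a b
    fin_cases a
    · exact fun h => (Fin.succAbove_ne i b) ((Fin.castAdd_injective _ _) h).symm
    · exact (hne _ _).symm

lemma append_comp_pairIndex {α : Type*} {k : ℕ} (x y : Fin (k + 1) → α) (i : Fin (k + 1)) :
    Fin.append x y ∘ pairIndex i = Fin.append ![x i, y i] (x ∘ i.succAbove) := by
  funext a
  refine Fin.addCases (fun a => ?_) (fun a => ?_) a
  · simp only [Function.comp_apply, pairIndex, Fin.append_left]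
    fin_cases a
    · exact Fin.append_left x y i
    · exact Fin.append_right x y i
  · simp only [Function.comp_apply, pairIndex, Fin.append_right, Fin.append_left]

lemma incrementGrowth_comp_pairIndex {q : ℝ} {k : ℕ} (ω : Fin ((k + 1) + (k + 1)) → U)
    (i : Fin (k + 1)) : incrementGrowth q (ω ∘ pairIndex i) =
      ‖ω (Fin.castAdd (k + 1) i) - ω (Fin.natAdd (k + 1) i)‖ₑ ^ q *
        growth q ((ω ∘ Fin.castAdd (k + 1)) ∘ i.succAbove) := by
  have e0 : pairIndex i (Fin.castAdd k 0) = Fin.castAdd (k + 1) i := by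
    simp only [pairIndex, Fin.append_left]; rfl
  have e1 : pairIndex i (Fin.castAdd k 1) = Fin.natAdd (k + 1) i := by
    simp only [pairIndex, Fin.append_left]; rfl
  have e2 : (ω ∘ pairIndex i) ∘ Fin.natAdd 2 = (ω ∘ Fin.castAdd (k + 1)) ∘ i.succAbove := by
    funext j
    simp only [pairIndex, Function.comp_apply, Fin.append_right]
  rw [incrementGrowth, e2, Function.comp_apply, Function.comp_apply, e0, e1]

/-- The small multiple of |ξ_i|^q combines with the growth of the other states into the full growth
function. The remaining term is the i-th increment weighted by the growth of the other states. -/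
lemma enorm_sub_le_of_isLipschitzProfile {q : ℝ} (hq : 1 ≤ q) {C c : ℝ≥0} {k : ℕ}
    {G : ℝ → (Fin (k + 1) → U) → ℝ} (hG : IsLipschitzProfile q C G) {ε : ℝ≥0}
    (hc : ∀ a b δ : ℝ, 0 ≤ a → 0 ≤ b → 0 ≤ δ → b ≤ a + δ →
      δ * max a b ^ (q - 1) ≤ ε * a ^ q + c * δ ^ q) (t : ℝ) (ξ ζ : Fin (k + 1) → U) :
    ‖G t ζ - G t ξ‖ₑ ≤ C * ∑ i, (ε * growth q ξ +
      c * (‖ξ i - ζ i‖ₑ ^ q * growth q (ξ ∘ i.succAbove))) := by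
  have hq0 : 0 ≤ q := by linarith
  have h1 : |G t ζ - G t ξ| ≤ C * ∑ i, (ε * ∏ j, (1 + ‖ξ j‖ ^ q) +
      c * (‖ξ i - ζ i‖ ^ q * ∏ j, (1 + ‖(ξ ∘ i.succAbove) j‖ ^ q))) := by
    refine (hG t ξ ζ).trans ?_
    gcongr with i
    rw [← norm_neg (ζ i - ξ i), neg_sub]
    have hP : 0 ≤ ∏ j, (1 + ‖ξ (i.succAbove j)‖ ^ q) :=
      Finset.prod_nonneg fun j _ => by positivity
    have h2 := hc ‖ξ i‖ ‖ζ i‖ ‖ξ i - ζ i‖ (norm_nonneg _) (norm_nonneg _) (norm_nonneg _)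
      (by rw [norm_sub_rev]; simpa using norm_add_le (ξ i) (ζ i - ξ i))
    refine (mul_le_mul_of_nonneg_right h2 hP).trans ?_
    rw [add_mul, mul_assoc, mul_assoc, Fin.prod_univ_succAbove _ i]
    simp only [Function.comp_apply]
    gcongr
    linarith
  have hs (i : Fin (k + 1)) : 0 ≤ (ε : ℝ) * ∏ j, (1 + ‖ξ j‖ ^ q) := mul_nonneg (NNReal.coe_nonneg _)
    (Finset.prod_nonneg fun j _ => by positivity)
  have hs' (i : Fin (k + 1)) :
      0 ≤ (c : ℝ) * (‖ξ i - ζ i‖ ^ q * ∏ j, (1 + ‖(ξ ∘ i.succAbove) j‖ ^ q)) :=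
    mul_nonneg (NNReal.coe_nonneg _) (mul_nonneg (by positivity)
      (Finset.prod_nonneg fun j _ => by positivity))
  rw [← ofReal_norm]
  refine (ENNReal.ofReal_le_ofReal h1).trans (le_of_eq ?_)
  rw [ENNReal.ofReal_mul (NNReal.coe_nonneg _), ENNReal.ofReal_coe_nnreal,
    ENNReal.ofReal_sum_of_nonneg fun i _ => add_nonneg (hs i) (hs' i)]
  congr 1
  refine Finset.sum_congr rfl fun i _ => ?_
  rw [ENNReal.ofReal_add (hs i) (hs' i), ENNReal.ofReal_mul (NNReal.coe_nonneg _),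
    ENNReal.ofReal_mul (NNReal.coe_nonneg _), ENNReal.ofReal_mul (by positivity),
    ofReal_prod_one_add hq0, ofReal_prod_one_add hq0, ENNReal.ofReal_coe_nnreal,
    ENNReal.ofReal_coe_nnreal, ← ENNReal.ofReal_rpow_of_nonneg (norm_nonneg _) hq0, ofReal_norm]

end Increments

/-! ### Averages over products of balls -/

section Averages

variable {X : Type*} [PseudoMetricSpace X] [SecondCountableTopology X] [MeasurableSpace X]
  [BorelSpace X] {lam : Measure X} [SigmaFinite lam]

/-- The product of the weights of balls around the points of a configuration. -/
noncomputable def prodWeight (lam : Measure X) (r : ℝ) {n : ℕ} (x y : Fin n → X) : ℝ≥0∞ :=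
  ∏ i, ballWeight lam r (x i) (y i)

lemma measurable_prodWeight (r : ℝ) {n : ℕ} :
    Measurable fun p : (Fin n → X) × (Fin n → X) => prodWeight lam r p.1 p.2 :=
  Finset.measurable_fun_prod _ fun i _ => (measurable_ballWeight lam r).comp
    (by fun_prop : Measurable fun p : (Fin n → X) × (Fin n → X) => (p.1 i, p.2 i))

lemma measurable_ballWeight_right (r : ℝ) (x : X) : Measurable fun y => ballWeight lam r x y :=
  (measurable_ballWeight lam r).comp measurable_prodMk_left

lemma lintegral_prodWeight_le (r : ℝ) {n : ℕ} (x : Fin n → X) :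
    ∫⁻ y, prodWeight lam r x y ∂(Measure.pi fun _ => lam) ≤ 1 := by
  simp only [prodWeight]
  rw [lintegral_prod_pi fun i => measurable_ballWeight_right r (x i)]
  exact Finset.prod_le_one' fun i _ => lintegral_ballWeight_right_le lam r (x i)

/-- The factors of the weight at indices other than i integrate to at most one. -/
lemma lintegral_prodWeight_mul_le (r : ℝ) {n : ℕ} (x : Fin n → X) (i : Fin n) {f : X → ℝ≥0∞}
    (hf : Measurable f) :
    ∫⁻ y, prodWeight lam r x y * f (y i) ∂(Measure.pi fun _ => lam) ≤
      ∫⁻ v, ballWeight lam r (x i) v * f v ∂lam := by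
  classical
  let F : Fin n → X → ℝ≥0∞ := fun j v =>
    ballWeight lam r (x j) v * (if j = i then f v else 1)
  have hF (j : Fin n) : Measurable (F j) := by
    refine (measurable_ballWeight_right r (x j)).mul ?_
    by_cases h : j = i
    · simpa only [h, if_true] using hf
    · simpa only [h, if_false] using measurable_const
  have e (y : Fin n → X) : prodWeight lam r x y * f (y i) = ∏ j, F j (y j) := by
    simp only [F, prodWeight, Finset.prod_mul_distrib, Finset.prod_ite_eq', Finset.mem_univ,
      if_true]
  simp_rw [e]
  rw [lintegral_prod_pi hF, ← Finset.mul_prod_erase _ _ (Finset.mem_univ i)]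
  refine (mul_le_of_le_one_right' (Finset.prod_le_one' fun j hj => ?_)).trans (le_of_eq ?_)
  · simp only [F, if_neg (Finset.ne_of_mem_erase hj), mul_one]
    exact lintegral_ballWeight_right_le lam r (x j)
  · simp only [F, if_true]

lemma measurable_append {A : Type*} [MeasurableSpace A] {b m : ℕ} {f : A → Fin b → X}
    {g : A → Fin m → X} (hf : Measurable f) (hg : Measurable g) :
    Measurable fun a => (Fin.append (f a) (g a) : Fin (b + m) → X) :=
  by
  have := (measurePreserving_append (0 : Measure X) b m).measurable
  exact this.comp (hf.prodMk hg)

/-- A configuration x together with a companion v of x_i is read as the pair (x_i, v) followed by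
the other points. Integrating over these in either order is Tonelli's theorem. -/
lemma lintegral_pair_eq (r : ℝ) {k : ℕ} (i : Fin (k + 1)) {Q : (Fin (2 + k) → X) → ℝ≥0∞}
    (hQ : Measurable Q) :
    ∫⁻ x : Fin (k + 1) → X, ∫⁻ v, ballWeight lam r (x i) v *
        Q (Fin.append ![x i, v] (x ∘ i.succAbove)) ∂lam ∂(Measure.pi fun _ => lam) =
      ∫⁻ w, ballWeight lam r (w (Fin.castAdd k 0)) (w (Fin.castAdd k 1)) * Q w
        ∂(Measure.pi fun _ => lam) := by
  have hm : Measurable fun w : Fin (2 + k) → X =>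
      ballWeight lam r (w (Fin.castAdd k 0)) (w (Fin.castAdd k 1)) * Q w :=
    (measurable_ballWeight_apply r _ _).mul hQ
  have hF : Measurable fun p : (X × X) × (Fin k → X) =>
      ballWeight lam r p.1.1 p.1.2 * Q (Fin.append ![p.1.1, p.1.2] p.2) := by
    refine ((measurable_ballWeight lam r).comp measurable_fst).mul (hQ.comp
      (measurable_append (measurable_vecCons (by fun_prop) (measurable_vecCons (by fun_prop)
        measurable_const)) measurable_snd))
  have e1 (u : Fin 2 → X) (y : Fin k → X) :
      ballWeight lam r ((Fin.append u y : Fin (2 + k) → X) (Fin.castAdd k 0))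
        ((Fin.append u y : Fin (2 + k) → X) (Fin.castAdd k 1)) * Q (Fin.append u y) =
      ballWeight lam r (u 0) (u 1) * Q (Fin.append ![u 0, u 1] y) := by
    rw [Fin.append_left, Fin.append_left]
    congr 3
    ext a; fin_cases a <;> rfl
  rw [lintegral_append hm]
  simp_rw [e1]
  rw [lintegral_pi_fin_two]
  swap
  · exact Measurable.lintegral_prod_right' (f := fun p : (Fin 2 → X) × (Fin k → X) =>
      ballWeight lam r (p.1 0) (p.1 1) * Q (Fin.append ![p.1 0, p.1 1] p.2))
      (hF.comp (by fun_prop : Measurable fun p : (Fin 2 → X) × (Fin k → X) =>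
        ((p.1 0, p.1 1), p.2)))
  have hmp := (measurePreserving_piFinSuccAbove (fun _ : Fin (k + 1) => lam) i).symm
  rw [← hmp.lintegral_comp_emb (MeasurableEquiv.measurableEmbedding _)]
  have e2 (p : X × (Fin k → X)) :
      (MeasurableEquiv.piFinSuccAbove (fun _ : Fin (k + 1) => X) i).symm p i = p.1 :=
    Fin.insertNth_apply_same (α := fun _ => X) i p.1 p.2
  have e3 (p : X × (Fin k → X)) :
      (MeasurableEquiv.piFinSuccAbove (fun _ : Fin (k + 1) => X) i).symm p ∘ i.succAbove =
        p.2 := by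
    funext j
    exact Fin.insertNth_apply_succAbove (α := fun _ => X) i p.1 p.2 j
  simp only [e2, e3, Matrix.cons_val_zero, Matrix.cons_val_one]
  rw [lintegral_prod _ (Measurable.aemeasurable (Measurable.lintegral_prod_right'
    (f := fun p : (X × (Fin k → X)) × X => ballWeight lam r p.1.1 p.2 *
      Q (Fin.append ![p.1.1, p.2] p.1.2)) (hF.comp (by fun_prop :
        Measurable fun p : (X × (Fin k → X)) × X => ((p.1.1, p.2), p.1.2)))))]
  refine lintegral_congr fun a => ?_
  refine lintegral_lintegral_swap (f := fun (y : Fin k → X) (v : X) =>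
    ballWeight lam r a v * Q (Fin.append ![a, v] y)) (Measurable.aemeasurable ?_)
  exact hF.comp (by fun_prop : Measurable fun p : (Fin k → X) × X => ((a, p.2), p.1))

end Averages

section Equicontinuity

variable {X : Type*} [PseudoMetricSpace X] [SecondCountableTopology X] [MeasurableSpace X]
  [BorelSpace X] {lam : Measure X} [SigmaFinite lam]
  {U : Type*} [NormedAddCommGroup U] [ProperSpace U] [MeasurableSpace U] [BorelSpace U]

lemma measurable_incrementGrowth {q : ℝ} {k : ℕ} :
    Measurable fun ξ : Fin (2 + k) → U => incrementGrowth q ξ := by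
  have : SecondCountableTopology U := secondCountable_of_proper
  exact Measurable.mul (by fun_prop) (measurable_growth.comp (measurable_comp_index _))

/-- The modulus of continuity of the two-point measures, weighted with the growth of other
points. -/
noncomputable def incrementModulus (lam : Measure X) (q r : ℝ) {k : ℕ}
    (σ : (Fin (2 + k) → X) → Measure (Fin (2 + k) → U)) : ℝ≥0∞ :=
  ∫⁻ w, ballWeight lam r (w (Fin.castAdd k 0)) (w (Fin.castAdd k 1)) *
    ∫⁻ ξ, incrementGrowth q ξ ∂(σ w) ∂(Measure.pi fun _ => lam)

/-- The averaged observables are continuous in the mean. -/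
lemma lintegral_prodWeight_enorm_sub_le {q : ℝ} (hq : 1 ≤ q) {C C' c ε : ℝ≥0} {k : ℕ}
    {G : ℝ → (Fin (k + 1) → U) → ℝ} (hG : IsProfile q C G) (hL : IsLipschitzProfile q C' G)
    (hc : ∀ a b δ : ℝ, 0 ≤ a → 0 ≤ b → 0 ≤ δ → b ≤ a + δ →
      δ * max a b ^ (q - 1) ≤ ε * a ^ q + c * δ ^ q) (t r : ℝ)
    {ρ : Kernel (Fin (k + 1) → X) (Fin (k + 1) → U)} [IsMarkovKernel ρ]
    {ρ₂ : (Fin ((k + 1) + (k + 1)) → X) → Measure (Fin ((k + 1) + (k + 1)) → U)}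
    {σ : Kernel (Fin (2 + k) → X) (Fin (2 + k) → U)} [IsMarkovKernel σ]
    (h0 : ∀ᵐ w ∂(Measure.pi fun _ => lam),
      ρ (w ∘ Fin.castAdd (k + 1)) = (ρ₂ w).map (· ∘ Fin.castAdd (k + 1)))
    (h1 : ∀ᵐ w ∂(Measure.pi fun _ => lam),
      ρ (w ∘ Fin.natAdd (k + 1)) = (ρ₂ w).map (· ∘ Fin.natAdd (k + 1)))
    (h2 : ∀ i, ∀ᵐ w ∂(Measure.pi fun _ => lam),
      σ (w ∘ pairIndex i) = (ρ₂ w).map (· ∘ pairIndex i))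
    (hA : ∀ᵐ x ∂(Measure.pi fun _ => lam), ∫⁻ ξ, growth q ξ ∂(ρ x) ≠ ∞) :
    ∫⁻ x, ∫⁻ y, prodWeight lam r x y * ‖∫ ξ, G t ξ ∂(ρ x) - ∫ ξ, G t ξ ∂(ρ y)‖ₑ
        ∂(Measure.pi fun _ => lam) ∂(Measure.pi fun _ => lam) ≤
      C' * ((k + 1 : ℕ) * (ε * ∫⁻ x, ∫⁻ ξ, growth q ξ ∂(ρ x) ∂(Measure.pi fun _ => lam) +
        c * incrementModulus lam q r σ)) := by
  have : SecondCountableTopology U := secondCountable_of_proper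
  set P : Measure (Fin (k + 1) → X) := Measure.pi fun _ => lam with hP
  let A : (Fin (k + 1) → X) → ℝ≥0∞ := fun x => ∫⁻ ξ, growth q ξ ∂(ρ x)
  let Q : (Fin (2 + k) → X) → ℝ≥0∞ := fun w => ∫⁻ ξ, incrementGrowth q ξ ∂(σ w)
  have hAm : Measurable A := measurable_growth.lintegral_kernel
  have hQm : Measurable Q := measurable_incrementGrowth.lintegral_kernel
  have hqmp := (measurePreserving_append lam (k + 1) (k + 1)).quasiMeasurePreserving
  -- The measures at x and y are coupled by the measure at the joint configuration (x,y). The i-th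
  -- increment together with the other states of x is a marginal of it along `pairIndex i`.
  have hpt : ∀ᵐ x ∂P, ∀ᵐ y ∂P, ‖∫ ξ, G t ξ ∂(ρ x) - ∫ ξ, G t ξ ∂(ρ y)‖ₑ ≤
      C' * ∑ i, (ε * A x + c * Q (Fin.append ![x i, y i] (x ∘ i.succAbove))) := by
    filter_upwards [Measure.ae_ae_of_ae_prod (hqmp.ae h0), Measure.ae_ae_of_ae_prod (hqmp.ae h1),
      Measure.ae_ae_of_ae_prod (hqmp.ae (ae_all_iff.2 h2)), hA] with x h0 h1 h2 hAx
    filter_upwards [h0, h1, h2, hA] with y h0 h1 h2 hAy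
    have ec : Fin.append x y ∘ Fin.castAdd (k + 1) = x := funext fun i => Fin.append_left x y i
    have en : Fin.append x y ∘ Fin.natAdd (k + 1) = y := funext fun i => Fin.append_right x y i
    simp only [ec] at h0
    simp only [en] at h1
    simp only [append_comp_pairIndex] at h2
    have mG : AEStronglyMeasurable (G t) (ρ x) := (hG.continuous t).aestronglyMeasurable
    have mG' : AEStronglyMeasurable (G t) (ρ y) := (hG.continuous t).aestronglyMeasurable
    have i0 := hG.integrable hAx t
    have i1 := hG.integrable hAy t
    have mc := (measurable_comp_index (U := U) (Fin.castAdd (m := k + 1) (n := k + 1)))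
    have mn := (measurable_comp_index (U := U) (Fin.natAdd (m := k + 1) (n := k + 1)))
    rw [h0] at i0 mG
    rw [h1] at i1 mG'
    have i0' : Integrable (fun ω => G t (ω ∘ Fin.castAdd (k + 1))) (ρ₂ (Fin.append x y)) := i0.comp_measurable mc
    have i1' : Integrable (fun ω => G t (ω ∘ Fin.natAdd (k + 1))) (ρ₂ (Fin.append x y)) := i1.comp_measurable mn
    rw [h0, h1, integral_map mc.aemeasurable mG, integral_map mn.aemeasurable mG',
      ← integral_sub i0' i1']
    refine (enorm_integral_le_lintegral_enorm _).trans ?_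
    calc _ ≤ ∫⁻ ω, C' * ∑ i, (ε * growth q (ω ∘ Fin.castAdd (k + 1)) +
          c * incrementGrowth q (ω ∘ pairIndex i)) ∂(ρ₂ (Fin.append x y)) := by
          refine lintegral_mono fun ω => ?_
          rw [← enorm_neg, neg_sub]
          refine (enorm_sub_le_of_isLipschitzProfile hq hL hc t _ _).trans (le_of_eq ?_)
          congr 1
          refine Finset.sum_congr rfl fun i _ => ?_
          rw [incrementGrowth_comp_pairIndex]
          rfl
      _ = _ := by
          have m1 : Measurable fun ω : Fin ((k + 1) + (k + 1)) → U =>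
              growth q (ω ∘ Fin.castAdd (k + 1)) := measurable_growth.comp mc
          have m2 (i : Fin (k + 1)) : Measurable fun ω : Fin ((k + 1) + (k + 1)) → U =>
              incrementGrowth q (ω ∘ pairIndex i) :=
            measurable_incrementGrowth.comp (measurable_comp_index _)
          rw [lintegral_const_mul' _ _ ENNReal.coe_ne_top,
            lintegral_finsetSum _ fun i _ => (m1.const_mul _).fun_add ((m2 i).const_mul _)]
          congr 1
          refine Finset.sum_congr rfl fun i _ => ?_
          rw [lintegral_add_left (m1.const_mul _), lintegral_const_mul _ m1,
            lintegral_const_mul _ (m2 i)]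
          simp only [A, Q]
          rw [h0, h2 i, lintegral_map measurable_growth mc,
            lintegral_map measurable_incrementGrowth (measurable_comp_index _)]
  have mW := measurable_prodWeight (lam := lam) r (n := k + 1)
  have mQ (x : Fin (k + 1) → X) (i : Fin (k + 1)) :
      Measurable fun v => Q (Fin.append ![x i, v] (x ∘ i.succAbove)) :=
    hQm.comp (measurable_append (measurable_vecCons measurable_const
      (measurable_vecCons measurable_id measurable_const)) measurable_const)
  have mWx (x : Fin (k + 1) → X) : Measurable fun y => prodWeight lam r x y :=
    mW.comp measurable_prodMk_left
  have mS (i : Fin (k + 1)) : Measurable fun x : Fin (k + 1) → X => ∫⁻ v,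
      ballWeight lam r (x i) v * Q (Fin.append ![x i, v] (x ∘ i.succAbove)) ∂lam := by
    refine Measurable.lintegral_prod_right' (f := fun p : (Fin (k + 1) → X) × X =>
      ballWeight lam r (p.1 i) p.2 * Q (Fin.append ![p.1 i, p.2] (p.1 ∘ i.succAbove))) ?_
    refine ((measurable_ballWeight lam r).comp (by fun_prop : Measurable fun
      p : (Fin (k + 1) → X) × X => (p.1 i, p.2))).mul (hQm.comp ?_)
    exact measurable_append (measurable_vecCons (by fun_prop) (measurable_vecCons (by fun_prop)
      measurable_const)) ((measurable_comp_index _).comp measurable_fst)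
  calc _ ≤ ∫⁻ x, C' * ∑ i, (ε * A x + c * ∫⁻ v, ballWeight lam r (x i) v *
          Q (Fin.append ![x i, v] (x ∘ i.succAbove)) ∂lam) ∂P := by
        refine lintegral_mono_ae ?_
        filter_upwards [hpt] with x hx
        calc _ ≤ ∫⁻ y, C' * ∑ i, (ε * A x * prodWeight lam r x y + c * (prodWeight lam r x y *
                Q (Fin.append ![x i, y i] (x ∘ i.succAbove)))) ∂P := by
              refine lintegral_mono_ae ?_
              filter_upwards [hx] with y hy
              refine (mul_le_mul_right hy _).trans (le_of_eq ?_)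
              rw [mul_left_comm, Finset.mul_sum]
              congr 1
              exact Finset.sum_congr rfl fun i _ => by ring
          _ ≤ _ := by
              have m3 (i : Fin (k + 1)) : Measurable fun y : Fin (k + 1) → X =>
                  prodWeight lam r x y * Q (Fin.append ![x i, y i] (x ∘ i.succAbove)) :=
                (mWx x).mul ((mQ x i).comp (measurable_pi_apply i))
              rw [lintegral_const_mul' _ _ ENNReal.coe_ne_top, lintegral_finsetSum _ fun i _ =>
                ((mWx x).const_mul _).fun_add ((m3 i).const_mul _)]
              gcongr with i
              rw [lintegral_add_left ((mWx x).const_mul _), lintegral_const_mul _ (mWx x),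
                lintegral_const_mul _ (m3 i)]
              exact add_le_add (mul_le_of_le_one_right' (lintegral_prodWeight_le r x))
                (mul_le_mul_right (lintegral_prodWeight_mul_le r x i (mQ x i)) _)
    _ = _ := by
        rw [lintegral_const_mul' _ _ ENNReal.coe_ne_top, lintegral_finsetSum _ fun i _ =>
          (hAm.const_mul _).fun_add ((mS i).const_mul _)]
        congr 1
        have (i : Fin (k + 1)) : ∫⁻ x, (ε * A x + c * ∫⁻ v, ballWeight lam r (x i) v *
            Q (Fin.append ![x i, v] (x ∘ i.succAbove)) ∂lam) ∂P =
            ε * ∫⁻ x, A x ∂P + c * incrementModulus lam q r σ := by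
          rw [lintegral_add_left (hAm.const_mul _), lintegral_const_mul _ hAm,
            lintegral_const_mul _ (mS i), lintegral_pair_eq r i hQm]
          rfl
        rw [Finset.sum_congr rfl fun i _ => this i, Finset.sum_const, Finset.card_univ,
          Fintype.card_fin, nsmul_eq_mul]

end Equicontinuity

/-! ### Strong convergence of time integrals -/

section Compactness

variable {S Y : Type*} [MeasurableSpace S] [MeasurableSpace Y] {τ : Measure S} {P : Measure Y}
  [IsFiniteMeasure τ] [IsFiniteMeasure P]

/-- Since the weights have mass one, the value at x is itself a weighted average of the constant
F(t,x). The difference is then a single integral over (t,y). -/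
lemma lintegral_enorm_sub_average_le {F : S × Y → ℝ} (hF : StronglyMeasurable F)
    (hFi : Integrable F (τ.prod P)) {W : Y × Y → ℝ≥0∞} (hW : Measurable W) {R : ℝ≥0}
    (hWR : ∀ p, W p ≤ R) (hW1 : ∀ᵐ x ∂P, ∫⁻ y, W (x, y) ∂P = 1) :
    ∫⁻ x, ‖∫ t, F (t, x) ∂τ - ∫ z, (W (x, z.2)).toReal * F z ∂(τ.prod P)‖ₑ ∂P ≤
      ∫⁻ t, ∫⁻ x, ∫⁻ y, W (x, y) * ‖F (t, x) - F (t, y)‖ₑ ∂P ∂P ∂τ := by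
  have hWt (p) : W p ≠ ∞ := ne_top_of_le_ne_top ENNReal.coe_ne_top (hWR p)
  have hm : Measurable fun p : (Y × S) × Y => W (p.1.1, p.2) *
      ‖F (p.1.2, p.1.1) - F (p.1.2, p.2)‖ₑ := by
    have hFm := hF.measurable
    refine (hW.comp (by fun_prop)).mul (Measurable.enorm (Measurable.sub ?_ ?_))
    · exact hFm.comp (by fun_prop : Measurable fun p : (Y × S) × Y => (p.1.2, p.1.1))
    · exact hFm.comp (by fun_prop : Measurable fun p : (Y × S) × Y => (p.1.2, p.2))
  rw [lintegral_lintegral_swap (f := fun t x => ∫⁻ y, W (x, y) * ‖F (t, x) - F (t, y)‖ₑ ∂P)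
    (hm.lintegral_prod_right'.comp measurable_swap).aemeasurable]
  refine lintegral_mono_ae ?_
  filter_upwards [hW1, hFi.prod_left_ae] with x hx hxi
  have hWx : Measurable fun y => W (x, y) := hW.comp measurable_prodMk_left
  have h1 : ∫ y, (W (x, y)).toReal ∂P = 1 := by
    rw [integral_toReal hWx.aemeasurable (ae_of_all _ fun y => (hWt _).lt_top), hx,
      ENNReal.toReal_one]
  have hWi : Integrable (fun y => (W (x, y)).toReal) P :=
    integrable_toReal_of_lintegral_ne_top hWx.aemeasurable (by rw [hx]; exact ENNReal.one_ne_top)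
  have e1 : ∫ t, F (t, x) ∂τ =
      ∫ z : S × Y, (W (x, z.2)).toReal * F (z.1, x) ∂(τ.prod P) := by
    have := integral_prod_mul (μ := τ) (ν := P) (fun t => F (t, x)) fun y => (W (x, y)).toReal
    rw [h1, mul_one] at this
    rw [← this]
    exact integral_congr_ae (ae_of_all _ fun z => mul_comm _ _)
  have i1 : Integrable (fun z : S × Y => (W (x, z.2)).toReal * F (z.1, x)) (τ.prod P) :=
    (hxi.mul_prod hWi).congr (ae_of_all _ fun z => mul_comm _ _)
  have i2 : Integrable (fun z : S × Y => (W (x, z.2)).toReal * F z) (τ.prod P) := by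
    refine hFi.bdd_mul (c := R) ?_ (ae_of_all _ fun z => ?_)
    · exact (hWx.comp measurable_snd).ennreal_toReal.aestronglyMeasurable
    · rw [Real.norm_of_nonneg ENNReal.toReal_nonneg]
      exact ENNReal.toReal_le_of_le_ofReal R.2 (by
        rw [ENNReal.ofReal_coe_nnreal]; exact hWR _)
  rw [e1, ← integral_sub i1 i2]
  refine (enorm_integral_le_lintegral_enorm _).trans (le_of_eq ?_)
  rw [← lintegral_prod (fun z : S × Y => W (x, z.2) * ‖F (z.1, x) - F z‖ₑ)]
  · refine lintegral_congr fun z => ?_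
    rw [← mul_sub, enorm_mul, ← ofReal_norm, Real.norm_of_nonneg ENNReal.toReal_nonneg,
      ENNReal.ofReal_toReal (hWt _)]
  · exact (hm.comp (by fun_prop : Measurable fun z : S × Y => ((x, z.1), z.2))).aemeasurable

/-- Weak convergence of averages and uniform continuity in the mean give strong convergence. -/
lemma tendsto_lintegral_enorm_integral_sub {F : ℕ → S × Y → ℝ} {F' : S × Y → ℝ}
    (hF : ∀ j, StronglyMeasurable (F j)) (hF' : StronglyMeasurable F') {K : ℝ≥0}
    (hFK : ∀ j, ∫⁻ z, ‖F j z‖ₑ ∂(τ.prod P) ≤ K) (hFK' : ∫⁻ z, ‖F' z‖ₑ ∂(τ.prod P) ≤ K)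
    (h : ∀ ε : ℝ≥0∞, 0 < ε → ∃ (W : Y × Y → ℝ≥0∞) (R : ℝ≥0), Measurable W ∧ (∀ p, W p ≤ R) ∧
      (∀ᵐ x ∂P, ∫⁻ y, W (x, y) ∂P = 1) ∧
      (∀ x, Tendsto (fun j => ∫ z, (W (x, z.2)).toReal * F j z ∂(τ.prod P)) atTop
        (𝓝 (∫ z, (W (x, z.2)).toReal * F' z ∂(τ.prod P)))) ∧
      (∀ᶠ j in atTop,
        ∫⁻ t, ∫⁻ x, ∫⁻ y, W (x, y) * ‖F j (t, x) - F j (t, y)‖ₑ ∂P ∂P ∂τ ≤ ε) ∧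
      ∫⁻ t, ∫⁻ x, ∫⁻ y, W (x, y) * ‖F' (t, x) - F' (t, y)‖ₑ ∂P ∂P ∂τ ≤ ε) :
    Tendsto (fun j => ∫⁻ x, ‖∫ t, F j (t, x) ∂τ - ∫ t, F' (t, x) ∂τ‖ₑ ∂P) atTop (𝓝 0) := by
  refine ENNReal.tendsto_nhds_zero.2 fun ε hε => ?_
  have hε3 : 0 < ε / 3 := ENNReal.div_pos hε.ne' (by simp)
  obtain ⟨W, R, hW, hWR, hW1, hlim, hj, hj'⟩ := h (ε / 3) hε3
  let A : (S × Y → ℝ) → Y → ℝ := fun f x => ∫ z, (W (x, z.2)).toReal * f z ∂(τ.prod P)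
  let Φ : (S × Y → ℝ) → Y → ℝ := fun f x => ∫ t, f (t, x) ∂τ
  have hA {f : S × Y → ℝ} (hf : StronglyMeasurable f) : StronglyMeasurable (A f) := by
    refine StronglyMeasurable.integral_prod_right'
      (f := fun p : Y × (S × Y) => (W (p.1, p.2.2)).toReal * f p.2) ?_
    exact ((hW.comp (by fun_prop :
      Measurable fun p : Y × (S × Y) => (p.1, p.2.2))).ennreal_toReal.stronglyMeasurable).mul
      (hf.comp_measurable measurable_snd)
  have hΦ {f : S × Y → ℝ} (hf : StronglyMeasurable f) : StronglyMeasurable (Φ f) :=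
    hf.integral_prod_left'
  have hi {f : S × Y → ℝ} (hf : StronglyMeasurable f) (hK : ∫⁻ z, ‖f z‖ₑ ∂(τ.prod P) ≤ K) :
      Integrable f (τ.prod P) :=
    ⟨hf.aestronglyMeasurable, hK.trans_lt ENNReal.coe_lt_top⟩
  -- Bounded weights turn the L¹ bound on f into a pointwise bound on its averages, so pointwise
  -- convergence of the averages gives L¹ convergence.
  have hb {f : S × Y → ℝ} (hK : ∫⁻ z, ‖f z‖ₑ ∂(τ.prod P) ≤ K) (x : Y) :
      ‖A f x‖ₑ ≤ R * K := by
    refine (enorm_integral_le_lintegral_enorm _).trans ?_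
    calc _ ≤ ∫⁻ z, R * ‖f z‖ₑ ∂(τ.prod P) := by
          refine lintegral_mono fun z => ?_
          rw [enorm_mul, ← ofReal_norm, Real.norm_of_nonneg ENNReal.toReal_nonneg]
          exact mul_le_mul_left (ENNReal.ofReal_toReal_le.trans (hWR _)) _
      _ ≤ _ := by
          rw [lintegral_const_mul' _ _ ENNReal.coe_ne_top]
          exact mul_le_mul_right hK _
  have hdct : Tendsto (fun j => ∫⁻ x, ‖A (F j) x - A F' x‖ₑ ∂P) atTop (𝓝 0) := by
    have := tendsto_lintegral_of_dominated_convergence (μ := P) (F := fun j x =>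
      ‖A (F j) x - A F' x‖ₑ) (f := fun _ => 0) (fun _ => R * K + R * K)
      (fun j => ((hA (hF j)).sub (hA hF')).measurable.enorm)
      (fun j => ae_of_all _ fun x => enorm_sub_le.trans
        (add_le_add (hb (hFK j) x) (hb hFK' x)))
      (by
        rw [lintegral_const]
        exact ENNReal.mul_ne_top (by simp [ENNReal.mul_eq_top]) (measure_ne_top _ _))
      (ae_of_all _ fun x => by
        have h1 := ((hlim x).sub_const (A F' x)).enorm
        rwa [sub_self, enorm_zero] at h1)
    rwa [lintegral_zero] at this
  filter_upwards [hj, ENNReal.tendsto_nhds_zero.1 hdct (ε / 3) hε3] with j h1 h2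
  calc ∫⁻ x, ‖Φ (F j) x - Φ F' x‖ₑ ∂P
      ≤ ∫⁻ x, (‖Φ (F j) x - A (F j) x‖ₑ + ‖A (F j) x - A F' x‖ₑ + ‖Φ F' x - A F' x‖ₑ) ∂P := by
        refine lintegral_mono fun x => ?_
        calc ‖Φ (F j) x - Φ F' x‖ₑ = ‖((Φ (F j) x - A (F j) x) + (A (F j) x - A F' x)) -
              (Φ F' x - A F' x)‖ₑ := by congr 1; ring
          _ ≤ _ := enorm_sub_le.trans (add_le_add_left (enorm_add_le _ _) _)
    _ = ∫⁻ x, ‖Φ (F j) x - A (F j) x‖ₑ ∂P + ∫⁻ x, ‖A (F j) x - A F' x‖ₑ ∂P +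
          ∫⁻ x, ‖Φ F' x - A F' x‖ₑ ∂P := by
        have m1 : Measurable fun x => ‖Φ (F j) x - A (F j) x‖ₑ := ((hΦ (hF j)).sub (hA (hF j))).measurable.enorm
        have m2 : Measurable fun x => ‖A (F j) x - A F' x‖ₑ := ((hA (hF j)).sub (hA hF')).measurable.enorm
        rw [lintegral_add_left (m1.fun_add m2), lintegral_add_left m1]
    _ ≤ ε / 3 + ε / 3 + ε / 3 := by
        refine add_le_add (add_le_add ?_ h2) ?_
        · exact (lintegral_enorm_sub_average_le (hF j) (hi (hF j) (hFK j)) hW hWR hW1).trans h1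
        · exact (lintegral_enorm_sub_average_le hF' (hi hF' hFK') hW hWR hW1).trans hj'
    _ ≤ ε := by
        rw [ENNReal.add_thirds]

end Compactness

/-! ### Strong convergence of time-integrated observables -/

section Observables

variable {X : Type*} [PseudoMetricSpace X] [SecondCountableTopology X] [MeasurableSpace X]
  [BorelSpace X] {lam : Measure X} [IsFiniteMeasure lam]
  {U : Type*} [NormedAddCommGroup U] [ProperSpace U] [MeasurableSpace U] [BorelSpace U]
  {τ : Measure ℝ} [IsFiniteMeasure τ]

/-- The weight becomes a density of the base measure, so lower semicontinuity under stable
convergence applies to the increment modulus. -/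
lemma lintegral_incrementModulus (q r : ℝ) {k : ℕ}
    (σ : Kernel (ℝ × (Fin (2 + k) → X)) (Fin (2 + k) → U)) [IsMarkovKernel σ] :
    ∫⁻ t, incrementModulus lam q r (fun w => σ (t, w)) ∂τ =
      ∫⁻ z, ∫⁻ ξ, incrementGrowth q ξ ∂(σ z) ∂((baseMeasure τ lam (2 + k)).withDensity
        fun z => ballWeight lam r (z.2 (Fin.castAdd k 0)) (z.2 (Fin.castAdd k 1))) := by
  have h1 : Measurable fun z : ℝ × (Fin (2 + k) → X) =>
      ballWeight lam r (z.2 (Fin.castAdd k 0)) (z.2 (Fin.castAdd k 1)) :=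
    (measurable_ballWeight_apply r _ _).comp measurable_snd
  have h2 : Measurable fun z => ∫⁻ ξ : Fin (2 + k) → U, incrementGrowth q ξ ∂(σ z) :=
    Measurable.lintegral_kernel measurable_incrementGrowth
  rw [lintegral_withDensity_eq_lintegral_mul _ h1 h2, baseMeasure,
    lintegral_prod _ (h1.mul h2).aemeasurable]
  rfl

/-- For a.e. time, consistency provides the couplings along the two halves of a doubled
configuration and along each `pairIndex i`. The estimate at fixed time is then integrated. -/
lemma IsConsistentFamily.lintegral_enorm_sub_le {κ : ∀ k : ℕ, Kernel (ℝ × (Fin k → X)) (Fin k → U)}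
    [∀ k, IsMarkovKernel (κ k)] (hκ : IsConsistentFamily τ lam κ) {q : ℝ} (hq : 1 ≤ q)
    {C C' c ε : ℝ≥0} {k : ℕ} {G : ℝ → (Fin (k + 1) → U) → ℝ} (hG : IsProfile q C G)
    (hL : IsLipschitzProfile q C' G)
    (hc : ∀ a b δ : ℝ, 0 ≤ a → 0 ≤ b → 0 ≤ δ → b ≤ a + δ →
      δ * max a b ^ (q - 1) ≤ ε * a ^ q + c * δ ^ q) (r : ℝ)
    (hA : ∫⁻ z, ∫⁻ ξ, growth q ξ ∂(κ (k + 1) z) ∂(baseMeasure τ lam (k + 1)) ≠ ∞) :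
    ∫⁻ t, ∫⁻ x, ∫⁻ y, prodWeight lam r x y *
        ‖∫ ξ, G t ξ ∂(κ (k + 1) (t, x)) - ∫ ξ, G t ξ ∂(κ (k + 1) (t, y))‖ₑ
        ∂(Measure.pi fun _ => lam) ∂(Measure.pi fun _ => lam) ∂τ ≤
      C' * ((k + 1 : ℕ) *
        (ε * ∫⁻ z, ∫⁻ ξ, growth q ξ ∂(κ (k + 1) z) ∂(baseMeasure τ lam (k + 1)) +
          c * ∫⁻ t, incrementModulus lam q r (fun w => κ (2 + k) (t, w)) ∂τ)) := by
  have m1 : Measurable fun z => ∫⁻ ξ, growth q ξ ∂(κ (k + 1) z) :=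
    measurable_growth.lintegral_kernel
  have m2 : Measurable fun t => incrementModulus lam q r (fun w => κ (2 + k) (t, w)) := by
    have h1 : Measurable fun z : ℝ × (Fin (2 + k) → X) =>
        ballWeight lam r (z.2 (Fin.castAdd k 0)) (z.2 (Fin.castAdd k 1)) :=
      (measurable_ballWeight_apply r _ _).comp measurable_snd
    have h2 : Measurable fun z => ∫⁻ ξ : Fin (2 + k) → U, incrementGrowth q ξ ∂(κ (2 + k) z) :=
      Measurable.lintegral_kernel measurable_incrementGrowth
    exact (h1.mul h2).lintegral_prod_right'
  have hA' := ae_ae_of_ae_base (ae_lintegral_growth_ne_top hA)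
  rw [baseMeasure, lintegral_prod _ m1.aemeasurable, ← lintegral_const_mul' _ _ (by simp),
    ← lintegral_const_mul' _ _ (by simp), ← lintegral_add_left (by
      exact m1.lintegral_prod_right'.const_mul _), ← lintegral_const_mul' _ _ (by simp),
    ← lintegral_const_mul' _ _ (by simp)]
  refine lintegral_mono_ae ?_
  filter_upwards [hA', ae_ae_of_ae_base (hκ.marginal (Fin.castAdd_injective (k + 1) (k + 1))),
    ae_ae_of_ae_base (hκ.marginal (Fin.natAdd_injective (k + 1) (k + 1))),
    ae_all_iff.2 fun i => ae_ae_of_ae_base (hκ.marginal (pairIndex_injective (k := k) i))]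
    with t hA h0 h1 h2
  have hm (n : ℕ) : Measurable (Prod.mk t : (Fin n → X) → ℝ × (Fin n → X)) :=
    measurable_prodMk_left
  exact lintegral_prodWeight_enorm_sub_le hq hG hL hc t r
    (ρ := (κ (k + 1)).comap (Prod.mk t) (hm _))
    (ρ₂ := fun w => κ ((k + 1) + (k + 1)) (t, w))
    (σ := (κ (2 + k)).comap (Prod.mk t) (hm _)) h0 h1 h2 hA

variable [NormedSpace ℝ U]

/-- Strong convergence of the time integrals of an observable, from weak convergence of the
correlation measures, uniform integrability and uniform continuity in the mean. -/
theorem StableTendsto.tendsto_lintegral_enorm_observable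
    {κ : ℕ → ∀ k : ℕ, Kernel (ℝ × (Fin k → X)) (Fin k → U)}
    {κ' : ∀ k : ℕ, Kernel (ℝ × (Fin k → X)) (Fin k → U)}
    [∀ j k, IsMarkovKernel (κ j k)] [∀ k, IsMarkovKernel (κ' k)]
    (h : ∀ k, StableTendsto (baseMeasure τ lam k) (fun j => κ j k) (κ' k))
    (hκ : ∀ j, IsConsistentFamily τ lam (κ j)) (hκ' : IsConsistentFamily τ lam κ')
    {q : ℝ} (hq : 1 ≤ q) {C C' K : ℝ≥0} {k : ℕ} {G : ℝ → (Fin (k + 1) → U) → ℝ}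
    (hG : IsProfile q C G) (hL : IsLipschitzProfile q C' G)
    (hmom : ∀ j, ∫⁻ z, ∫⁻ ξ, growth q ξ ∂(κ j (k + 1) z) ∂(baseMeasure τ lam (k + 1)) ≤ K)
    (hmod : ∀ ε : ℝ≥0∞, 0 < ε → ∃ r : ℝ, 0 < r ∧ ∀ᶠ j in atTop,
      ∫⁻ t, incrementModulus lam q r (fun w => κ j (2 + k) (t, w)) ∂τ ≤ ε)
    (htail : ∀ ε : ℝ≥0∞, 0 < ε → ∃ i, ∀ᶠ j in atTop,
      tailMass q i (baseMeasure τ lam (k + 1)) (κ j (k + 1)) ≤ ε)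
    (hball : ∀ r : ℝ, 0 < r → ∃ b : ℝ≥0∞, b ≠ 0 ∧ ∀ᵐ x ∂lam, b ≤ lam (Metric.ball x r)) :
    ∫⁻ z, ∫⁻ ξ, growth q ξ ∂(κ' (k + 1) z) ∂(baseMeasure τ lam (k + 1)) ≤ K ∧
    Tendsto (fun j => ∫⁻ x, ‖∫ t, ∫ ξ, G t ξ ∂(κ j (k + 1) (t, x)) ∂τ -
      ∫ t, ∫ ξ, G t ξ ∂(κ' (k + 1) (t, x)) ∂τ‖ₑ ∂(Measure.pi fun _ => lam)) atTop (𝓝 0) := by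
  have hq0 : 0 ≤ q := by linarith
  have : SecondCountableTopology U := secondCountable_of_proper
  -- the bounds for the limit
  have hmom' : ∫⁻ z, ∫⁻ ξ, growth q ξ ∂(κ' (k + 1) z) ∂(baseMeasure τ lam (k + 1)) ≤ K := by
    simp only [← coe_nngrowth hq0] at hmom ⊢
    exact ((h (k + 1)).lintegral_le_liminf Measure.AbsolutelyContinuous.rfl
      (continuous_nngrowth hq0)).trans
      (liminf_le_of_frequently_le' (Frequently.of_forall hmom))
  have hmod' {ε : ℝ≥0∞} {r : ℝ} (hr : ∀ᶠ j in atTop,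
      ∫⁻ t, incrementModulus lam q r (fun w => κ j (2 + k) (t, w)) ∂τ ≤ ε) :
      ∫⁻ t, incrementModulus lam q r (fun w => κ' (2 + k) (t, w)) ∂τ ≤ ε := by
    let f : (Fin (2 + k) → U) → ℝ≥0 := fun ξ =>
      ‖ξ (Fin.castAdd k 0) - ξ (Fin.castAdd k 1)‖₊ ^ q * nngrowth q (ξ ∘ Fin.natAdd 2)
    have hf : Continuous f := by
      refine Continuous.mul ?_ ((continuous_nngrowth hq0).comp
        (continuous_pi fun i => continuous_apply _))
      have := NNReal.continuous_rpow_const hq0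
      fun_prop
    have hfe (ξ : Fin (2 + k) → U) : incrementGrowth q ξ = f ξ := by
      simp only [f, incrementGrowth, ENNReal.coe_mul, coe_nngrowth hq0, coe_nnnorm_rpow hq0]
    simp only [lintegral_incrementModulus, hfe] at hr ⊢
    exact ((h (2 + k)).lintegral_le_liminf (withDensity_absolutelyContinuous _ _) hf).trans
      (liminf_le_of_frequently_le' hr.frequently)
  have htail' {ε : ℝ≥0∞} {i : ℕ} (hi : ∀ᶠ j in atTop,
      tailMass q i (baseMeasure τ lam (k + 1)) (κ j (k + 1)) ≤ ε) :
      tailMass q i (baseMeasure τ lam (k + 1)) (κ' (k + 1)) ≤ ε := by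
    simp only [tailMass, ← coe_nngrowth hq0, ← ENNReal.coe_mul] at hi ⊢
    refine ((h (k + 1)).lintegral_le_liminf Measure.AbsolutelyContinuous.rfl
      (f := fun ξ => (1 - tent i ξ) * nngrowth q ξ) ?_).trans
      (liminf_le_of_frequently_le' hi.frequently)
    exact (continuous_const.sub (continuous_tent i)).mul (continuous_nngrowth hq0)
  refine ⟨hmom', ?_⟩
  have hb {η : Kernel (ℝ × (Fin (k + 1) → X)) (Fin (k + 1) → U)}
      (hη : ∫⁻ z, ∫⁻ ξ, growth q ξ ∂(η z) ∂(baseMeasure τ lam (k + 1)) ≤ K) :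
      ∫⁻ z, ‖∫ ξ, G z.1 ξ ∂(η z)‖ₑ ∂(baseMeasure τ lam (k + 1)) ≤ (C * K : ℝ≥0) := by
    refine (lintegral_mono fun z => hG.enorm_integral_le (η z) z.1).trans ?_
    rw [lintegral_const_mul' _ _ ENNReal.coe_ne_top, ENNReal.coe_mul]
    exact mul_le_mul_right hη _
  refine tendsto_lintegral_enorm_integral_sub (S := ℝ) (Y := Fin (k + 1) → X)
    (F := fun j z => ∫ ξ, G z.1 ξ ∂(κ j (k + 1) z)) (F' := fun z => ∫ ξ, G z.1 ξ ∂(κ' (k + 1) z))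
    (fun j => hG.stronglyMeasurable_integral _) (hG.stronglyMeasurable_integral _)
    (fun j => hb (hmom j)) (hb hmom') fun ε hε => ?_
  have hε2 : ε / 2 ≠ 0 := (ENNReal.half_pos hε.ne').ne'
  -- The order matters: ε₀ absorbs the moment bound K, the constant c depends on ε₀, and the scale r
  -- is chosen last, so that the modulus beats c.
  obtain ⟨ε₀, hε₀, h1⟩ := ENNReal.exists_nnreal_pos_mul_lt
    (a := C' * ((k + 1 : ℕ) * K)) (by finiteness) hε2
  obtain ⟨c, hc⟩ := exists_mul_max_rpow_le hq (ε := ε₀) (by exact_mod_cast hε₀)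
  obtain ⟨ε₁, hε₁, h2⟩ := ENNReal.exists_nnreal_pos_mul_lt
    (a := C' * ((k + 1 : ℕ) * c)) (by finiteness) hε2
  obtain ⟨r, hr, hrj⟩ := hmod ε₁ (by exact_mod_cast hε₁)
  obtain ⟨b, hb0, hb⟩ := hball r hr
  -- This power bounds the product weight at a.e. centre. The minimum in `W` makes the bound hold
  -- everywhere and does not change the weight at a.e. centre.
  let R : ℝ≥0 := (b⁻¹).toNNReal ^ (k + 1)
  let W : (Fin (k + 1) → X) × (Fin (k + 1) → X) → ℝ≥0∞ := fun p =>
    min (prodWeight lam r p.1 p.2) R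
  have hae : ∀ᵐ x ∂(Measure.pi fun _ : Fin (k + 1) => lam),
      ∀ i, b ≤ lam (Metric.ball (x i) r) ∧ lam (Metric.ball (x i) r) ≠ 0 := by
    refine ae_all_iff.2 fun i => ?_
    refine (Measure.tendsto_eval_ae_ae (μ := fun _ : Fin (k + 1) => lam) (i := i)).eventually
      (p := fun v => b ≤ lam (Metric.ball v r) ∧ lam (Metric.ball v r) ≠ 0) ?_
    filter_upwards [hb] with x hx using ⟨hx, fun h0 => hb0 (le_antisymm (h0 ▸ hx) zero_le)⟩
  have hWle (p) : W p ≤ prodWeight lam r p.1 p.2 := min_le_left _ _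
  have hbound {η : ∀ n : ℕ, Kernel (ℝ × (Fin n → X)) (Fin n → U)} [∀ n, IsMarkovKernel (η n)]
      (hη : IsConsistentFamily τ lam η)
      (hmom : ∫⁻ z, ∫⁻ ξ, growth q ξ ∂(η (k + 1) z) ∂(baseMeasure τ lam (k + 1)) ≤ K)
      (hmod : ∫⁻ t, incrementModulus lam q r (fun w => η (2 + k) (t, w)) ∂τ ≤ ε₁) :
      ∫⁻ t, ∫⁻ x, ∫⁻ y, W (x, y) *
        ‖∫ ξ, G t ξ ∂(η (k + 1) (t, x)) - ∫ ξ, G t ξ ∂(η (k + 1) (t, y))‖ₑ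
        ∂(Measure.pi fun _ => lam) ∂(Measure.pi fun _ => lam) ∂τ ≤ ε := by
    calc _ ≤ ∫⁻ t, ∫⁻ x, ∫⁻ y, prodWeight lam r x y *
          ‖∫ ξ, G t ξ ∂(η (k + 1) (t, x)) - ∫ ξ, G t ξ ∂(η (k + 1) (t, y))‖ₑ
          ∂(Measure.pi fun _ => lam) ∂(Measure.pi fun _ => lam) ∂τ :=
          lintegral_mono fun t => lintegral_mono fun x => lintegral_mono fun y =>
            mul_le_mul_left (hWle (x, y)) _
      _ ≤ C' * ((k + 1 : ℕ) * (ε₀ * K + c * ε₁)) := by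
          refine (hη.lintegral_enorm_sub_le hq hG hL hc r
            (ne_top_of_le_ne_top ENNReal.coe_ne_top hmom)).trans ?_
          gcongr
      _ = ε₀ * (C' * ((k + 1 : ℕ) * K)) + ε₁ * (C' * ((k + 1 : ℕ) * c)) := by ring
      _ ≤ ε / 2 + ε / 2 := add_le_add h1.le h2.le
      _ = ε := ENNReal.add_halves ε
  refine ⟨W, R, (measurable_prodWeight r).min measurable_const, fun p => min_le_right _ _, ?_,
    fun x => ?_, ?_, hbound hκ' hmom' (hmod' hrj)⟩
  · filter_upwards [hae] with x hx
    have hle (y : Fin (k + 1) → X) : prodWeight lam r x y ≤ R := by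
      have hbi : b⁻¹ ≠ ∞ := ENNReal.inv_ne_top.2 hb0
      simp only [R, ENNReal.coe_pow, ENNReal.coe_toNNReal hbi, prodWeight]
      calc ∏ i, ballWeight lam r (x i) (y i) ≤ ∏ _i : Fin (k + 1), b⁻¹ := by
            refine Finset.prod_le_prod' fun i _ => ?_
            exact (indicator_le_self _ _ _).trans (ENNReal.inv_le_inv.2 (hx i).1)
        _ = _ := by simp
    have e (y : Fin (k + 1) → X) : W (x, y) = prodWeight lam r x y := min_eq_left (hle y)
    simp only [e, prodWeight]
    rw [lintegral_prod_pi fun i => measurable_ballWeight_right r (x i)]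
    exact Finset.prod_eq_one fun i _ =>
      lintegral_ballWeight_right_eq lam (hx i).2 (measure_ne_top _ _)
  · have : IsFiniteMeasure (baseMeasure τ lam (k + 1)) := by
      unfold baseMeasure; infer_instance
    refine (h (k + 1)).tendsto_integral_profile hq0 hG
      (w := fun z : ℝ × (Fin (k + 1) → X) => (W (x, z.2)).toReal) (R := R) ?_ ?_ ?_ ?_ ?_
    · exact fun j => ne_top_of_le_ne_top ENNReal.coe_ne_top (hmom j)
    · exact ne_top_of_le_ne_top ENNReal.coe_ne_top hmom'
    · intro ε hε
      obtain ⟨i, hi⟩ := htail ε hε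
      exact ⟨i, htail' hi, hi⟩
    · exact (((measurable_prodWeight r).min measurable_const).comp
        (measurable_const.prodMk measurable_snd)).ennreal_toReal
    · intro z
      rw [← ofReal_norm, Real.norm_of_nonneg ENNReal.toReal_nonneg]
      exact ENNReal.ofReal_toReal_le.trans (min_le_right _ _)
  · filter_upwards [hrj] with j hj using hbound (hκ j) (hmom j) hj

end Observables

/-! ### Uniform integrability from decoupling -/

section HeadIndex

/-- The enumeration of a configuration which starts with a given point. -/
def headIndex {k : ℕ} (i : Fin (k + 1)) : Fin (1 + k) → Fin (k + 1) :=
  Fin.append (fun _ => i) i.succAbove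

lemma headIndex_injective {k : ℕ} (i : Fin (k + 1)) : Function.Injective (headIndex i) :=
  Fin.append_injective_iff.2 ⟨fun _ _ _ => Subsingleton.elim _ _, Fin.succAbove_right_injective,
    fun _ j => (Fin.succAbove_ne i j).symm⟩

lemma measurePreserving_comp_headIndex {X : Type*} [MeasurableSpace X] {lam : Measure X}
    [SigmaFinite lam] {k : ℕ} (i : Fin (k + 1)) :
    MeasurePreserving (fun x : Fin (k + 1) → X => x ∘ headIndex i)
      (Measure.pi fun _ => lam) (Measure.pi fun _ => lam) := by
  have hb : Function.Bijective (headIndex i) :=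
    (Fintype.bijective_iff_injective_and_card _).2 ⟨headIndex_injective i, by simp [add_comm]⟩
  exact (measurePreserving_piCongrLeft (fun _ : Fin (k + 1) => lam)
    (Equiv.ofBijective _ hb)).symm

end HeadIndex

/-! ### Weights of large states and equi-integrability -/

section Tail

variable {U : Type*} [NormedAddCommGroup U]

/-- The weight of large values of a single state. -/
noncomputable def tailWeight (i : ℕ) (s : ℝ≥0) : ℝ≥0 := min 1 (s / (i + 1))

lemma continuous_tailWeight (i : ℕ) : Continuous (tailWeight i) := by
  unfold tailWeight; fun_prop

/-- The left side is the tail weight of the maximum norm, which is attained at one of the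
coordinates. -/
lemma one_sub_tent_le {n : ℕ} (i : ℕ) (ξ : Fin n → U) :
    1 - tent i ξ ≤ ∑ l, tailWeight i ‖ξ l‖₊ := by
  have e : Real.toNNReal (‖ξ‖ / (i + 1)) = ‖ξ‖₊ / (i + 1) := by
    rw [Real.toNNReal_div (norm_nonneg _), norm_toNNReal]
    congr 1
    rw [Real.toNNReal_add (by positivity) (by positivity)]
    simp
  rw [tent, e]
  have h1 : 1 - (1 - ‖ξ‖₊ / ((i : ℝ≥0) + 1)) ≤ tailWeight i ‖ξ‖₊ :=
    le_min tsub_le_self tsub_tsub_le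
  refine h1.trans ?_
  rcases isEmpty_or_nonempty (Fin n) with h | h
  · have : ξ = 0 := Subsingleton.elim _ _
    simp [this, tailWeight]
  · obtain ⟨l, -, hl⟩ := Finset.exists_mem_eq_sup (Finset.univ : Finset (Fin n))
      Finset.univ_nonempty fun l => ‖ξ l‖₊
    rw [show ‖ξ‖₊ = ‖ξ l‖₊ by rw [Pi.nnnorm_def, hl]]
    exact Finset.single_le_sum (f := fun l => tailWeight i ‖ξ l‖₊) (fun _ _ => zero_le)
      (Finset.mem_univ l)

/-- This is the core of the equi-integrability, with s the size of a state, u an increment and v the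
size of the neighbouring state. For s ≤ L the weight is at most L/(i+1). For s > L either u ≥ s/2,
or v ≥ s/2 > L/2, in which case 1 ≤ L⁻¹·2^q·v^q. -/
lemma tailWeight_mul_le {q : ℝ} (hq : 1 ≤ q) (i : ℕ) {L : ℝ≥0} (hL : 1 ≤ L) {s u v : ℝ≥0}
    (hs : s ≤ u + v) :
    tailWeight i s * (1 + s ^ q) ≤ (1 + L ^ q) * L * ((i : ℝ≥0) + 1)⁻¹ +
      2 * 2 ^ q * (u ^ q + L⁻¹ * (s ^ q * v ^ q)) := by
  have hq0 : 0 ≤ q := by linarith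
  rcases le_or_gt s L with h | h
  · refine le_trans ?_ (le_add_of_nonneg_right zero_le)
    calc tailWeight i s * (1 + s ^ q) ≤ (L / (i + 1)) * (1 + L ^ q) := by
          gcongr
          exact (min_le_right _ _).trans (by gcongr)
      _ = _ := by rw [div_eq_mul_inv]; ring
  · refine le_trans ?_ (le_add_of_nonneg_left zero_le)
    have h1 : 1 ≤ s ^ q := NNReal.one_le_rpow (hL.trans h.le) hq0
    have h2 : tailWeight i s * (1 + s ^ q) ≤ 2 * s ^ q := by
      calc tailWeight i s * (1 + s ^ q) ≤ 1 * (s ^ q + s ^ q) := by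
            gcongr
            exact min_le_left _ _
        _ = _ := by ring
    refine h2.trans ?_
    rw [mul_assoc]
    refine mul_le_mul_right ?_ _
    rcases le_total v u with hvu | hvu
    · calc s ^ q ≤ (2 * u) ^ q := by
            refine NNReal.rpow_le_rpow (hs.trans ?_) hq0
            rw [two_mul]; gcongr
        _ = 2 ^ q * u ^ q := NNReal.mul_rpow
        _ ≤ _ := by gcongr; exact le_add_of_nonneg_right zero_le
    · have h3 : L ≤ 2 * v := h.le.trans (hs.trans (by rw [two_mul]; gcongr))
      have h4 : L ≤ 2 ^ q * v ^ q := by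
        rw [← NNReal.mul_rpow]
        calc L = L ^ (1 : ℝ) := (NNReal.rpow_one L).symm
          _ ≤ L ^ q := NNReal.rpow_le_rpow_of_exponent_le hL hq
          _ ≤ _ := NNReal.rpow_le_rpow h3 hq0
      have hL0 : L ≠ 0 := (one_pos.trans_le hL).ne'
      calc s ^ q = L⁻¹ * L * s ^ q := by rw [inv_mul_cancel₀ hL0, one_mul]
        _ ≤ L⁻¹ * (2 ^ q * v ^ q) * s ^ q := by gcongr
        _ = 2 ^ q * (L⁻¹ * (s ^ q * v ^ q)) := by ring
        _ ≤ _ := by gcongr; exact le_add_of_nonneg_left zero_le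

end Tail

section Slice

variable {X : Type*} [PseudoMetricSpace X] [SecondCountableTopology X] [MeasurableSpace X]
  [BorelSpace X] {lam : Measure X} [IsFiniteMeasure lam]
  {U : Type*} [NormedAddCommGroup U] [ProperSpace U] [MeasurableSpace U] [BorelSpace U]

/-- A second point, averaged over the ball of radius r, is inserted next to the first. The increment
produces the modulus. The product of the two states is bounded by the two-point growth, and the ball
average costs at most b⁻¹ there, which a large L compensates. -/
lemma lintegral_tailWeight_le {q r : ℝ} (hq : 1 ≤ q) (i : ℕ) {L : ℝ≥0} (hL : 1 ≤ L)
    {ρ₁ : Kernel (Fin 1 → X) (Fin 1 → U)} {ρ₂ : Kernel (Fin 2 → X) (Fin 2 → U)}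
    [IsMarkovKernel ρ₁] [IsMarkovKernel ρ₂]
    (h : ∀ᵐ w ∂(Measure.pi fun _ => lam), ρ₁ (w ∘ ![0]) = (ρ₂ w).map (· ∘ ![0]))
    {b : ℝ≥0∞} (hb0 : b ≠ 0) (hb : ∀ᵐ x ∂lam, b ≤ lam (Metric.ball x r)) :
    ∫⁻ x, ∫⁻ ξ, ((tailWeight i ‖ξ 0‖₊ * (1 + ‖ξ 0‖₊ ^ q) : ℝ≥0) : ℝ≥0∞) ∂(ρ₁ x)
        ∂(Measure.pi fun _ => lam) ≤
      ((1 + L ^ q) * L * ((i : ℝ≥0) + 1)⁻¹ : ℝ≥0) * lam univ +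
        (2 * 2 ^ q : ℝ≥0) * (kModulus lam q r ρ₂ + (L⁻¹ : ℝ≥0) * (b⁻¹ *
          ∫⁻ w, ∫⁻ ξ, growth q ξ ∂(ρ₂ w) ∂(Measure.pi fun _ => lam))) := by
  have hq0 : 0 ≤ q := by linarith
  have : SecondCountableTopology U := secondCountable_of_proper
  let H : U → ℝ≥0∞ := fun v => ((tailWeight i ‖v‖₊ * (1 + ‖v‖₊ ^ q) : ℝ≥0) : ℝ≥0∞)
  have hH : Measurable H := by
    have := NNReal.continuous_rpow_const hq0
    have h2 := continuous_tailWeight i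
    exact (by fun_prop : Continuous fun v : U =>
      tailWeight i ‖v‖₊ * (1 + ‖v‖₊ ^ q)).measurable.coe_nnreal_ennreal
  have hH1 : Measurable fun ξ : Fin 1 → U => H (ξ 0) := hH.comp (measurable_pi_apply 0)
  have m1 : Measurable fun x => ∫⁻ ξ, H (ξ 0) ∂(ρ₁ x) := hH1.lintegral_kernel
  have m2 : Measurable fun w => ∫⁻ ξ, ‖ξ 0 - ξ 1‖ₑ ^ q ∂(ρ₂ w) :=
    Measurable.lintegral_kernel (by fun_prop)
  have m3 : Measurable fun w => ∫⁻ ξ, growth q ξ ∂(ρ₂ w) := measurable_growth.lintegral_kernel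
  have mb : Measurable fun w : Fin 2 → X => ballWeight lam r (w 0) (w 1) :=
    measurable_ballWeight_apply r 0 1
  set a : ℝ≥0 := (1 + L ^ q) * L * ((i : ℝ≥0) + 1)⁻¹
  set e : ℝ≥0 := 2 * 2 ^ q
  have hpt (ξ : Fin 2 → U) : H (ξ 0) ≤
      a + e * (‖ξ 0 - ξ 1‖ₑ ^ q + (L⁻¹ : ℝ≥0) * growth q ξ) := by
    have hs : ‖ξ 0‖₊ ≤ ‖ξ 0 - ξ 1‖₊ + ‖ξ 1‖₊ := by
      simpa using nnnorm_add_le (ξ 0 - ξ 1) (ξ 1)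
    have h1 := tailWeight_mul_le hq i hL hs
    have h2 : ‖ξ 0‖₊ ^ q * ‖ξ 1‖₊ ^ q ≤ nngrowth q ξ := by
      rw [nngrowth, Fin.prod_univ_two]
      gcongr <;> exact le_add_of_nonneg_left zero_le
    rw [← coe_nngrowth hq0, ← coe_nnnorm_rpow hq0]
    have h3 : tailWeight i ‖ξ 0‖₊ * (1 + ‖ξ 0‖₊ ^ q) ≤
        a + e * (‖ξ 0 - ξ 1‖₊ ^ q + L⁻¹ * nngrowth q ξ) := h1.trans (by gcongr)
    have h4 := ENNReal.coe_le_coe.2 h3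
    push_cast at h4
    simpa only [H, ENNReal.coe_mul, ENNReal.coe_add, ENNReal.coe_one] using h4
  have hball1 : ∀ᵐ x ∂lam, ∫⁻ y, ballWeight lam r x y ∂lam = 1 := by
    filter_upwards [hb] with x hx
    exact lintegral_ballWeight_right_eq lam (fun h0 => hb0 (le_antisymm (h0 ▸ hx) zero_le))
      (measure_ne_top _ _)
  have hbW : ∀ᵐ w ∂(Measure.pi fun _ : Fin 2 => lam), ballWeight lam r (w 0) (w 1) ≤ b⁻¹ := by
    filter_upwards [(Measure.tendsto_eval_ae_ae (μ := fun _ : Fin 2 => lam) (i := 0)).eventually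
      (p := fun v => b ≤ lam (Metric.ball v r)) hb] with w hw
    exact (indicator_le_self _ _ _).trans (ENNReal.inv_le_inv.2 hw)
  have hone : ∫⁻ w, ballWeight lam r (w 0) (w 1) ∂(Measure.pi fun _ : Fin 2 => lam) ≤
      lam univ := by
    rw [lintegral_pi_fin_two mb]
    refine (lintegral_mono fun x => lintegral_ballWeight_right_le lam r x).trans ?_
    rw [lintegral_const, one_mul]
  calc ∫⁻ x, ∫⁻ ξ, H (ξ 0) ∂(ρ₁ x) ∂(Measure.pi fun _ => lam)
      = ∫⁻ w, ballWeight lam r (w 0) (w 1) * ∫⁻ ξ, H (ξ 0) ∂(ρ₁ (w ∘ ![0]))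
          ∂(Measure.pi fun _ : Fin 2 => lam) := by
        rw [lintegral_pi_fin_one m1, lintegral_pi_fin_two (f := fun w =>
          ballWeight lam r (w 0) (w 1) * ∫⁻ ξ, H (ξ 0) ∂(ρ₁ (w ∘ ![0])))
          (mb.mul (m1.comp (measurable_comp_index _)))]
        refine lintegral_congr_ae ?_
        filter_upwards [hball1] with x hx
        have e0 (y : X) : ![x, y] ∘ ![(0 : Fin 2)] = ![x] := by
          ext i; fin_cases i; rfl
        simp only [e0, Matrix.cons_val_zero, Matrix.cons_val_one]
        rw [lintegral_mul_const _ (measurable_ballWeight_right r x), hx, one_mul]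
    _ ≤ ∫⁻ w, (a * ballWeight lam r (w 0) (w 1) +
          e * (ballWeight lam r (w 0) (w 1) * ∫⁻ ξ, ‖ξ 0 - ξ 1‖ₑ ^ q ∂(ρ₂ w) +
            (L⁻¹ : ℝ≥0) * (b⁻¹ * ∫⁻ ξ, growth q ξ ∂(ρ₂ w)))) ∂(Measure.pi fun _ => lam) := by
        refine lintegral_mono_ae ?_
        filter_upwards [h, hbW] with w hw hbw
        rw [hw, lintegral_map hH1 (measurable_comp_index _)]
        calc _ ≤ ballWeight lam r (w 0) (w 1) * ∫⁻ ξ, (a + e * (‖ξ 0 - ξ 1‖ₑ ^ q +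
              (L⁻¹ : ℝ≥0) * growth q ξ)) ∂(ρ₂ w) := by
              gcongr with ξ; exact hpt ξ
          _ = ballWeight lam r (w 0) (w 1) * (a + e * (∫⁻ ξ, ‖ξ 0 - ξ 1‖ₑ ^ q ∂(ρ₂ w) +
              (L⁻¹ : ℝ≥0) * ∫⁻ ξ, growth q ξ ∂(ρ₂ w))) := by
              rw [lintegral_add_left measurable_const, lintegral_const, measure_univ, mul_one,
                lintegral_const_mul' _ _ ENNReal.coe_ne_top, lintegral_add_left (by fun_prop),
                lintegral_const_mul' _ _ ENNReal.coe_ne_top]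
          _ = a * ballWeight lam r (w 0) (w 1) + e * (ballWeight lam r (w 0) (w 1) *
              ∫⁻ ξ, ‖ξ 0 - ξ 1‖ₑ ^ q ∂(ρ₂ w) + (L⁻¹ : ℝ≥0) *
                (ballWeight lam r (w 0) (w 1) * ∫⁻ ξ, growth q ξ ∂(ρ₂ w))) := by ring
          _ ≤ _ := by gcongr
    _ ≤ _ := by
        have hbt : b⁻¹ ≠ ∞ := ENNReal.inv_ne_top.2 hb0
        rw [lintegral_add_left (mb.const_mul _), lintegral_const_mul' _ _ ENNReal.coe_ne_top,
          lintegral_const_mul' _ _ ENNReal.coe_ne_top, lintegral_add_left (mb.fun_mul m2),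
          lintegral_const_mul' _ _ ENNReal.coe_ne_top, lintegral_const_mul' _ _ hbt]
        gcongr
        exact le_rfl

variable {p : ℝ≥0∞} [Fact (1 ≤ p)]

/-- The i-th point is moved to the front by a reordering that preserves the product measure. The
other k points are then decoupled. -/
lemma lintegral_head_mul_growth_le (hp : p ≠ ∞) {k : ℕ} (i : Fin (k + 1))
    {ρ₁ : Kernel (Fin 1 → X) (Fin 1 → U)} {ρ : Kernel (Fin (1 + k) → X) (Fin (1 + k) → U)}
    {ρ' : Kernel (Fin (k + 1) → X) (Fin (k + 1) → U)}
    [IsMarkovKernel ρ₁] [IsMarkovKernel ρ] [IsMarkovKernel ρ']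
    {μ : @Measure (Lp U p lam) (borel _)} (hμ : @IsProbabilityMeasure _ (borel _) μ)
    (h : IsDualAt lam p (1 + k) ρ μ) (h₁ : IsDualAt lam p 1 ρ₁ μ) {M : ℝ≥0}
    (hM : ∀ᵐ u ∂μ, ‖u‖ ≤ M)
    (hρ : ∀ᵐ w ∂(Measure.pi fun _ => lam),
      ρ (w ∘ headIndex i) = (ρ' w).map (· ∘ headIndex i))
    {H : U → ℝ≥0} (hH : Continuous H) :
    ∫⁻ x, ∫⁻ ξ, H (ξ i) * growth p.toReal (ξ ∘ i.succAbove) ∂(ρ' x) ∂(Measure.pi fun _ => lam) ≤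
      (lam univ + (M : ℝ≥0∞) ^ p.toReal) ^ k *
        ∫⁻ x, ∫⁻ ξ, H (ξ 0) ∂(ρ₁ x) ∂(Measure.pi fun _ => lam) := by
  have : SecondCountableTopology U := secondCountable_of_proper
  have hd := h.lintegral_decoupled_le hp hμ h₁ hM (w := fun _ => 1) measurable_const
    (H := fun ξ => H (ξ 0)) (hH.comp (continuous_apply 0))
  simp only [one_mul] at hd
  refine le_trans (le_of_eq ?_) hd
  let f : (Fin (1 + k) → U) → ℝ≥0∞ := fun ξ => H ((ξ ∘ Fin.castAdd k) 0) *
    ∏ j, (1 + ‖ξ (Fin.natAdd 1 j)‖ₑ ^ p.toReal)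
  have hf : Measurable f := by
    refine Measurable.mul ?_ (by fun_prop)
    exact (hH.measurable.comp (measurable_pi_apply (Fin.castAdd k 0))).coe_nnreal_ennreal
  have hmp := measurePreserving_comp_headIndex (lam := lam) i
  have e1 : ∫⁻ w, ∫⁻ ξ, f ξ ∂(ρ w) ∂(Measure.pi fun _ => lam) =
      ∫⁻ x, ∫⁻ ξ, f ξ ∂(ρ (x ∘ headIndex i)) ∂(Measure.pi fun _ => lam) := by
    conv_lhs => rw [← hmp.map_eq]
    exact lintegral_map hf.lintegral_kernel hmp.measurable
  rw [e1]
  refine lintegral_congr_ae ?_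
  filter_upwards [hρ] with x hx
  rw [hx, lintegral_map hf (measurable_comp_index _)]
  refine lintegral_congr fun ξ => ?_
  simp only [f, growth, headIndex, Function.comp_apply, Fin.append_left, Fin.append_right]

/-- Decoupling keeps the first two points, with the ball weight and their increment, and integrates
out the other k. -/
lemma IsDualAt.incrementModulus_le (hp : p ≠ ∞) {k : ℕ}
    {ρ₂ : Kernel (Fin 2 → X) (Fin 2 → U)} {ρ : Kernel (Fin (2 + k) → X) (Fin (2 + k) → U)}
    [IsMarkovKernel ρ₂] [IsMarkovKernel ρ]
    {μ : @Measure (Lp U p lam) (borel _)} (hμ : @IsProbabilityMeasure _ (borel _) μ)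
    (h : IsDualAt lam p (2 + k) ρ μ) (h₂ : IsDualAt lam p 2 ρ₂ μ) {M : ℝ≥0}
    (hM : ∀ᵐ u ∂μ, ‖u‖ ≤ M) (r : ℝ) :
    incrementModulus lam p.toReal r ρ ≤
      (lam univ + (M : ℝ≥0∞) ^ p.toReal) ^ k * kModulus lam p.toReal r ρ₂ := by
  have hq : 0 ≤ p.toReal := ENNReal.toReal_nonneg
  have := NNReal.continuous_rpow_const hq
  have hd := h.lintegral_decoupled_le hp hμ h₂ hM
    (w := fun w => ballWeight lam r (w 0) (w 1)) (measurable_ballWeight_apply r 0 1)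
    (H := fun ξ => ‖ξ 0 - ξ 1‖₊ ^ p.toReal) (by fun_prop)
  simp only [coe_nnnorm_rpow hq] at hd
  exact hd

end Slice

/-! ### Time-dependent families with dual measures -/

section TimeDependent

variable {X : Type*} [PseudoMetricSpace X] [SecondCountableTopology X] [MeasurableSpace X]
  [BorelSpace X] {lam : Measure X} [IsFiniteMeasure lam]
  {U : Type*} [NormedAddCommGroup U] [ProperSpace U] [MeasurableSpace U] [BorelSpace U]
  {p : ℝ≥0∞} [Fact (1 ≤ p)] {τ : Measure ℝ} [IsFiniteMeasure τ]

/-- A time-dependent family of kernels which is dual to a family of probability measures on a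
ball of `L^p`. -/
def HasBoundedDual (τ : Measure ℝ) (lam : Measure X) (p : ℝ≥0∞) [Fact (1 ≤ p)] (M : ℝ≥0)
    (κ : ∀ k : ℕ, Kernel (ℝ × (Fin k → X)) (Fin k → U)) : Prop :=
  ∀ᵐ t ∂τ, ∃ μ : @Measure (Lp U p lam) (borel _), @IsProbabilityMeasure _ (borel _) μ ∧
    (∀ᵐ u ∂μ, ‖u‖ ≤ M) ∧ ∀ l, 1 ≤ l → IsDualAt lam p l (fun x => κ l (t, x)) μ

variable {κ : ∀ k : ℕ, Kernel (ℝ × (Fin k → X)) (Fin k → U)} [∀ k, IsMarkovKernel (κ k)] {M : ℝ≥0}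

lemma HasBoundedDual.ae_lintegral_le (hd : HasBoundedDual τ lam p M κ) (hp : p ≠ ∞)
    (hκ : IsConsistentFamily τ lam κ) {k : ℕ} (i : Fin (k + 1)) {H : U → ℝ≥0}
    (hH : Continuous H) :
    ∀ᵐ t ∂τ, ∫⁻ x, ∫⁻ ξ, H (ξ i) * growth p.toReal (ξ ∘ i.succAbove) ∂(κ (k + 1) (t, x))
        ∂(Measure.pi fun _ => lam) ≤
      (lam univ + (M : ℝ≥0∞) ^ p.toReal) ^ k *
        ∫⁻ x, ∫⁻ ξ, H (ξ 0) ∂(κ 1 (t, x)) ∂(Measure.pi fun _ => lam) := by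
  filter_upwards [hd, ae_ae_of_ae_base (hκ.marginal (headIndex_injective i))]
    with t ⟨μ, hμ, hM, hdual⟩ hm
  have hc (n : ℕ) : Measurable (Prod.mk t : (Fin n → X) → ℝ × (Fin n → X)) :=
    measurable_prodMk_left
  exact lintegral_head_mul_growth_le hp i (ρ₁ := (κ 1).comap (Prod.mk t) (hc _))
    (ρ := (κ (1 + k)).comap (Prod.mk t) (hc _)) (ρ' := (κ (k + 1)).comap (Prod.mk t) (hc _))
    hμ (hdual _ (by omega)) (hdual _ le_rfl) hM hm hH

/-- One point is kept and integrated with the moment bound. The other k points are decoupled. -/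
lemma HasBoundedDual.lintegral_growth_le (hd : HasBoundedDual τ lam p M κ) (hp : p ≠ ∞)
    (hκ : IsConsistentFamily τ lam κ) {C : ℝ≥0∞}
    (hC : ∀ᵐ t ∂τ, kMoment lam p.toReal (fun x => κ 1 (t, x)) ≤ C) (k : ℕ) :
    ∫⁻ z, ∫⁻ ξ, growth p.toReal ξ ∂(κ (k + 1) z) ∂(baseMeasure τ lam (k + 1)) ≤
      (lam univ + (M : ℝ≥0∞) ^ p.toReal) ^ k * (lam univ + C) * τ univ := by
  have hq : 0 ≤ p.toReal := ENNReal.toReal_nonneg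
  have : SecondCountableTopology U := secondCountable_of_proper
  have hH : Continuous fun v : U => 1 + ‖v‖₊ ^ p.toReal := by
    have := NNReal.continuous_rpow_const hq
    fun_prop
  rw [baseMeasure, lintegral_prod _ measurable_growth.lintegral_kernel.aemeasurable,
    ← lintegral_const]
  refine lintegral_mono_ae ?_
  filter_upwards [hC, hd.ae_lintegral_le hp hκ (0 : Fin (k + 1)) hH] with t hC h
  have e (ξ : Fin (k + 1) → U) : growth p.toReal ξ =
      ((1 + ‖ξ 0‖₊ ^ p.toReal : ℝ≥0) : ℝ≥0∞) * growth p.toReal (ξ ∘ Fin.succAbove 0) := by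
    rw [growth, Fin.prod_univ_succAbove _ 0, ENNReal.coe_add, coe_nnnorm_rpow hq,
      ENNReal.coe_one]
    rfl
  simp_rw [e]
  refine h.trans (mul_le_mul_right ?_ _)
  have m1 (x : Fin 1 → X) : ∫⁻ ξ, ((1 + ‖ξ 0‖₊ ^ p.toReal : ℝ≥0) : ℝ≥0∞) ∂(κ 1 (t, x)) =
      1 + ∫⁻ ξ, ‖ξ 0‖ₑ ^ p.toReal ∂(κ 1 (t, x)) := by
    simp only [ENNReal.coe_add, coe_nnnorm_rpow hq, ENNReal.coe_one]
    rw [lintegral_add_left measurable_const, lintegral_const, measure_univ, one_mul]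
  simp_rw [m1]
  rw [lintegral_add_left measurable_const, lintegral_const, one_mul, Measure.pi_univ,
    Fin.prod_univ_one]
  exact add_le_add_right hC _

lemma HasBoundedDual.lintegral_incrementModulus_le (hd : HasBoundedDual τ lam p M κ) (hp : p ≠ ∞)
    (k : ℕ) (r : ℝ) :
    ∫⁻ t, incrementModulus lam p.toReal r (fun w => κ (2 + k) (t, w)) ∂τ ≤
      (lam univ + (M : ℝ≥0∞) ^ p.toReal) ^ k *
        ∫⁻ t, kModulus lam p.toReal r (fun x => κ 2 (t, x)) ∂τ := by
  rw [← lintegral_const_mul _ (measurable_kModulus _ _ _)]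
  refine lintegral_mono_ae ?_
  filter_upwards [hd] with t ⟨μ, hμ, hM, hdual⟩
  have hc (n : ℕ) : Measurable (Prod.mk t : (Fin n → X) → ℝ × (Fin n → X)) :=
    measurable_prodMk_left
  exact IsDualAt.incrementModulus_le hp (ρ₂ := (κ 2).comap (Prod.mk t) (hc _))
    (ρ := (κ (2 + k)).comap (Prod.mk t) (hc _)) hμ (hdual _ (by omega)) (hdual _ (by omega)) hM r

/-- The lost mass is distributed over the coordinates. In each term the remaining points are
decoupled, which leaves the tail of a single state, where the two-point estimate applies. -/
lemma HasBoundedDual.tailMass_le (hd : HasBoundedDual τ lam p M κ) (hp : p ≠ ∞)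
    (hκ : IsConsistentFamily τ lam κ) {r : ℝ} {b : ℝ≥0∞} (hb0 : b ≠ 0)
    (hb : ∀ᵐ x ∂lam, b ≤ lam (Metric.ball x r)) {L : ℝ≥0} (hL : 1 ≤ L) (k i : ℕ) :
    tailMass p.toReal i (baseMeasure τ lam (k + 1)) (κ (k + 1)) ≤
      (k + 1 : ℕ) * ((lam univ + (M : ℝ≥0∞) ^ p.toReal) ^ k *
        (((1 + L ^ p.toReal) * L * ((i : ℝ≥0) + 1)⁻¹ : ℝ≥0) * lam univ * τ univ +
          (2 * 2 ^ p.toReal : ℝ≥0) * (∫⁻ t, kModulus lam p.toReal r (fun x => κ 2 (t, x)) ∂τ +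
            (L⁻¹ : ℝ≥0) * (b⁻¹ *
              ∫⁻ z, ∫⁻ ξ, growth p.toReal ξ ∂(κ 2 z) ∂(baseMeasure τ lam 2))))) := by
  have hq1 : 1 ≤ p.toReal := by
    simpa using ENNReal.toReal_mono hp (Fact.out : 1 ≤ p)
  have hq : 0 ≤ p.toReal := by linarith
  have : SecondCountableTopology U := secondCountable_of_proper
  have hB : (lam univ + (M : ℝ≥0∞) ^ p.toReal) ^ k ≠ ∞ := ENNReal.pow_ne_top
    (ENNReal.add_ne_top.2 ⟨measure_ne_top _ _, ENNReal.rpow_ne_top_of_nonneg hq (by simp)⟩)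
  have hbt : b⁻¹ ≠ ∞ := ENNReal.inv_ne_top.2 hb0
  let H : U → ℝ≥0 := fun v => tailWeight i ‖v‖₊ * (1 + ‖v‖₊ ^ p.toReal)
  have hH : Continuous H := by
    have := NNReal.continuous_rpow_const hq
    have h2 := continuous_tailWeight i
    fun_prop
  have hfm (l : Fin (k + 1)) : Measurable fun ξ : Fin (k + 1) → U =>
      (H (ξ l) : ℝ≥0∞) * growth p.toReal (ξ ∘ l.succAbove) :=
    (hH.measurable.comp (measurable_pi_apply l)).coe_nnreal_ennreal.mul
      (measurable_growth.comp (measurable_comp_index _))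
  have hpt (ξ : Fin (k + 1) → U) : ((1 - tent i ξ : ℝ≥0) : ℝ≥0∞) * growth p.toReal ξ ≤
      ∑ l, (H (ξ l) : ℝ≥0∞) * growth p.toReal (ξ ∘ l.succAbove) := by
    have h1 : (1 - tent i ξ) * nngrowth p.toReal ξ ≤
        ∑ l, H (ξ l) * nngrowth p.toReal (ξ ∘ l.succAbove) := by
      refine (mul_le_mul_left (one_sub_tent_le i ξ) _).trans (le_of_eq ?_)
      rw [Finset.sum_mul]
      refine Finset.sum_congr rfl fun l _ => ?_
      rw [nngrowth, Fin.prod_univ_succAbove _ l, ← mul_assoc]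
      rfl
    have h2 := ENNReal.coe_le_coe.2 h1
    simpa only [ENNReal.coe_mul, ENNReal.ofNNReal_finsetSum, coe_nngrowth hq] using h2
  have mk (l : Fin (k + 1)) : Measurable fun z =>
      ∫⁻ ξ, H (ξ l) * growth p.toReal (ξ ∘ l.succAbove) ∂(κ (k + 1) z) :=
    (hfm l).lintegral_kernel
  have m2 : Measurable fun z => ∫⁻ ξ, growth p.toReal ξ ∂(κ 2 z) :=
    measurable_growth.lintegral_kernel
  have mmod : Measurable fun t => kModulus lam p.toReal r (fun x => κ 2 (t, x)) :=
    measurable_kModulus _ _ _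
  calc tailMass p.toReal i (baseMeasure τ lam (k + 1)) (κ (k + 1))
      ≤ ∫⁻ z, ∫⁻ ξ, ∑ l, (H (ξ l) : ℝ≥0∞) * growth p.toReal (ξ ∘ l.succAbove) ∂(κ (k + 1) z)
          ∂(baseMeasure τ lam (k + 1)) :=
        lintegral_mono fun z => lintegral_mono hpt
    _ = ∑ l, ∫⁻ t, ∫⁻ x, ∫⁻ ξ, H (ξ l) * growth p.toReal (ξ ∘ l.succAbove)
          ∂(κ (k + 1) (t, x)) ∂(Measure.pi fun _ => lam) ∂τ := by
        simp_rw [lintegral_finsetSum _ fun l _ => hfm l]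
        rw [lintegral_finsetSum _ fun l _ => mk l]
        refine Finset.sum_congr rfl fun l _ => ?_
        rw [baseMeasure, lintegral_prod _ (mk l).aemeasurable]
    _ ≤ ∑ _l : Fin (k + 1), ∫⁻ t, (lam univ + (M : ℝ≥0∞) ^ p.toReal) ^ k *
          (((1 + L ^ p.toReal) * L * ((i : ℝ≥0) + 1)⁻¹ : ℝ≥0) * lam univ +
          (2 * 2 ^ p.toReal : ℝ≥0) * (kModulus lam p.toReal r (fun x => κ 2 (t, x)) +
            (L⁻¹ : ℝ≥0) * (b⁻¹ *
              ∫⁻ w, ∫⁻ ξ, growth p.toReal ξ ∂(κ 2 (t, w)) ∂(Measure.pi fun _ => lam)))) ∂τ := by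
        refine Finset.sum_le_sum fun l _ => lintegral_mono_ae ?_
        have hinj0 : Function.Injective ![(0 : Fin 2)] := by decide
        filter_upwards [hd.ae_lintegral_le hp hκ l hH, ae_ae_of_ae_base (hκ.marginal hinj0)]
          with t h1 h2
        refine h1.trans (mul_le_mul_right ?_ _)
        have hc (n : ℕ) : Measurable (Prod.mk t : (Fin n → X) → ℝ × (Fin n → X)) :=
          measurable_prodMk_left
        exact lintegral_tailWeight_le hq1 i hL (ρ₁ := (κ 1).comap (Prod.mk t) (hc _))
          (ρ₂ := (κ 2).comap (Prod.mk t) (hc _)) h2 hb0 hb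
    _ = _ := by
        rw [Finset.sum_const, Finset.card_univ, Fintype.card_fin, nsmul_eq_mul,
          lintegral_const_mul' _ _ hB, lintegral_add_left measurable_const, lintegral_const,
          lintegral_const_mul' _ _ ENNReal.coe_ne_top, lintegral_add_left mmod,
          lintegral_const_mul' _ _ ENNReal.coe_ne_top, lintegral_const_mul' _ _ hbt,
          baseMeasure, lintegral_prod _ m2.aemeasurable]

variable [NormedSpace ℝ U]

/-- Strong convergence of the time integrals of an observable along a weakly convergent sequence of
families with dual measures on a ball of `L^p`. -/
theorem StableTendsto.tendsto_lintegral_enorm_observable_of_dual (hp : p ≠ ∞)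
    {κ : ℕ → ∀ k : ℕ, Kernel (ℝ × (Fin k → X)) (Fin k → U)}
    {κ' : ∀ k : ℕ, Kernel (ℝ × (Fin k → X)) (Fin k → U)}
    [∀ j k, IsMarkovKernel (κ j k)] [∀ k, IsMarkovKernel (κ' k)]
    (h : ∀ k, StableTendsto (baseMeasure τ lam k) (fun j => κ j k) (κ' k))
    (hκ : ∀ j, IsConsistentFamily τ lam (κ j)) (hκ' : IsConsistentFamily τ lam κ')
    (hd : ∀ j, HasBoundedDual τ lam p M (κ j)) {C₀ : ℝ≥0∞} (hC₀ : C₀ ≠ ∞)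
    (hC : ∀ j, ∀ᵐ t ∂τ, kMoment lam p.toReal (fun x => κ j 1 (t, x)) ≤ C₀)
    {C C' : ℝ≥0} {k : ℕ} {G : ℝ → (Fin (k + 1) → U) → ℝ}
    (hG : IsProfile p.toReal C G) (hL : IsLipschitzProfile p.toReal C' G)
    (hmod : ∀ ε : ℝ≥0∞, 0 < ε → ∃ r : ℝ, 0 < r ∧ ∀ᶠ j in atTop,
      ∫⁻ t, kModulus lam p.toReal r (fun x => κ j 2 (t, x)) ∂τ ≤ ε)
    (hball : ∀ r : ℝ, 0 < r → ∃ b : ℝ≥0∞, b ≠ 0 ∧ ∀ᵐ x ∂lam, b ≤ lam (Metric.ball x r)) :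
    ∫⁻ z, ∫⁻ ξ, growth p.toReal ξ ∂(κ' (k + 1) z) ∂(baseMeasure τ lam (k + 1)) ≠ ∞ ∧
    Tendsto (fun j => ∫⁻ x, ‖∫ t, ∫ ξ, G t ξ ∂(κ j (k + 1) (t, x)) ∂τ -
      ∫ t, ∫ ξ, G t ξ ∂(κ' (k + 1) (t, x)) ∂τ‖ₑ ∂(Measure.pi fun _ => lam)) atTop (𝓝 0) := by
  have hq1 : 1 ≤ p.toReal := by
    simpa using ENNReal.toReal_mono hp (Fact.out : 1 ≤ p)
  have hq : 0 ≤ p.toReal := by linarith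
  set B : ℝ≥0∞ := lam univ + (M : ℝ≥0∞) ^ p.toReal with hBdef
  have hB : B ≠ ∞ :=
    ENNReal.add_ne_top.2 ⟨measure_ne_top _ _, ENNReal.rpow_ne_top_of_nonneg hq (by simp)⟩
  have hlam : lam univ ≠ ∞ := measure_ne_top _ _
  have hτ : τ univ ≠ ∞ := measure_ne_top _ _
  have hK (n : ℕ) : B ^ n * (lam univ + C₀) * τ univ ≠ ∞ := by finiteness
  have hmom (n j : ℕ) := (hd j).lintegral_growth_le hp (hκ j) (hC j) n
  have hBk : B ^ k ≠ ∞ := by finiteness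
  have main := StableTendsto.tendsto_lintegral_enorm_observable h hκ hκ' hq1 (C := C) (C' := C')
    (K := (B ^ k * (lam univ + C₀) * τ univ).toNNReal) hG hL
    (fun j => by rw [ENNReal.coe_toNNReal (hK k)]; exact hmom k j) ?_ ?_ hball
  · exact ⟨ne_top_of_le_ne_top ENNReal.coe_ne_top main.1, main.2⟩
  · intro ε hε
    obtain ⟨δ, hδ, h1⟩ := ENNReal.exists_nnreal_pos_mul_lt hBk hε.ne'
    obtain ⟨r, hr, hj⟩ := hmod δ (by exact_mod_cast hδ)
    refine ⟨r, hr, hj.mono fun j hj => ?_⟩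
    refine ((hd j).lintegral_incrementModulus_le hp k r).trans ?_
    exact (mul_le_mul_right hj _).trans (by rw [mul_comm]; exact h1.le)
  · intro ε hε
    have hε3 : ε / 3 ≠ 0 := (ENNReal.div_pos hε.ne' (by simp)).ne'
    let e : ℝ≥0 := 2 * 2 ^ p.toReal
    have hA : ((k + 1 : ℕ) : ℝ≥0∞) * (B ^ k * e) ≠ ∞ := by finiteness
    -- The scale r makes the modulus small and fixes the lower bound b of the ball measures. Next L
    -- compensates b⁻¹ in the two-point term, and finally i makes the contribution of states below L
    -- small.
    obtain ⟨δ, hδ, h1⟩ := ENNReal.exists_nnreal_pos_mul_lt hA hε3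
    obtain ⟨r, hr, hj⟩ := hmod δ (by exact_mod_cast hδ)
    obtain ⟨b, hb0, hb⟩ := hball r hr
    have hbt : b⁻¹ ≠ ∞ := ENNReal.inv_ne_top.2 hb0
    have hK1 := hK 1
    have hA2 : ((k + 1 : ℕ) : ℝ≥0∞) * (B ^ k * e) *
        (b⁻¹ * (B ^ 1 * (lam univ + C₀) * τ univ)) ≠ ∞ := by finiteness
    obtain ⟨δ₂, hδ₂, h2⟩ := ENNReal.exists_nnreal_pos_mul_lt hA2 hε3
    let L : ℝ≥0 := max 1 δ₂⁻¹
    have hL1 : 1 ≤ L := le_max_left _ _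
    have hLδ : L⁻¹ ≤ δ₂ := by
      rw [← inv_inv δ₂]
      exact inv_anti₀ (inv_pos.2 hδ₂) (le_max_right _ _)
    let D : ℝ≥0 := (1 + L ^ p.toReal) * L
    have hA3 : ((k + 1 : ℕ) : ℝ≥0∞) * (B ^ k * (D * lam univ * τ univ)) ≠ ∞ := by finiteness
    obtain ⟨δ₃, hδ₃, h3⟩ := ENNReal.exists_nnreal_pos_mul_lt hA3 hε3
    obtain ⟨i, hi⟩ := exists_nat_gt δ₃⁻¹
    have hiδ : ((i : ℝ≥0) + 1)⁻¹ ≤ δ₃ := by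
      rw [← inv_inv δ₃]
      exact inv_anti₀ (inv_pos.2 hδ₃) (hi.le.trans (le_add_of_nonneg_right zero_le))
    refine ⟨i, hj.mono fun j hj => ?_⟩
    refine ((hd j).tailMass_le hp (hκ j) hb0 hb hL1 k i).trans ?_
    calc _ ≤ ((k + 1 : ℕ) : ℝ≥0∞) * (B ^ k * ((D * δ₃ : ℝ≥0) * lam univ * τ univ +
          e * (δ + δ₂ * (b⁻¹ * (B ^ 1 * (lam univ + C₀) * τ univ))))) := by
          gcongr
          exact hmom 1 j
      _ = δ₃ * (((k + 1 : ℕ) : ℝ≥0∞) * (B ^ k * (D * lam univ * τ univ))) +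
          (δ * (((k + 1 : ℕ) : ℝ≥0∞) * (B ^ k * e)) + δ₂ * (((k + 1 : ℕ) : ℝ≥0∞) * (B ^ k * e) *
            (b⁻¹ * (B ^ 1 * (lam univ + C₀) * τ univ)))) := by
          rw [ENNReal.coe_mul]; ring
      _ ≤ ε / 3 + (ε / 3 + ε / 3) := add_le_add h3.le (add_le_add h1.le h2.le)
      _ = ε := by rw [← add_assoc, ENNReal.add_thirds]

end TimeDependent

/-! ### Bounds on bounded domains -/

section BoundedDomain

/-- This controls the modulus at times close to T, where smallness is not assumed. Convexity bounds
the increment by the moments at both points, and ball averages are bounded on L¹. The constant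
serves all families and radii. -/
lemma IsConsistentFamily.exists_ae_kModulus_le {E : Type*} [NormedAddCommGroup E]
    [NormedSpace ℝ E] [FiniteDimensional ℝ E] [MeasurableSpace E] [BorelSpace E] {lam : Measure E}
    [SigmaFinite lam] {U : Type*} [NormedAddCommGroup U] [SecondCountableTopology U]
    [MeasurableSpace U] [BorelSpace U] {τ : Measure ℝ} [SigmaFinite τ] {q : ℝ} (hq : 1 ≤ q) :
    ∃ c : ℝ≥0, ∀ κ : ∀ k : ℕ, Kernel (ℝ × (Fin k → E)) (Fin k → U), (∀ k, IsMarkovKernel (κ k)) →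
      IsConsistentFamily τ lam κ → ∀ᵐ t ∂τ, ∀ r,
        kModulus lam q r (fun x => κ 2 (t, x)) ≤ c * kMoment lam q (fun x => κ 1 (t, x)) := by
  have : ProperSpace E := FiniteDimensional.proper ℝ E
  have : SecondCountableTopology E := secondCountable_of_proper
  obtain ⟨n, hn⟩ := exists_lintegral_ballWeight_left_le E
  refine ⟨2 ^ (q - 1) * (1 + n), fun κ hM hκ => ?_⟩
  have hinj0 : Function.Injective ![(0 : Fin 2)] := by decide
  have hinj1 : Function.Injective ![(1 : Fin 2)] := by decide
  filter_upwards [ae_ae_of_ae_base (hκ.marginal hinj0), ae_ae_of_ae_base (hκ.marginal hinj1)]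
    with t h0 h1 r
  let a : (Fin 1 → E) → ℝ≥0∞ := fun x => ∫⁻ ξ, ‖ξ 0‖ₑ ^ q ∂(κ 1 (t, x))
  have ha : Measurable a := by
    have h : Measurable fun z : ℝ × (Fin 1 → E) => ∫⁻ ξ, ‖ξ 0‖ₑ ^ q ∂(κ 1 z) :=
      Measurable.lintegral_kernel (by fun_prop)
    exact h.comp measurable_prodMk_left
  have hmb : Measurable fun w : Fin 2 → E => ballWeight lam r (w 0) (w 1) :=
    measurable_ballWeight_apply r 0 1
  have ha0 : Measurable fun w : Fin 2 → E => a ![w 0] :=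
    ha.comp (measurable_vecCons (by fun_prop) measurable_const)
  have ha1 : Measurable fun w : Fin 2 → E => a ![w 1] :=
    ha.comp (measurable_vecCons (by fun_prop) measurable_const)
  have hav : Measurable fun x : E => a ![x] :=
    ha.comp (measurable_vecCons measurable_id measurable_const)
  have hmom : ∫⁻ x, a ![x] ∂lam = kMoment lam q (fun x => κ 1 (t, x)) :=
    (lintegral_pi_fin_one ha).symm
  calc kModulus lam q r (fun x => κ 2 (t, x))
      ≤ ∫⁻ w : Fin 2 → E, (2 ^ (q - 1) : ℝ≥0) * (ballWeight lam r (w 0) (w 1) * a ![w 0] +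
          ballWeight lam r (w 0) (w 1) * a ![w 1]) ∂(Measure.pi fun _ => lam) := by
        refine lintegral_mono_ae ?_
        filter_upwards [h0, h1] with w h0 h1
        have e0 : w ∘ ![(0 : Fin 2)] = ![w 0] := by ext i; fin_cases i; rfl
        have e1 : w ∘ ![(1 : Fin 2)] = ![w 1] := by ext i; fin_cases i; rfl
        simp only [e0] at h0
        simp only [e1] at h1
        simp only [a]
        rw [h0, h1, lintegral_map (by fun_prop) (measurable_comp_index _),
          lintegral_map (by fun_prop) (measurable_comp_index _), ← mul_add, mul_left_comm,
          ← lintegral_add_left (by fun_prop), ← lintegral_const_mul' _ _ ENNReal.coe_ne_top]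
        refine mul_le_mul_right (lintegral_mono fun ξ => ?_) _
        exact (ENNReal.rpow_le_rpow enorm_sub_le (by linarith)).trans (rpow_add_le_two_mul hq _ _)
    _ = (2 ^ (q - 1) : ℝ≥0) * (∫⁻ x, ∫⁻ y, ballWeight lam r x y * a ![x] ∂lam ∂lam +
          ∫⁻ y, ∫⁻ x, ballWeight lam r x y * a ![y] ∂lam ∂lam) := by
        rw [lintegral_const_mul' _ _ ENNReal.coe_ne_top, lintegral_add_left (hmb.fun_mul ha0),
          lintegral_pi_fin_two (hmb.fun_mul ha0), lintegral_pi_fin_two (hmb.fun_mul ha1)]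
        congr 2
        refine lintegral_lintegral_swap (f := fun x y => ballWeight lam r x y * a ![y]) ?_
        exact ((measurable_ballWeight lam r).mul (hav.comp measurable_snd)).aemeasurable
    _ ≤ (2 ^ (q - 1) : ℝ≥0) * (∫⁻ x, 1 * a ![x] ∂lam + ∫⁻ y, n * a ![y] ∂lam) := by
        gcongr with x y
        · rw [lintegral_mul_const _ (measurable_ballWeight_right r x)]
          exact mul_le_mul_left (lintegral_ballWeight_right_le lam r x) _
        · have hm : Measurable fun x => ballWeight lam r x y :=
            (measurable_ballWeight lam r).comp measurable_prodMk_right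
          rw [lintegral_mul_const _ hm]
          exact mul_le_mul_left (hn lam r y) _
    _ = _ := by
        rw [lintegral_const_mul _ hav, lintegral_const_mul _ hav, hmom]
        push_cast
        ring

/-- Balls around the points of a bounded open set have measure bounded from below. -/
lemma exists_le_measure_ball {E : Type*} [PseudoMetricSpace E] [ProperSpace E]
    [MeasurableSpace E] [BorelSpace E] {vol : Measure E} [vol.IsOpenPosMeasure] {D : Set E}
    (hD : IsOpen D) (hDb : Bornology.IsBounded D) {r : ℝ} (hr : 0 < r) :
    ∃ b : ℝ≥0∞, b ≠ 0 ∧ ∀ᵐ x ∂(vol.restrict D), b ≤ vol.restrict D (Metric.ball x r) := by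
  have htb : TotallyBounded D := hDb.isCompact_closure.totallyBounded.subset subset_closure
  -- Every ball of radius r around a point of D contains one of finitely many half-balls with
  -- centres in D, and these have positive measure.
  obtain ⟨t, htD, htfin, ht⟩ := Metric.finite_approx_of_totallyBounded htb (r / 2) (by positivity)
  refine ⟨htfin.toFinset.inf fun c => vol.restrict D (Metric.ball c (r / 2)), ?_, ?_⟩
  · refine (Finset.lt_inf_iff ENNReal.zero_lt_top).2 (fun c hc => ?_) |>.ne'
    rw [Measure.restrict_apply Metric.isOpen_ball.measurableSet]
    exact (Metric.isOpen_ball.inter hD).measure_pos _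
      ⟨c, Metric.mem_ball_self (by positivity), htD (htfin.mem_toFinset.1 hc)⟩
  · filter_upwards [ae_restrict_mem hD.measurableSet] with x hx
    obtain ⟨c, hc, hxc⟩ := mem_iUnion₂.1 (ht hx)
    refine (Finset.inf_le (htfin.mem_toFinset.2 hc)).trans (measure_mono ?_)
    refine Metric.ball_subset_ball' ?_
    rw [Metric.mem_ball, dist_comm] at hxc
    linarith

end BoundedDomain

/-! ### Observables of correlation measures -/

section Bridge

variable {d N : ℕ} {p : ℝ≥0∞} {D : Set (EuclideanSpace ℝ (Fin d))} {T : EReal}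

lemma isFiniteMeasure_cmTimeMeasure (hT : T < ⊤) : IsFiniteMeasure (cmTimeMeasure T) := by
  refine ⟨?_⟩
  rw [cmTimeMeasure, Measure.restrict_apply_univ]
  refine (measure_mono (t := Ico 0 T.toReal) fun t ht => ⟨ht.1, ?_⟩).trans_lt (by
    rw [Real.volume_Ico]; exact ENNReal.ofReal_lt_top)
  have hb : T ≠ ⊥ := ne_bot_of_gt ht.2
  have h2 := ht.2
  rw [← EReal.coe_toReal hT.ne hb] at h2
  exact_mod_cast h2

lemma exists_cmTimeMeasure_tail_le (hT0 : 0 < T) (hT : T < ⊤) {η : ℝ≥0∞} (hη : 0 < η) :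
    ∃ T' : ℝ, 0 ≤ T' ∧ (T' : EReal) < T ∧
      cmTimeMeasure T (Ico 0 T')ᶜ ≤ η := by
  have hb : T ≠ ⊥ := (bot_le.trans_lt hT0).ne'
  obtain ⟨T₀, rfl⟩ : ∃ T₀ : ℝ, T = T₀ := ⟨T.toReal, (EReal.coe_toReal hT.ne hb).symm⟩
  have hT0' : 0 < T₀ := by exact_mod_cast hT0
  obtain ⟨e, he0, he⟩ : ∃ e : ℝ≥0, 0 < e ∧ (e : ℝ≥0∞) < η := by
    obtain ⟨e, he⟩ := ENNReal.lt_iff_exists_nnreal_btwn.1 hη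
    exact ⟨e, by exact_mod_cast he.1, he.2⟩
  refine ⟨max 0 (T₀ - e), le_max_left _ _, ?_, ?_⟩
  · have : (0 : ℝ) < e := by exact_mod_cast he0
    exact_mod_cast max_lt hT0' (by linarith)
  · rw [cmTimeMeasure, Measure.restrict_apply measurableSet_Ico.compl]
    refine (measure_mono (t := Icc (T₀ - e) T₀) fun t ht => ?_).trans ?_
    · have h1 : t < T₀ := by exact_mod_cast ht.2.2
      have h2 : ¬ (0 ≤ t ∧ t < max 0 (T₀ - e)) := ht.1
      have h3 := ht.2.1
      refine ⟨?_, h1.le⟩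
      by_contra h
      exact h2 ⟨h3, lt_max_of_lt_right (not_le.1 h)⟩
    · rw [Real.volume_Icc, sub_sub_cancel, ENNReal.ofReal_coe_nnreal]
      exact he.le

/-- The exceptional times for the representations at all k are united, so that one dual measure
serves every k. The bound M may be any real number, hence its positive part. -/
lemma IsDualTo.hasBoundedDual [Fact (1 ≤ p)]
    {ν : ∀ k : ℕ, ℝ → (Fin k → EuclideanSpace ℝ (Fin d)) →
      Measure (Fin k → EuclideanSpace ℝ (Fin N))} {μ : ℝ → CmLpMeasure p D N}
    (h : IsDualTo p D T ν μ) [IsFiniteMeasure (volume.restrict D : Measure (EuclideanSpace ℝ (Fin d)))]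
    {κ : ∀ k : ℕ, Kernel (ℝ × (Fin k → EuclideanSpace ℝ (Fin d)))
      (Fin k → EuclideanSpace ℝ (Fin N))}
    (hrep : ∀ k, 1 ≤ k →
      ∀ᵐ z ∂(baseMeasure (cmTimeMeasure T) (volume.restrict D) k), ν k z.1 z.2 = κ k z)
    {M : ℝ} (hM : ∀ᵐ t ∂(cmTimeMeasure T), ∀ᵐ u ∂(μ t), ‖u‖ ≤ M) :
    HasBoundedDual (cmTimeMeasure T) (volume.restrict D) p M.toNNReal κ := by
  have hrep' : ∀ᵐ t ∂(cmTimeMeasure T), ∀ k, 1 ≤ k →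
      ∀ᵐ x ∂(Measure.pi fun _ => volume.restrict D), ν k t x = κ k (t, x) := by
    refine ae_all_iff.2 fun k => ?_
    by_cases hk : 1 ≤ k
    · filter_upwards [ae_ae_of_ae_base (hrep k hk)] with t ht _ using ht
    · exact ae_of_all _ fun t h => absurd h hk
  filter_upwards [hrep', hM, h.duality, ae_mem_cmTime] with t h1 h2 h3 h4
  refine ⟨μ t, h.prob t h4, ?_, fun l hl g hg => ?_⟩
  · filter_upwards [h2] with u hu using hu.trans (Real.le_coe_toNNReal M)
  · have h5 := h3 l hl g (by rwa [cmSpaceMeasure_eq_pi])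
    rw [cmSpaceMeasure_eq_pi] at h5
    rw [← h5]
    refine integral_congr_ae ?_
    filter_upwards [h1 l hl] with x hx
    rw [hx]

section Observable

variable {k : ℕ} {ν ν' : ℝ → (Fin k → EuclideanSpace ℝ (Fin d)) →
      Measure (Fin k → EuclideanSpace ℝ (Fin N))}
  {κ κ' : Kernel (ℝ × (Fin k → EuclideanSpace ℝ (Fin d))) (Fin k → EuclideanSpace ℝ (Fin N))}
  [IsMarkovKernel κ] [IsMarkovKernel κ']
  {g : ℝ → (Fin k → EuclideanSpace ℝ (Fin d)) → (Fin k → EuclideanSpace ℝ (Fin N)) → ℝ}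
  {G : ℝ → (Fin k → EuclideanSpace ℝ (Fin N)) → ℝ} {q : ℝ} {C : ℝ≥0}

lemma ae_integral_observable_eq (hD : MeasurableSet D)
    (hrep : ∀ᵐ z ∂(baseMeasure (cmTimeMeasure T) (volume.restrict D) k), ν z.1 z.2 = κ z)
    (hg : ∀ᵐ t ∂(cmTimeMeasure T), ∀ x ∈ cmPower D k, ∀ ξ, g t x ξ = G t ξ) :
    ∀ᵐ z ∂(baseMeasure (cmTimeMeasure T) (volume.restrict D) k),
      ν z.1 z.2 = κ z ∧ g z.1 z.2 = G z.1 := by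
  have h1 := ae_mem_prod (T := T) hD k
  rw [cmSpaceTimeMeasure_eq] at h1
  have h2 : ∀ᵐ z ∂(baseMeasure (cmTimeMeasure T) (volume.restrict D) k),
      ∀ x ∈ cmPower D k, ∀ ξ, g z.1 x ξ = G z.1 ξ :=
    Measure.quasiMeasurePreserving_fst.ae hg
  filter_upwards [hrep, h1, h2] with z h0 h1 h2 using ⟨h0, funext (h2 _ h1.2)⟩

lemma observableIntegrable_of_profile (hD : MeasurableSet D)
    (hrep : ∀ᵐ z ∂(baseMeasure (cmTimeMeasure T) (volume.restrict D) k), ν z.1 z.2 = κ z)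
    (hg : ∀ᵐ t ∂(cmTimeMeasure T), ∀ x ∈ cmPower D k, ∀ ξ, g t x ξ = G t ξ)
    (hG : IsProfile q C G)
    (hκ : ∫⁻ z, ∫⁻ ξ, growth q ξ ∂(κ z)
      ∂(baseMeasure (cmTimeMeasure T) (volume.restrict D) k) ≠ ∞) :
    ObservableIntegrable D T k ν g := by
  have h := ae_integral_observable_eq hD hrep hg
  rw [ObservableIntegrable, cmSpaceTimeMeasure_eq]
  constructor
  · filter_upwards [h, ae_lintegral_growth_ne_top hκ] with z hz h2
    rw [hz.1, hz.2]
    exact hG.integrable h2 z.1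
  · refine (hG.integrable_integral hκ).congr ?_
    filter_upwards [h] with z hz
    rw [hz.1, hz.2]

/-- Finite growth makes both observables integrable on the product, so for a.e. x the time integral
of the difference splits. The a.e. identities, stated over (t,x), are swapped to hold for a.e. t at
a.e. x. -/
lemma integral_abs_observable_eq [IsFiniteMeasure (cmTimeMeasure T)]
    (hD : MeasurableSet D)
    (hrep : ∀ᵐ z ∂(baseMeasure (cmTimeMeasure T) (volume.restrict D) k), ν z.1 z.2 = κ z)
    (hrep' : ∀ᵐ z ∂(baseMeasure (cmTimeMeasure T) (volume.restrict D) k), ν' z.1 z.2 = κ' z)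
    (hg : ∀ᵐ t ∂(cmTimeMeasure T), ∀ x ∈ cmPower D k, ∀ ξ, g t x ξ = G t ξ)
    (hG : IsProfile q C G)
    (hκ : ∫⁻ z, ∫⁻ ξ, growth q ξ ∂(κ z)
      ∂(baseMeasure (cmTimeMeasure T) (volume.restrict D) k) ≠ ∞)
    (hκ' : ∫⁻ z, ∫⁻ ξ, growth q ξ ∂(κ' z)
      ∂(baseMeasure (cmTimeMeasure T) (volume.restrict D) k) ≠ ∞) :
    ∫ x, |∫ t, (∫ ξ, g t x ξ ∂(ν t x) - ∫ ξ, g t x ξ ∂(ν' t x)) ∂(cmTimeMeasure T)|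
        ∂(cmSpaceMeasure D k) =
      (∫⁻ x, ‖∫ t, ∫ ξ, G t ξ ∂(κ (t, x)) ∂(cmTimeMeasure T) -
        ∫ t, ∫ ξ, G t ξ ∂(κ' (t, x)) ∂(cmTimeMeasure T)‖ₑ
        ∂(Measure.pi fun _ => volume.restrict D)).toReal := by
  have h := ae_integral_observable_eq hD hrep hg
  have h' := ae_integral_observable_eq hD hrep' hg
  have hsw : ∀ᵐ x ∂(Measure.pi fun _ : Fin k => (volume.restrict D :
      Measure (EuclideanSpace ℝ (Fin d)))), ∀ᵐ t ∂(cmTimeMeasure T),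
      (ν t x = κ (t, x) ∧ g t x = G t) ∧ (ν' t x = κ' (t, x) ∧ g t x = G t) :=
    Measure.ae_ae_of_ae_prod (Measure.measurePreserving_swap.quasiMeasurePreserving.ae
      (h.and h'))
  have i1 := hG.integrable_integral hκ
  have i2 := hG.integrable_integral hκ'
  rw [← integral_norm_eq_lintegral_enorm, cmSpaceMeasure_eq_pi]
  · refine integral_congr_ae ?_
    filter_upwards [hsw, i1.prod_left_ae, i2.prod_left_ae] with x hx j1 j2
    rw [← integral_sub j1 j2, Real.norm_eq_abs]
    congr 1
    refine integral_congr_ae ?_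
    filter_upwards [hx] with t ht
    rw [ht.1.1, ht.1.2, ht.2.1]
  · exact ((hG.stronglyMeasurable_integral κ).integral_prod_left'.sub
      (hG.stronglyMeasurable_integral κ').integral_prod_left').aestronglyMeasurable

end Observable

end Bridge

end

/-! ### The limit family and its properties -/

theorem theorem2p9 {d N : ℕ} (p : ℝ≥0∞) [Fact (1 ≤ p)] (hp : p ≠ ∞)
    (D : Set (EuclideanSpace ℝ (Fin d))) (hDopen : IsOpen D) (hDconn : IsConnected D)
    (T : EReal) (hT : 0 < T)
    (ν : ℕ → ∀ k : ℕ, ℝ → (Fin k → EuclideanSpace ℝ (Fin d)) →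
      Measure (Fin k → EuclideanSpace ℝ (Fin N)))
    (hν : ∀ n, IsTimeDepCorrelationMeasure p D T (ν n))
    (c : ℝ) (hc : 0 < c)
    (hbound : ⨆ n, essSup (fun t => cmMoment p D (ν n 1 t)) (cmTimeMeasure T)
      ≤ ENNReal.ofReal c ^ p.toReal)
    (hdiag : ∀ T' : ℝ, 0 ≤ T' → (T' : EReal) < T →
      Tendsto (fun r : ℝ =>
          limsup (fun n => ∫⁻ t in Set.Ico 0 T', cmModulus p D r (ν n 2 t)) atTop)
        (𝓝[>] 0) (𝓝 0)) :
    ∃ s : ℕ → ℕ, StrictMono s ∧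
    ∃ ν' : ∀ k : ℕ, ℝ → (Fin k → EuclideanSpace ℝ (Fin d)) →
      Measure (Fin k → EuclideanSpace ℝ (Fin N)),
    IsTimeDepCorrelationMeasure p D T ν' ∧
    -- (i) weak* convergence
    (∀ k : ℕ, 1 ≤ k →
      ∀ g : ℝ × (Fin k → EuclideanSpace ℝ (Fin d)) → C₀(Fin k → EuclideanSpace ℝ (Fin N), ℝ),
        Integrable g (cmSpaceTimeMeasure D T k) →
        Tendsto (fun j => cmPairing D T k (ν (s j) k) g) atTop
          (𝓝 (cmPairing D T k (ν' k) g))) ∧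
    -- (ii) the moment bound
    (∀ᵐ t ∂(cmTimeMeasure T), cmMoment p D (ν' 1 t) ≤ ENNReal.ofReal c ^ p.toReal) ∧
    -- (iii) the moduli of continuity
    (∀ r : ℝ, 0 < r → ∀ T' : ℝ, 0 ≤ T' → (T' : EReal) < T →
      ∫⁻ t in Set.Ico 0 T', cmModulus p D r (ν' 2 t) ≤
        liminf (fun j => ∫⁻ t in Set.Ico 0 T', cmModulus p D r (ν (s j) 2 t)) atTop) ∧
    -- (iv) lower semicontinuity
    (∀ k : ℕ, 1 ≤ k →
      ∀ (φ : ℝ → (Fin k → EuclideanSpace ℝ (Fin d)) → ℝ)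
        (κ : (Fin k → EuclideanSpace ℝ (Fin N)) → ℝ),
        LocallyIntegrableOn (fun z : ℝ × (Fin k → EuclideanSpace ℝ (Fin d)) => φ z.1 z.2)
          (cmTime T ×ˢ cmPower D k) volume →
        (∀ t ∈ cmTime T, ∀ x ∈ cmPower D k, 0 ≤ φ t x) →
        Continuous κ → (∀ ξ, 0 ≤ κ ξ) →
        cmPairingNonneg D T k (ν' k) (fun t x ξ => φ t x * κ ξ) ≤
          liminf (fun j => cmPairingNonneg D T k (ν (s j) k) (fun t x ξ => φ t x * κ ξ))
            atTop) ∧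
    -- (v) strong convergence of observables
    (Bornology.IsBounded D → T < ⊤ →
      ∀ (M : ℝ) (μ : ℕ → ℝ → CmLpMeasure p D N),
        (∀ n, IsDualTo p D T (ν n) (μ n)) →
        (∀ n, ∀ᵐ t ∂(cmTimeMeasure T), ∀ᵐ u ∂(μ n t), ‖u‖ ≤ M) →
        ∀ (k : ℕ) (g : ℝ → (Fin (k + 1) → EuclideanSpace ℝ (Fin d)) →
            (Fin (k + 1) → EuclideanSpace ℝ (Fin N)) → ℝ),
          MemHOne p D T k g →
          (∀ n, ObservableIntegrable D T (k + 1) (ν n (k + 1)) g) ∧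
          ObservableIntegrable D T (k + 1) (ν' (k + 1)) g ∧
          Tendsto (fun j => ∫ x, |∫ t, (∫ ξ, g t x ξ ∂(ν (s j) (k + 1) t x) -
              ∫ ξ, g t x ξ ∂(ν' (k + 1) t x)) ∂(cmTimeMeasure T)| ∂(cmSpaceMeasure D (k + 1)))
            atTop (𝓝 0)) := by
  have hq1 : 1 ≤ p.toReal := by
    simpa using ENNReal.toReal_mono hp (Fact.out : 1 ≤ p)
  have hq : 0 ≤ p.toReal := by linarith
  have hDm : MeasurableSet D := hDopen.measurableSet
  obtain ⟨C, hCe⟩ : ∃ C : ℝ≥0, (C : ℝ≥0∞) = ENNReal.ofReal c ^ p.toReal :=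
    ⟨_, ENNReal.coe_toNNReal (ENNReal.rpow_ne_top_of_nonneg hq ENNReal.ofReal_ne_top)⟩
  rw [← hCe] at hbound ⊢
  have hC := ae_cmMoment_le hbound
  obtain ⟨s, κ, κ', hs, hκM, hκM', hκ, hκ', hrep, hlim⟩ :=
    exists_limit_kernels hp hDopen hDconn.nonempty hT hν hC
  have hrep' (k : ℕ) (_ : 1 ≤ k) : ∀ᵐ z ∂(baseMeasure (cmTimeMeasure T) (volume.restrict D) k),
      (fun (k : ℕ) (t : ℝ) (x : Fin k → EuclideanSpace ℝ (Fin d)) => κ' k (t, x)) k z.1 z.2 =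
        κ' k z := ae_of_all _ fun z => rfl
  have hkC (n : ℕ) : ∀ᵐ t ∂(cmTimeMeasure T),
      kMoment (volume.restrict D) p.toReal (fun x => κ n 1 (t, x)) ≤ C := by
    filter_upwards [hC n, ae_cmMoment_eq (p := p) (hrep n)] with t h1 h2 using h2 ▸ h1
  have hkC' := (hlim 1).ae_kMoment_le hq fun j => hkC (s j)
  have hlsc (r T' : ℝ) (hT' : (T' : EReal) < T) :
      ∫⁻ t in Ico 0 T', kModulus (volume.restrict D) p.toReal r (fun x => κ' 2 (t, x)) ≤
        liminf (fun j => ∫⁻ t in Ico 0 T', cmModulus p D r (ν (s j) 2 t)) atTop := by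
    simp_rw [setLIntegral_cmModulus_eq (hrep _) hT' r]
    rw [lintegral_kModulus]
    simp only [← coe_nnnorm_rpow hq]
    have : SFinite (modulusMeasure (volume.restrict (Ico 0 T'))
        (volume.restrict D : Measure (EuclideanSpace ℝ (Fin d))) r) := by
      unfold modulusMeasure; infer_instance
    exact (hlim 2).lintegral_le_liminf (modulusMeasure_absolutelyContinuous hT' r)
      (f := fun ξ => ‖ξ 0 - ξ 1‖₊ ^ p.toReal)
      (by have := NNReal.continuous_rpow_const hq; fun_prop)
  refine ⟨s, hs, fun k t x => κ' k (t, x), hκ'.isTimeDepCorrelationMeasure hp hDopen hkC' ?_,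
    ?_, ?_, ?_, ?_, ?_⟩
  · intro T' h0 h1
    refine tendsto_of_tendsto_of_tendsto_of_le_of_le tendsto_const_nhds (hdiag T' h0.le h1)
      (fun r => zero_le) fun r => (hlsc r T' h1).trans ?_
    -- The upper limit along the subsequence is at most that of the whole sequence, which tends to
    -- zero with r.
    refine (liminf_le_limsup).trans ?_
    exact limsup_le_limsup_of_le (u := fun n => ∫⁻ t in Ico 0 T', cmModulus p D r (ν n 2 t))
      hs.tendsto_atTop
  · intro k hk g hg
    rw [cmSpaceTimeMeasure_eq] at hg
    simp_rw [cmPairing_eq (hrep _) hk g]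
    rw [cmPairing_eq (ν := fun k t x => κ' k (t, x)) hrep' hk g]
    exact (hlim k).tendsto_integral_of_integrable (integrable_toBCF hg)
  · filter_upwards [hkC', ae_cmMoment_eq (p := p) (ν := fun k t x => κ' k (t, x)) hrep']
      with t h1 h2
    exact h2 ▸ h1
  · intro r _ T' _ hT'
    refine le_trans (le_of_eq ?_) (hlsc r T' hT')
    rw [setLIntegral_cmModulus_eq (ν := fun k t x => κ' k (t, x)) hrep' hT' r, lintegral_kModulus]
  · intro k hk φ f hφ hφ0 hf hf0
    have hφm : AEStronglyMeasurable
        (fun z : ℝ × (Fin k → EuclideanSpace ℝ (Fin d)) => φ z.1 z.2)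
        (baseMeasure (cmTimeMeasure T) (volume.restrict D) k) := by
      rw [← cmSpaceTimeMeasure_eq, cmSpaceTimeMeasure_eq_restrict]
      exact hφ.aestronglyMeasurable
    simp_rw [cmPairingNonneg_eq hDm (hrep _) hk hφm hφ0 hf]
    rw [cmPairingNonneg_eq (ν := fun k t x => κ' k (t, x)) hDm hrep' hk hφm hφ0 hf]
    exact (hlim k).lintegral_le_liminf (withDensity_absolutelyContinuous _ _)
      (f := fun ξ => (f ξ).toNNReal) (continuous_real_toNNReal.comp hf)
  · intro hDb hTt M μ hμ hM k g hg
    have : IsFiniteMeasure (volume.restrict D : Measure (EuclideanSpace ℝ (Fin d))) :=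
      ⟨by rw [Measure.restrict_apply_univ]; exact hDb.measure_lt_top⟩
    have := isFiniteMeasure_cmTimeMeasure hTt
    obtain ⟨G, C₁, hGm, hGc, hGb, hGl, hgG⟩ := hg.exists_profile hDopen hDconn hDb
    have hG : IsProfile p.toReal C₁ G := by
      refine ⟨hGm, hGc, fun t ξ => ?_⟩
      rw [← ofReal_norm, ← ofReal_prod_one_add hq, ← ENNReal.ofReal_coe_nnreal,
        ← ENNReal.ofReal_mul (NNReal.coe_nonneg _)]
      exact ENNReal.ofReal_le_ofReal (hGb t ξ)
    have hL : IsLipschitzProfile p.toReal C₁ G := hGl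
    have hd (n : ℕ) := (hμ n).hasBoundedDual (hrep n) (hM n)
    have hgrow (n : ℕ) : ∫⁻ z, ∫⁻ ξ, growth p.toReal ξ ∂(κ n (k + 1) z)
        ∂(baseMeasure (cmTimeMeasure T) (volume.restrict D) (k + 1)) ≠ ∞ := by
      refine ne_top_of_le_ne_top ?_ ((hd n).lintegral_growth_le hp (hκ n) (hkC n) k)
      have := measure_ne_top (volume.restrict D : Measure (EuclideanSpace ℝ (Fin d))) univ
      have := measure_ne_top (cmTimeMeasure T) univ
      have := ENNReal.rpow_ne_top_of_nonneg hq (ENNReal.coe_ne_top (r := M.toNNReal))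
      finiteness
    -- Diagonal continuity is assumed only on [0,T') with T' < T, whereas the observables are
    -- integrated up to T. The modulus is at most c₀·C at a.e. time, uniformly in n and r, so a
    -- short final interval contributes little.
    obtain ⟨c₀, hc₀⟩ := IsConsistentFamily.exists_ae_kModulus_le (U := EuclideanSpace ℝ (Fin N))
      (lam := (volume.restrict D : Measure (EuclideanSpace ℝ (Fin d)))) (τ := cmTimeMeasure T) hq1
    have hmod (ε : ℝ≥0∞) (hε : 0 < ε) : ∃ r : ℝ, 0 < r ∧ ∀ᶠ j in atTop,
        ∫⁻ t, kModulus (volume.restrict D) p.toReal r (fun x => κ (s j) 2 (t, x))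
          ∂(cmTimeMeasure T) ≤ ε := by
      have hε2 : ε / 2 ≠ 0 := (ENNReal.half_pos hε.ne').ne'
      obtain ⟨η, hη, h1⟩ := ENNReal.exists_nnreal_pos_mul_lt
        (a := (c₀ * C : ℝ≥0)) ENNReal.coe_ne_top hε2
      obtain ⟨T', hT'0, hT'1, htail⟩ := exists_cmTimeMeasure_tail_le hT hTt
        (η := η) (by exact_mod_cast hη)
      obtain ⟨r, hr, hr0⟩ := (((hdiag T' hT'0 hT'1).eventually
        (gt_mem_nhds (pos_iff_ne_zero.2 hε2))).and self_mem_nhdsWithin).exists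
      refine ⟨r, hr0, ?_⟩
      filter_upwards [hs.tendsto_atTop.eventually (eventually_lt_of_limsup_lt hr)] with j hj
      rw [← lintegral_add_compl _ (measurableSet_Ico (a := (0 : ℝ)) (b := T')),
        ← ENNReal.add_halves ε]
      refine add_le_add (le_trans (le_of_eq ?_) hj.le) ?_
      · rw [restrict_Ico_cmTimeMeasure hT'1, setLIntegral_cmModulus_eq (hrep _) hT'1,
          lintegral_kModulus]
      · calc _ ≤ ∫⁻ t in (Ico 0 T')ᶜ, (c₀ * C : ℝ≥0) ∂(cmTimeMeasure T) := by
              refine lintegral_mono_ae (ae_restrict_of_ae ?_)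
              filter_upwards [hc₀ (κ (s j)) (hκM _) (hκ _), hkC (s j)] with t h2 h3
              rw [ENNReal.coe_mul]
              exact (h2 r).trans (mul_le_mul_right h3 _)
          _ ≤ _ := by
              rw [setLIntegral_const, mul_comm]
              exact (mul_le_mul_left htail _).trans h1.le
    obtain ⟨hgrow', hconv⟩ := StableTendsto.tendsto_lintegral_enorm_observable_of_dual hp hlim
      (fun j => hκ (s j)) hκ' (fun j => hd (s j)) ENNReal.coe_ne_top (fun j => hkC (s j)) hG hL
      hmod fun r hr => exists_le_measure_ball hDopen hDb hr
    have hk : 1 ≤ k + 1 := by omega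
    refine ⟨fun n => observableIntegrable_of_profile hDm (hrep n _ hk) hgG hG (hgrow n),
      observableIntegrable_of_profile hDm (hrep' _ hk) hgG hG hgrow', ?_⟩
    refine ((ENNReal.tendsto_toReal ENNReal.zero_ne_top).comp hconv).congr fun j => ?_
    exact (integral_abs_observable_eq (ν' := fun t x => κ' (k + 1) (t, x)) hDm (hrep _ _ hk)
      (hrep' _ hk) hgG hG (hgrow _) hgrow').symm
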